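/- **Setting.** For each sample size $n$ let $(X_i,Y_i)_{i=1,\dots,n}$ be i.i.d. copies of a pair $(X_0,Y_0)\in\mathbb{R}^p\times\mathbb{R}$; the dimension $p$, the law of $(X_0,Y_0)$, the loading $\xi\in\mathbb{R}^p\setminus\{0\}$ and all other objects may depend on $n$, and limits are taken as $n\to\infty$. No linear model is assumed to hold. Let $\bar\beta$ minimize $\beta\mapsto\mathbb{E}[\tfrac12(Y_0-X_0^{\mathrm T}\beta)^2]$ over $\mathbb{R}^p$, and put $\Sigma=\mathbb{E}[X_0X_0^{\mathrm T}]$, $\Omega^*=\Sigma^{-1}$, $V=\mathbb{E}[(\xi^{\mathrm T}\Omega^*X_0)^2(Y_0-X_0^{\mathrm T}\bar\beta)^2]$, $s_0=\|\bar\beta\|_0$, $s_{1j}=\|\Omega^*_{\cdot j}\|_0$, $s_1=\max_j s_{1j}$, $s_{1\xi}=(s_{1j}: \xi_j\neq 0)$, $\tau_n=\log(p\vee n)/\sqrt n$, $\lambda_n=\sqrt{\log(p\vee n)/n}$, where $\|\cdot\|_0$ counts nonzero entries. For a random variable $z$, $\|z\|_{\psi_2}=\inf\{t>0:\mathbb{E}\exp(z^2/t^2)\le2\}$,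 and for a random vector $Z$, $\|Z\|_{\psi_2}=\sup_{a\ne0}\|a^{\mathrm T}Z/\|a\|_2\|_{\psi_2}$. **Estimators.** Let $\{1,\dots,n\}=J\cup J^c$ be a deterministic split with $|J|>\rho n$ and $|J^c|>\rho n$ for all large $n$, where $0<\rho<1$ is fixed. For $I\in\{J,J^c\}$ put $\hat\Sigma_I=|I|^{-1}\sum_{i\in I}X_iX_i^{\mathrm T}$. With a tuning parameter $\rho_n>0$, the two-stage algorithm takes $$\hat G^I\in\operatorname*{argmin}_{G\in\mathbb{R}^{p\times p}}\ \tfrac12\operatorname{Tr}(G^{\mathrm T}\hat\Sigma_IG)-\operatorname{Tr}(G)+\rho_n\sum_{k,l}|G_{kl}|,$$ $$\hat\Omega^I\in\operatorname*{argmin}_{G=G^{\mathrm T}}\ \|\hat G^I-G\|_1\quad\text{subject to}\quad\max_{k,l}|(\hat\Sigma_IG-I_p)_{kl}|\le\rho_n,$$ where $\|A\|_1=\max_l\sum_k|A_{kl}|$. Here $\hat\Omega^I$ is any measurable function of $(X_i)_{i\in I}$ that is an output of the algorithm whenever an output exists. Given an initial estimator $\hat\beta$ (any random vector subject to condition 4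 below), define $$\widehat{\xi^{\mathrm T}\beta}=\xi^{\mathrm T}\hat\beta+\xi^{\mathrm T}\hat\Omega^{J^c}\frac1n\sum_{i\in J}X_i(Y_i-X_i^{\mathrm T}\hat\beta)+\xi^{\mathrm T}\hat\Omega^{J}\frac1n\sum_{i\in J^c}X_i(Y_i-X_i^{\mathrm T}\hat\beta),$$ $$\hat V=\frac1n\sum_{i\in J}(\xi^{\mathrm T}\hat\Omega^{J^c}X_i)^2(Y_i-X_i^{\mathrm T}\hat\beta)^2+\frac1n\sum_{i\in J^c}(\xi^{\mathrm T}\hat\Omega^{J}X_i)^2(Y_i-X_i^{\mathrm T}\hat\beta)^2.$$ **Assumptions.** With positive constants $C_1,C_3,C_4,C_5,\sigma_1,\sigma_2$ not depending on $n$, for all large $n$: 1. $C_3\le\lambda_{\min}(\Omega^*)$ and $\lambda_{\max}(\Omega^*)\le C_4$; 2. $\|Y_0-X_0^{\mathrm T}\bar\beta\|_{\psi_2}\le\sigma_2$ and $\mathbb{E}[(Y_0-X_0^{\mathrm T}\bar\beta)^2\mid X_0]\ge C_5$; 3. every entry of $\Omega^*X_0$ has $\psi_2$-norm at most $\sigma_1$;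 4. with probability at least $1-\delta_1(n)$, where $\delta_1(n)\to0$, $\|\hat\beta-\bar\beta\|_1\le C_1s_0\lambda_n$ and $\frac1n\sum_{i=1}^n(X_i^{\mathrm T}\hat\beta-X_i^{\mathrm T}\bar\beta)^2\le C_1s_0\lambda_n^2$. No bound on $\|\Omega^*\|_1$ is assumed. **Theorem.** There is a constant $a_0>0$, depending only on $(\sigma_1,\rho)$, such that if $\rho_n=A_0\lambda_n$ with a constant $A_0\ge a_0$, then the following holds. (i) Suppose further that, for all large $n$, every entry of $X_0$ has $\psi_2$-norm at most $\sigma_1$ and $\|\xi^{\mathrm T}\Omega^*X_0\|_{\psi_2}\le\sigma_1\|\Omega^*\xi\|_2$. If $$\max\Big\{s_0,\ s_1\frac{\|\xi\|_1}{\|\xi\|_2},\ \min\{\sqrt{\|s_{1\xi}\|_0s_1},\,s_1\}\sqrt{s_0}\Big\}\,\tau_n\to0,$$ then $$\frac{\widehat{\xi^{\mathrm T}\beta}-\xi^{\mathrm T}\bar\beta}{\sqrt V}=\frac1n\sum_{i=1}^n\frac{(\xi^{\mathrm T}\Omega^*X_i)(Y_i-X_i^{\mathrm T}\bar\beta)}{\sqrt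 V}+o_p(n^{-1/2})\qquad\text{and}\qquad\frac{\hat V}{V}=1+o_p(1).$$ (ii) Suppose further that $\|X_0\|_{\psi_2}\le\sigma_1$ for all large $n$. If $$\max\Big\{s_0,\ \min\{\sqrt{\|s_{1\xi}\|_0s_1},\,s_1\}\sqrt{s_0\vee1}\Big\}\,\tau_n\to0,$$ then the same two conclusions hold. -/

import Mathlib

open Filter MeasureTheory ProbabilityTheory Topology Matrix
open scoped ENNReal

universe u

noncomputable section

namespace DebiasedLM

/-! ### Norms of vectors and matrices -/

/-- `‖a‖₀`: the number of nonzero entries. -/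
def zeroNorm {p : ℕ} (a : Fin p → ℝ) : ℕ := (Finset.univ.filter fun j => a j ≠ 0).card

/-- `‖a‖₁`. -/
def oneNorm {p : ℕ} (a : Fin p → ℝ) : ℝ := ∑ j, |a j|

/-- `‖a‖₂`. -/
def twoNorm {p : ℕ} (a : Fin p → ℝ) : ℝ := √(∑ j, a j ^ 2)

/-- `‖A‖_max`, the largest absolute value of an entry. -/
def matMaxNorm {p q : ℕ} (A : Matrix (Fin p) (Fin q) ℝ) : ℝ := ⨆ i, ⨆ j, |A i j|

/-- `‖A‖₁`, the operator norm for `ℓ₁`, i.e. the largest `ℓ₁` norm of a column. -/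
def matOneNorm {p q : ℕ} (A : Matrix (Fin p) (Fin q) ℝ) : ℝ := ⨆ j, oneNorm (fun i => A i j)

/-- `‖A‖_{L₁}`, the entrywise `ℓ₁` norm. -/
def matEntryOneNorm {p q : ℕ} (A : Matrix (Fin p) (Fin q) ℝ) : ℝ := ∑ i, ∑ j, |A i j|

/-! ### Sub-gaussian norms -/

/-- `‖z‖_{ψ₂} = inf {t > 0 : E exp (z² / t²) ≤ 2}`, equal to `∞` if there is no such `t`. -/
def psiTwoNorm {S : Type*} [MeasurableSpace S] (μ : Measure S) (z : S → ℝ) : ℝ≥0∞ :=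
  ⨅ (t : ℝ) (_ : 0 < t) (_ : ∫⁻ s, ENNReal.ofReal (Real.exp (z s ^ 2 / t ^ 2)) ∂μ ≤ 2),
    ENNReal.ofReal t

/-- `‖Z‖_{ψ₂} = sup_{a ≠ 0} ‖⟨a, Z⟩ / ‖a‖₂‖_{ψ₂}` for a random vector `Z`. -/
def vecPsiTwoNorm {S : Type*} [MeasurableSpace S] {p : ℕ} (μ : Measure S) (Z : S → Fin p → ℝ) :
    ℝ≥0∞ :=
  ⨆ (a : Fin p → ℝ) (_ : a ≠ 0), psiTwoNorm μ (fun s => (a ⬝ᵥ Z s) / twoNorm a)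

/-! ### The two-stage algorithm -/

/-- Objective of the first stage: `½ Tr(Gᵀ W G) - Tr(G) + r ‖G‖_{L₁}`. It is the sum over `j` of
the Lasso objectives `½ θᵀ W θ - θ_j + r ‖θ‖₁` of the columns `θ` of `G`. -/
def stageOneObjective {p : ℕ} (W : Matrix (Fin p) (Fin p) ℝ) (r : ℝ)
    (G : Matrix (Fin p) (Fin p) ℝ) : ℝ :=
  1 / 2 * (Gᵀ * W * G).trace - G.trace + r * matEntryOneNorm G

/-- `G` solves the first stage. -/
def IsStageOne {p : ℕ} (W : Matrix (Fin p) (Fin p) ℝ) (r : ℝ)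
    (G : Matrix (Fin p) (Fin p) ℝ) : Prop :=
  ∀ G', stageOneObjective W r G ≤ stageOneObjective W r G'

/-- Feasible points of the second stage. -/
def StageTwoFeasible {p : ℕ} (W : Matrix (Fin p) (Fin p) ℝ) (r : ℝ)
    (G : Matrix (Fin p) (Fin p) ℝ) : Prop :=
  G.IsSymm ∧ matMaxNorm (W * G - 1) ≤ r

/-- `O` solves the second stage for the first-stage solution `G`. -/
def IsStageTwo {p : ℕ} (W : Matrix (Fin p) (Fin p) ℝ) (r : ℝ)
    (G O : Matrix (Fin p) (Fin p) ℝ) : Prop :=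
  StageTwoFeasible W r O ∧
    ∀ O', StageTwoFeasible W r O' → matOneNorm (G - O) ≤ matOneNorm (G - O')

/-- `O` is an output of the two-stage algorithm with sample second-moment matrix `W` and tuning
parameter `r`. -/
def IsTwoStageOutput {p : ℕ} (W : Matrix (Fin p) (Fin p) ℝ) (r : ℝ)
    (O : Matrix (Fin p) (Fin p) ℝ) : Prop :=
  ∃ G, IsStageOne W r G ∧ IsStageTwo W r G O

/-! ### The model at sample size `n` -/

/-- A (possibly misspecified) linear model with `n` i.i.d. observations of `p` covariates and a
response, a loading `ξ`, the least-squares target `βbar`, a split `J`, `Jᶜ` of the sample, an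
initial estimator `βhat`, and estimators `ΩhatJ`, `ΩhatJc` of `Ω*` computed from the covariates
in `J` and in `Jᶜ` respectively. -/
structure LMModel (n : ℕ) where
  /-- the probability space -/
  S : Type u
  [mS : MeasurableSpace S]
  P : Measure S
  [isProb : IsProbabilityMeasure P]
  /-- the number of covariates -/
  p : ℕ
  /-- the law of the generic pair `(X₀, Y₀)` -/
  law : Measure ((Fin p → ℝ) × ℝ)
  [isProb_law : IsProbabilityMeasure law]
  X : Fin n → S → Fin p → ℝ
  Y : Fin n → S → ℝ
  measurable_X : ∀ i, Measurable (X i)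
  measurable_Y : ∀ i, Measurable (Y i)
  indep : iIndepFun (fun i s => (X i s, Y i s)) P
  map_eq : ∀ i, P.map (fun s => (X i s, Y i s)) = law
  ξ : Fin p → ℝ
  ξ_ne_zero : ξ ≠ 0
  βbar : Fin p → ℝ
  βbar_min : ∀ β : Fin p → ℝ,
    ∫ z, 1 / 2 * (z.2 - z.1 ⬝ᵥ βbar) ^ 2 ∂law ≤ ∫ z, 1 / 2 * (z.2 - z.1 ⬝ᵥ β) ^ 2 ∂law
  J : Finset (Fin n)
  βhat : S → Fin p → ℝ
  measurable_βhat : Measurable βhat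
  ΩhatJ : S → Matrix (Fin p) (Fin p) ℝ
  ΩhatJc : S → Matrix (Fin p) (Fin p) ℝ
  measurable_ΩhatJ : ∀ k l,
    Measurable[⨆ i ∈ J, MeasurableSpace.comap (X i) inferInstance] (fun s => ΩhatJ s k l)
  measurable_ΩhatJc : ∀ k l,
    Measurable[⨆ i ∈ Jᶜ, MeasurableSpace.comap (X i) inferInstance] (fun s => ΩhatJc s k l)

attribute [instance] LMModel.mS LMModel.isProb LMModel.isProb_law

namespace LMModel

variable {n : ℕ} (D : LMModel.{u} n)

/-- `Σ = E[X₀ X₀ᵀ]`. -/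
def secondMoment : Matrix (Fin D.p) (Fin D.p) ℝ :=
  Matrix.of fun k l => ∫ z, z.1 k * z.1 l ∂D.law

/-- `Ω* = Σ⁻¹`. -/
def Ωstar : Matrix (Fin D.p) (Fin D.p) ℝ := D.secondMoment⁻¹

/-- `s₀ = ‖βbar‖₀`. -/
def s₀ : ℕ := zeroNorm D.βbar

/-- `s₁ⱼ = ‖Ω*_{·j}‖₀`. -/
def s₁col (j : Fin D.p) : ℕ := zeroNorm (fun i => D.Ωstar i j)

/-- `s₁ = max_j s₁ⱼ`. -/
def s₁ : ℕ := Finset.univ.sup D.s₁col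

/-- `‖s_{1ξ}‖₀` for the vector `s_{1ξ} = (s₁ⱼ : j ∈ supp ξ)`. -/
def s₁ξzero : ℕ := (Finset.univ.filter fun j => D.ξ j ≠ 0 ∧ D.s₁col j ≠ 0).card

/-- `log (p ∨ n)`. -/
def logDim : ℝ := Real.log ((max D.p n : ℕ) : ℝ)

/-- `τ_n = log (p ∨ n) / √n`. -/
def τ : ℝ := D.logDim / √(n : ℝ)

/-- `λ_n = √(log (p ∨ n) / n)`. -/
def lam : ℝ := √(D.logDim / n)

/-- The asymptotic variance `V = E[(ξᵀ Ω* X₀)² (Y₀ - X₀ᵀ βbar)²]`. -/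
def V : ℝ := ∫ z, (D.ξ ⬝ᵥ D.Ωstar *ᵥ z.1) ^ 2 * (z.2 - z.1 ⬝ᵥ D.βbar) ^ 2 ∂D.law

/-- The sample second-moment matrix `(1/|I|) ∑_{i ∈ I} Xᵢ Xᵢᵀ`. -/
def sampleSecondMoment (I : Finset (Fin n)) (s : D.S) : Matrix (Fin D.p) (Fin D.p) ℝ :=
  (1 / (I.card : ℝ)) • ∑ i ∈ I, Matrix.vecMulVec (D.X i s) (D.X i s)

/-- The cross-fitted debiased estimator of `ξᵀ βbar`. -/
def debiased (s : D.S) : ℝ :=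
  D.ξ ⬝ᵥ D.βhat s
  + D.ξ ⬝ᵥ D.ΩhatJc s *ᵥ
      ((1 / (n : ℝ)) • ∑ i ∈ D.J, (D.Y i s - D.X i s ⬝ᵥ D.βhat s) • D.X i s)
  + D.ξ ⬝ᵥ D.ΩhatJ s *ᵥ
      ((1 / (n : ℝ)) • ∑ i ∈ D.Jᶜ, (D.Y i s - D.X i s ⬝ᵥ D.βhat s) • D.X i s)

/-- The cross-fitted estimator of `V`. -/
def Vhat (s : D.S) : ℝ :=
  1 / (n : ℝ) * ∑ i ∈ D.J,
      (D.ξ ⬝ᵥ D.ΩhatJc s *ᵥ D.X i s) ^ 2 * (D.Y i s - D.X i s ⬝ᵥ D.βhat s) ^ 2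
  + 1 / (n : ℝ) * ∑ i ∈ D.Jᶜ,
      (D.ξ ⬝ᵥ D.ΩhatJ s *ᵥ D.X i s) ^ 2 * (D.Y i s - D.X i s ⬝ᵥ D.βhat s) ^ 2

/-- The remainder in the expansion of the debiased estimator:
`(debiased - ξᵀ βbar) / √V - (1/n) ∑ᵢ (ξᵀ Ω* Xᵢ) (Yᵢ - Xᵢᵀ βbar) / √V`. -/
def remainder (s : D.S) : ℝ :=
  (D.debiased s - D.ξ ⬝ᵥ D.βbar) / √D.V
  - 1 / (n : ℝ) * ∑ i, (D.ξ ⬝ᵥ D.Ωstar *ᵥ D.X i s) * (D.Y i s - D.X i s ⬝ᵥ D.βbar) / √D.V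

/-! #### Assumptions -/

/-- The split is balanced up to constants: `|J| > ρ n` and `|Jᶜ| > ρ n`. -/
def SplitCondition (ρ : ℝ) : Prop := ρ * n < D.J.card ∧ ρ * n < D.Jᶜ.card

/-- Every entry of `X₀` is sub-gaussian with norm at most `σ₁`, and `ξᵀ Ω* X₀` is sub-gaussian
with norm at most `σ₁ ‖Ω* ξ‖₂`. -/
def SubGaussianEntries (σ₁ : ℝ) : Prop :=
  (∀ j, psiTwoNorm D.law (fun z => z.1 j) ≤ ENNReal.ofReal σ₁) ∧
  psiTwoNorm D.law (fun z => D.ξ ⬝ᵥ D.Ωstar *ᵥ z.1)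
    ≤ ENNReal.ofReal (σ₁ * twoNorm (D.Ωstar *ᵥ D.ξ))

/-- `X₀` is a sub-gaussian vector with norm at most `σ₁`. -/
def SubGaussianVector (σ₁ : ℝ) : Prop :=
  vecPsiTwoNorm D.law (fun z => z.1) ≤ ENNReal.ofReal σ₁

/-- `C₃ ≤ λ_min(Ω*)` and `λ_max(Ω*) ≤ C₄`. -/
def EigenvalueBounds (C₃ C₄ : ℝ) : Prop :=
  ∀ μ : ℝ, Module.End.HasEigenvalue (Matrix.toLin' D.Ωstar) μ → C₃ ≤ μ ∧ μ ≤ C₄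

/-- `Y₀ - X₀ᵀ βbar` is sub-gaussian with norm at most `σ₂`, and
`E[(Y₀ - X₀ᵀ βbar)² | X₀] ≥ C₅`. -/
def ResidualCondition (σ₂ C₅ : ℝ) : Prop :=
  psiTwoNorm D.law (fun z => z.2 - z.1 ⬝ᵥ D.βbar) ≤ ENNReal.ofReal σ₂ ∧
  ∀ᵐ z ∂D.law, C₅ ≤ (D.law[fun z => (z.2 - z.1 ⬝ᵥ D.βbar) ^ 2 |
    MeasurableSpace.comap Prod.fst inferInstance]) z

/-- Every entry of `Ω* X₀` is sub-gaussian with norm at most `σ₁`. -/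
def SubGaussianPrecisionEntries (σ₁ : ℝ) : Prop :=
  ∀ j, psiTwoNorm D.law (fun z => (D.Ωstar *ᵥ z.1) j) ≤ ENNReal.ofReal σ₁

/-- The event on which the initial estimator attains the usual rates. -/
def initialEvent (C₁ : ℝ) : Set D.S :=
  {s | oneNorm (D.βhat s - D.βbar) ≤ C₁ * D.s₀ * √(D.logDim / n) ∧
    1 / (n : ℝ) * ∑ i, (D.X i s ⬝ᵥ D.βhat s - D.X i s ⬝ᵥ D.βbar) ^ 2
      ≤ C₁ * D.s₀ * (D.logDim / n)}

/-- `ΩhatJ` and `ΩhatJc` come from the two-stage algorithm with tuning parameter `r`, applied to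
the covariates in `J` and in `Jᶜ`. For some samples the optimization problems have no solution;
the estimators are unrestricted there. -/
def TwoStage (r : ℝ) : Prop :=
  ∀ s,
    ((∃ O, IsTwoStageOutput (D.sampleSecondMoment D.J s) r O) →
      IsTwoStageOutput (D.sampleSecondMoment D.J s) r (D.ΩhatJ s)) ∧
    ((∃ O, IsTwoStageOutput (D.sampleSecondMoment D.Jᶜ s) r O) →
      IsTwoStageOutput (D.sampleSecondMoment D.Jᶜ s) r (D.ΩhatJc s))

/-- `min {√(‖s_{1ξ}‖₀ s₁), s₁}`. -/
def minSparsity : ℝ := min (√((D.s₁ξzero : ℝ) * D.s₁)) (D.s₁ : ℝ)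

end LMModel

/-! ### Asymptotics along a sequence of models -/

/-- Some `δ(n) → 0` is such that the initial estimator attains its rates, with constant `C₁`, with
probability at least `1 - δ(n)`. -/
def InitialCondition (D : (n : ℕ) → LMModel.{u} n) (C₁ : ℝ) : Prop :=
  ∃ δ : ℕ → ℝ, Tendsto δ atTop (𝓝 0) ∧
    ∀ n, 1 - δ n ≤ (D n).P.real ((D n).initialEvent C₁)

/-- `Z_n = o_p(a_n)`. -/
def IsLittleOp (D : (n : ℕ) → LMModel.{u} n) (Z : (n : ℕ) → (D n).S → ℝ) (a : ℕ → ℝ) : Prop :=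
  ∀ ε : ℝ, 0 < ε → Tendsto (fun n => (D n).P {s | ε * |a n| < |Z n s|}) atTop (𝓝 0)

/-- The asymptotic expansion of the debiased estimator and the consistency of the variance
estimator: `remainder = o_p(n^{-1/2})` and `Vhat / V = 1 + o_p(1)`. -/
def ResultLM (D : (n : ℕ) → LMModel.{u} n) : Prop :=
  IsLittleOp D (fun n => (D n).remainder) (fun n => (n : ℝ) ^ (-(1 / 2 : ℝ))) ∧
  IsLittleOp D (fun n s => (D n).Vhat s / (D n).V - 1) (fun _ => 1)

end DebiasedLM

end

/-!
The error of the debiased estimator is a sum over the two folds. Write `Δ = βhat - βbar` for the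
error of the initial estimator, `ε` for the population residual and `v = ξᵀ (Ωhat - Ω*)` for the
error of the precision matrix, which is estimated on the other fold, in the direction of the
loading. After the leading term `ξᵀ Ω* Xᵢ εᵢ` is removed, a fold `I` contributes
(`LMModel.abs_foldError_le`)

* the error of `ξᵀ Ω*` in the sample debiasing equations, paired with `Δ`. The equations hold up to
  order `λ_n ‖ξ‖₂` in the maximum norm and `‖Δ‖₁` is of order `s₀ λ_n`, so this is of order
  `s₀ λ_n² = s₀ τ_n / √n`;
* the noise `n⁻¹ ∑ (vᵀ Xᵢ) εᵢ`. Given the other fold `v` is fixed, and the sum is centred by the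
  normal equations, so that Chebyshev's inequality applies with variance `E[(vᵀ X₀)² ε²]`;
* the product `n⁻¹ ∑ (vᵀ Xᵢ) (Xᵢᵀ Δ)`. By the Cauchy-Schwarz inequality it is controlled by the
  prediction error of `βhat` and by `n⁻¹ ∑ (vᵀ Xᵢ)²`, which is of order `‖v‖₂²`, again conditionally
  on the other fold.

As `V` is at least a multiple of `‖ξ‖₂²` (`LMModel.Regular.le_V`), all of this is `o_p(n^{-1/2})`
after division by `√V`. The variance estimator is a perturbation of an average of i.i.d. variables
with mean `V`, with the same error terms.

It remains to bound `v`. With high probability `Ω*` inverts the sample second-moment matrix `Σ̂` up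
to `ρ_n / 2` in each entry, since `X₀` and `Ω* X₀` have sub-gaussian entries; this is where the
lower bound on the tuning constant comes from. Hence both optimization problems have solutions. Each
column of the first stage is a Lasso problem, and under restricted convexity of `Σ̂` its `ℓ₁` error
is of order `s₁ ρ_n`. As `Ω*` is feasible for the second stage, the output inherits the bound for
its columns and, being symmetric, for its rows: this gives `‖v‖₁` and, by Schur's test, `‖v‖₂`.
Restricted convexity also bounds the columns in `ℓ₂`, which gives the alternative bound on `‖v‖₂`
for sparse `ξ` (`IsTwoStageOutput.error_bounds`).

Restricted convexity is where the two sets of assumptions differ. For sub-gaussian entries the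
maximum norm of `Σ̂ - Σ`, of order `λ_n`, serves as `ℓ₁` tolerance, which is harmless if
`s₁ λ_n → 0`. If only `s₁ λ_n² → 0` is known and the vector `X₀` is sub-gaussian, then `Σ̂ - Σ` is
bounded below on all sums of `m` signed basis vectors, by a one-sided tail bound and a union bound
with `m` of order `n / log (p ∨ n)`. Maurey's sparsification extends this to all vectors with an `ℓ₁`
tolerance of order `1 / m`, that is `λ_n²` (`neg_oneNorm_sq_le_quadForm`).
-/

namespace DebiasedLM

/-! ### Sub-gaussian variables -/

/-- `z` is sub-gaussian with scale `t`: `E exp (z² / t²) ≤ 2`. A bound `σ` on the `ψ₂`-norm, which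
is an infimum, gives this at every scale `t > σ`. -/
def SubGaussianAt {S : Type*} [MeasurableSpace S] (μ : Measure S) (z : S → ℝ) (t : ℝ) : Prop :=
  ∫⁻ s, ENNReal.ofReal (Real.exp (z s ^ 2 / t ^ 2)) ∂μ ≤ 2

section SubGaussian

variable {S : Type*} [MeasurableSpace S] {μ : Measure S}

lemma subGaussianAt_of_psiTwoNorm_le {z : S → ℝ} {σ t : ℝ} (ht : 0 < t) (hσ : σ < t)
    (h : psiTwoNorm μ z ≤ ENNReal.ofReal σ) : SubGaussianAt μ z t := by
  have h1 : psiTwoNorm μ z < ENNReal.ofReal t :=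
    h.trans_lt ((ENNReal.ofReal_lt_ofReal_iff ht).2 hσ)
  unfold psiTwoNorm at h1
  simp only [iInf_lt_iff] at h1
  obtain ⟨r, hr, h2, h3⟩ := h1
  have hrt : r < t := (ENNReal.ofReal_lt_ofReal_iff ht).1 h3
  refine le_trans (lintegral_mono fun s => ENNReal.ofReal_le_ofReal (Real.exp_le_exp.2 ?_)) h2
  gcongr

lemma SubGaussianAt.of_div {z : S → ℝ} {t c : ℝ} (h : SubGaussianAt μ (fun s => z s / c) t) :
    SubGaussianAt μ z (t * c) := by
  unfold SubGaussianAt at *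
  convert h using 5 with s
  rw [div_pow, mul_pow, div_div, mul_comm (c ^ 2)]

lemma SubGaussianAt.integrable_exp {z : S → ℝ} {t : ℝ} (hz : Measurable z)
    (h : SubGaussianAt μ z t) : Integrable (fun s => Real.exp (z s ^ 2 / t ^ 2)) μ := by
  refine ⟨by fun_prop, ?_⟩
  rw [hasFiniteIntegral_iff_ofReal (Eventually.of_forall fun s => (Real.exp_pos _).le)]
  exact lt_of_le_of_lt h (by simp)

lemma SubGaussianAt.integral_exp_le {z : S → ℝ} {t : ℝ}
    (h : SubGaussianAt μ z t) : ∫ s, Real.exp (z s ^ 2 / t ^ 2) ∂μ ≤ 2 := by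
  by_cases hm : AEStronglyMeasurable (fun s => Real.exp (z s ^ 2 / t ^ 2)) μ
  · rw [integral_eq_lintegral_of_nonneg_ae (Eventually.of_forall fun s => (Real.exp_pos _).le) hm]
    exact ENNReal.toReal_le_of_le_ofReal (by norm_num) (by simpa [SubGaussianAt] using h)
  · rw [integral_undef fun hi => hm hi.1]; norm_num

lemma even_pow_le_exp {x t : ℝ} (ht : 0 < t) (k : ℕ) :
    x ^ (2 * k) ≤ k.factorial * t ^ (2 * k) * Real.exp (x ^ 2 / t ^ 2) := by
  have h := Real.pow_div_factorial_le_exp (x ^ 2 / t ^ 2) (by positivity) k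
  rw [div_le_iff₀ (by positivity), div_pow, ← pow_mul, ← pow_mul, div_le_iff₀ (by positivity)] at h
  linarith

lemma SubGaussianAt.integrable_pow {z : S → ℝ} {t : ℝ} (ht : 0 < t) (hz : Measurable z)
    (h : SubGaussianAt μ z t) (k : ℕ) : Integrable (fun s => z s ^ (2 * k)) μ := by
  refine ((h.integrable_exp hz).const_mul (k.factorial * t ^ (2 * k))).mono' (by fun_prop) ?_
  filter_upwards with s
  rw [Real.norm_of_nonneg (by rw [pow_mul]; positivity)]
  exact even_pow_le_exp ht k

lemma SubGaussianAt.integral_pow_le {z : S → ℝ} {t : ℝ} (ht : 0 < t) (hz : Measurable z)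
    (h : SubGaussianAt μ z t) (k : ℕ) :
    ∫ s, z s ^ (2 * k) ∂μ ≤ 2 * k.factorial * t ^ (2 * k) := by
  calc ∫ s, z s ^ (2 * k) ∂μ
      ≤ ∫ s, k.factorial * t ^ (2 * k) * Real.exp (z s ^ 2 / t ^ 2) ∂μ :=
        integral_mono (h.integrable_pow ht hz k) ((h.integrable_exp hz).const_mul _)
          fun s => even_pow_le_exp ht k
    _ = k.factorial * t ^ (2 * k) * ∫ s, Real.exp (z s ^ 2 / t ^ 2) ∂μ := integral_const_mul _ _
    _ ≤ k.factorial * t ^ (2 * k) * 2 := by gcongr; exact h.integral_exp_le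
    _ = _ := by ring

/-- A product of two sub-gaussian variables has an exponential moment. -/
lemma integrable_exp_abs_mul {x y : S → ℝ} {a b : ℝ} (ha : 0 < a) (hb : 0 < b)
    (hx : Measurable x) (hy : Measurable y) (h1 : SubGaussianAt μ x a) (h2 : SubGaussianAt μ y b) :
    Integrable (fun s => Real.exp |x s * y s / (a * b)|) μ ∧
      ∫ s, Real.exp |x s * y s / (a * b)| ∂μ ≤ 2 := by
  have hI : Integrable (fun s => (Real.exp (x s ^ 2 / a ^ 2) + Real.exp (y s ^ 2 / b ^ 2)) / 2) μ :=
    ((h1.integrable_exp hx).add (h2.integrable_exp hy)).div_const 2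
  have hle : ∀ s, Real.exp |x s * y s / (a * b)| ≤
      (Real.exp (x s ^ 2 / a ^ 2) + Real.exp (y s ^ 2 / b ^ 2)) / 2 := by
    intro s
    have e1 : |x s * y s / (a * b)| = |x s / a| * |y s / b| := by
      rw [← abs_mul]; congr 1; field_simp
    have e2 : x s ^ 2 / a ^ 2 = |x s / a| ^ 2 := by rw [sq_abs, div_pow]
    have e3 : y s ^ 2 / b ^ 2 = |y s / b| ^ 2 := by rw [sq_abs, div_pow]
    rw [e1, e2, e3]
    set p := |x s / a|
    set q := |y s / b|
    have e4 : Real.exp (p * q) ≤ Real.exp (p ^ 2 / 2) * Real.exp (q ^ 2 / 2) := by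
      rw [← Real.exp_add]; exact Real.exp_le_exp.2 (by nlinarith [sq_nonneg (p - q)])
    have e5 : Real.exp (p ^ 2) = Real.exp (p ^ 2 / 2) ^ 2 := by
      rw [← Real.exp_nat_mul]; congr 1; push_cast; ring
    have e6 : Real.exp (q ^ 2) = Real.exp (q ^ 2 / 2) ^ 2 := by
      rw [← Real.exp_nat_mul]; congr 1; push_cast; ring
    rw [e5, e6]
    nlinarith [sq_nonneg (Real.exp (p ^ 2 / 2) - Real.exp (q ^ 2 / 2))]
  have hi : Integrable (fun s => Real.exp |x s * y s / (a * b)|) μ := by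
    refine hI.mono' (by fun_prop) ?_
    filter_upwards with s
    rw [Real.norm_of_nonneg (Real.exp_pos _).le]
    exact hle s
  refine ⟨hi, (integral_mono hi hI hle).trans ?_⟩
  rw [integral_div, integral_add (h1.integrable_exp hx) (h2.integrable_exp hy)]
  linarith [h1.integral_exp_le, h2.integral_exp_le]

lemma SubGaussianAt.integrable_mul {x y : S → ℝ} {a b : ℝ} (ha : 0 < a) (hb : 0 < b)
    (hx : Measurable x) (hy : Measurable y) (h1 : SubGaussianAt μ x a) (h2 : SubGaussianAt μ y b) :
    Integrable (fun s => x s * y s) μ := by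
  refine ((h1.integrable_pow ha hx 1).add (h2.integrable_pow hb hy 1)).mono' (by fun_prop) ?_
  filter_upwards with s
  rw [Real.norm_eq_abs, abs_le]
  simp only [Pi.add_apply, mul_one]
  constructor <;> nlinarith [sq_nonneg (x s - y s), sq_nonneg (x s + y s)]

lemma abs_mul_abs_le {x y : ℝ} : |x * y| ≤ (x ^ 2 + y ^ 2) / 2 := by
  rw [abs_le]; constructor <;> nlinarith [sq_nonneg (x - y), sq_nonneg (x + y)]

/-- Second-order expansion of the exponential; the factor `8` pays for absorbing `w²` into `exp
|w|`. -/
lemma exp_mul_le {θ w : ℝ} (hθ : |θ| ≤ 1 / 2) :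
    Real.exp (θ * w) ≤ 1 + θ * w + 8 * θ ^ 2 * Real.exp |w| := by
  have h := Complex.norm_exp_sub_sum_le_norm_mul_exp ((θ * w : ℝ) : ℂ) 2
  have e : Complex.exp ((θ * w : ℝ) : ℂ) - ∑ m ∈ Finset.range 2, ((θ * w : ℝ) : ℂ) ^ m / m.factorial
      = ((Real.exp (θ * w) - (1 + θ * w) : ℝ) : ℂ) := by
    simp [Finset.sum_range_succ]
  rw [e, Complex.norm_real, Complex.norm_real, Real.norm_eq_abs, Real.norm_eq_abs] at h
  have h1 := (le_abs_self _).trans h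
  rw [sq_abs] at h1
  have h2 : |θ * w| ≤ |w| / 2 := by
    rw [abs_mul]; nlinarith [abs_nonneg w]
  have h3 : (|w| / 2) ^ 2 / 2 ≤ Real.exp (|w| / 2) := by
    simpa using Real.pow_div_factorial_le_exp (|w| / 2) (by positivity) 2
  have h4 : Real.exp |w| = Real.exp (|w| / 2) * Real.exp (|w| / 2) := by
    rw [← Real.exp_add]; congr 1; ring
  have h5 : (θ * w) ^ 2 * Real.exp |θ * w| ≤ 8 * θ ^ 2 * Real.exp |w| := by
    calc (θ * w) ^ 2 * Real.exp |θ * w| = θ ^ 2 * |w| ^ 2 * Real.exp |θ * w| := by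
          rw [mul_pow, sq_abs]
      _ ≤ θ ^ 2 * (8 * Real.exp (|w| / 2)) * Real.exp (|w| / 2) := by
          gcongr
          nlinarith
      _ = _ := by rw [h4]; ring
  linarith

/-- Moment generating function of a centred product of sub-gaussian variables near zero. -/
lemma lintegral_exp_mul_sub_le [IsProbabilityMeasure μ] {x y : S → ℝ} {a b θ : ℝ}
    (ha : 0 < a) (hb : 0 < b) (hx : Measurable x) (hy : Measurable y)
    (h1 : SubGaussianAt μ x a) (h2 : SubGaussianAt μ y b) (hθ : |θ| ≤ 1 / 2) :
    ∫⁻ s, ENNReal.ofReal (Real.exp (θ * ((x s * y s - ∫ r, x r * y r ∂μ) / (a * b)))) ∂μ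
      ≤ ENNReal.ofReal (Real.exp (16 * θ ^ 2)) := by
  obtain ⟨hi, hle⟩ := integrable_exp_abs_mul ha hb hx hy h1 h2
  have hxy : Integrable (fun s => x s * y s / (a * b)) μ :=
    (h1.integrable_mul ha hb hx hy h2).div_const _
  set m := ∫ r, x r * y r ∂μ with hm
  have hI : Integrable (fun s => 1 + θ * (x s * y s / (a * b))
      + 8 * θ ^ 2 * Real.exp |x s * y s / (a * b)|) μ :=
    ((integrable_const 1).add (hxy.const_mul θ)).add (hi.const_mul _)
  have hmain : ∫ s, (1 + θ * (x s * y s / (a * b))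
      + 8 * θ ^ 2 * Real.exp |x s * y s / (a * b)|) ∂μ
      ≤ Real.exp (θ * (m / (a * b)) + 16 * θ ^ 2) := by
    have hadd : Integrable (fun s => 1 + θ * (x s * y s / (a * b))) μ :=
      (integrable_const 1).add (hxy.const_mul θ)
    rw [integral_add hadd (hi.const_mul _), integral_add (integrable_const 1) (hxy.const_mul θ),
      integral_const_mul,
      integral_const_mul, integral_div, ← hm]
    simp only [integral_const, probReal_univ, smul_eq_mul, one_mul]
    have := Real.add_one_le_exp (θ * (m / (a * b)) + 16 * θ ^ 2)
    nlinarith [sq_nonneg θ]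
  have e : ∀ s, ENNReal.ofReal (Real.exp (θ * ((x s * y s - m) / (a * b))))
      ≤ ENNReal.ofReal (Real.exp (-(θ * (m / (a * b)))))
        * ENNReal.ofReal (1 + θ * (x s * y s / (a * b))
          + 8 * θ ^ 2 * Real.exp |x s * y s / (a * b)|) := by
    intro s
    rw [← ENNReal.ofReal_mul (Real.exp_pos _).le]
    apply ENNReal.ofReal_le_ofReal
    have : θ * ((x s * y s - m) / (a * b)) = -(θ * (m / (a * b))) + θ * (x s * y s / (a * b)) := by
      ring
    rw [this, Real.exp_add]
    gcongr
    exact exp_mul_le hθ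
  refine (lintegral_mono e).trans ?_
  rw [lintegral_const_mul' _ _ ENNReal.ofReal_ne_top, ← ofReal_integral_eq_lintegral_ofReal hI
    (Eventually.of_forall fun s => (Real.exp_pos _).le.trans (exp_mul_le hθ)),
    ← ENNReal.ofReal_mul (Real.exp_pos _).le]
  apply ENNReal.ofReal_le_ofReal
  calc _ ≤ Real.exp (-(θ * (m / (a * b)))) * Real.exp (θ * (m / (a * b)) + 16 * θ ^ 2) := by
        gcongr
    _ = _ := by rw [← Real.exp_add]; congr 1; ring

/-- Moment generating function of a nonnegative variable on the negative half-line. -/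
lemma lintegral_exp_neg_le [IsProbabilityMeasure μ] {q : S → ℝ} {θ M : ℝ}
    (hq0 : ∀ s, 0 ≤ q s) (hθ : 0 ≤ θ) (h1 : Integrable q μ)
    (h2 : Integrable (fun s => q s ^ 2) μ) (hM : ∫ s, q s ^ 2 ∂μ ≤ M) :
    ∫⁻ s, ENNReal.ofReal (Real.exp (-θ * q s)) ∂μ
      ≤ ENNReal.ofReal (Real.exp (-θ * ∫ s, q s ∂μ + θ ^ 2 * M / 2)) := by
  have key : ∀ x : ℝ, 0 ≤ x → Real.exp (-x) ≤ 1 - x + x ^ 2 / 2 := by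
    intro x hx
    have := Real.quadratic_le_exp_of_nonneg hx
    rw [Real.exp_neg, inv_le_iff_one_le_mul₀ (Real.exp_pos _)]
    have hpos : 0 ≤ 1 - x + x ^ 2 / 2 := by nlinarith [sq_nonneg (x - 1)]
    nlinarith [mul_le_mul_of_nonneg_left this hpos, sq_nonneg (x ^ 2)]
  have hI : Integrable (fun s => 1 - θ * q s + θ ^ 2 / 2 * q s ^ 2) μ :=
    ((integrable_const 1).sub (h1.const_mul θ)).add (h2.const_mul _)
  have e : ∀ s, Real.exp (-θ * q s) ≤ 1 - θ * q s + θ ^ 2 / 2 * q s ^ 2 := by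
    intro s
    have := key (θ * q s) (mul_nonneg hθ (hq0 s))
    rw [neg_mul]; linarith [mul_pow θ (q s) 2]
  refine (lintegral_mono fun s => ENNReal.ofReal_le_ofReal (e s)).trans ?_
  rw [← ofReal_integral_eq_lintegral_ofReal hI
    (Eventually.of_forall fun s => (Real.exp_pos _).le.trans (e s))]
  apply ENNReal.ofReal_le_ofReal
  have hsub : Integrable (fun s => 1 - θ * q s) μ := (integrable_const 1).sub (h1.const_mul θ)
  rw [integral_add hsub (h2.const_mul _), integral_sub (integrable_const 1) (h1.const_mul θ),
      integral_const_mul,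
      integral_const_mul]
  simp only [integral_const, probReal_univ, smul_eq_mul, one_mul]
  have := Real.add_one_le_exp (-θ * ∫ s, q s ∂μ + θ ^ 2 * M / 2)
  nlinarith [sq_nonneg θ]

end SubGaussian

/-! ### Deviation inequalities for i.i.d. samples -/

section Sample

variable {Ω ι β : Type*} [MeasurableSpace Ω] [MeasurableSpace β] {P : Measure Ω}
  {Z : ι → Ω → β} {law : Measure β}

lemma lintegral_sample (hZ : ∀ i, Measurable (Z i)) (hlaw : ∀ i, P.map (Z i) = law)
    {f : β → ℝ≥0∞} (hf : Measurable f) (i : ι) :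
    ∫⁻ s, f (Z i s) ∂P = ∫⁻ z, f z ∂law := by
  rw [← hlaw i, lintegral_map hf (hZ i)]

/-- Chernoff's bound for a sum of i.i.d. variables. -/
lemma measure_sum_ge_le_exp (hind : iIndepFun Z P) (hZ : ∀ i, Measurable (Z i))
    (hlaw : ∀ i, P.map (Z i) = law) {h : β → ℝ} (hh : Measurable h) {b : ℝ}
    (hb : ∫⁻ z, ENNReal.ofReal (Real.exp (h z)) ∂law ≤ ENNReal.ofReal (Real.exp b))
    (I : Finset ι) (c : ℝ) :
    P {s | c ≤ ∑ i ∈ I, h (Z i s)} ≤ ENNReal.ofReal (Real.exp (I.card * b - c)) := by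
  have hg : Measurable fun z => ENNReal.ofReal (Real.exp (h z)) := by fun_prop
  have h1 : ∫⁻ s, ∏ i ∈ I, ENNReal.ofReal (Real.exp (h (Z i s))) ∂P
      = ∏ i ∈ I, ∫⁻ s, ENNReal.ofReal (Real.exp (h (Z i s))) ∂P :=
    lintegral_prod_eq_prod_lintegral_of_indepFun I
      (fun i s => ENNReal.ofReal (Real.exp (h (Z i s))))
      (hind.comp (fun _ z => ENNReal.ofReal (Real.exp (h z))) fun _ => hg)
      fun i => hg.comp (hZ i)
  have h2 : ∫⁻ s, ENNReal.ofReal (Real.exp (∑ i ∈ I, h (Z i s))) ∂P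
      ≤ ENNReal.ofReal (Real.exp (I.card * b)) := by
    simp_rw [Real.exp_sum, ENNReal.ofReal_prod_of_nonneg fun i _ => (Real.exp_pos _).le]
    rw [h1]
    calc _ ≤ ∏ i ∈ I, ENNReal.ofReal (Real.exp b) := by
          gcongr with i hi
          rw [lintegral_sample hZ hlaw hg]; exact hb
      _ = _ := by
          rw [Finset.prod_const, ← ENNReal.ofReal_pow (Real.exp_pos _).le, ← Real.exp_nat_mul]
  have h3 := mul_meas_ge_le_lintegral₀ (μ := P)
    (f := fun s => ENNReal.ofReal (Real.exp (∑ i ∈ I, h (Z i s))))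
    (by fun_prop) (ENNReal.ofReal (Real.exp c))
  have h4 : {s | c ≤ ∑ i ∈ I, h (Z i s)} ⊆ {s | ENNReal.ofReal (Real.exp c)
      ≤ ENNReal.ofReal (Real.exp (∑ i ∈ I, h (Z i s)))} := fun s hs =>
    ENNReal.ofReal_le_ofReal (Real.exp_le_exp.2 hs)
  refine (measure_mono h4).trans ?_
  rw [Real.exp_sub, ENNReal.ofReal_div_of_pos (Real.exp_pos _),
    ENNReal.le_div_iff_mul_le (Or.inl (by simp [Real.exp_pos])) (Or.inl ENNReal.ofReal_ne_top),
    mul_comm]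
  exact h3.trans h2

/-- Bernstein's inequality for averages of products of sub-gaussian variables. -/
lemma measure_abs_sum_mul_sub_gt_le [IsProbabilityMeasure law]
    (hind : iIndepFun Z P) (hZ : ∀ i, Measurable (Z i))
    (hlaw : ∀ i, P.map (Z i) = law) {x y : β → ℝ} {a b : ℝ} (ha : 0 < a) (hb : 0 < b)
    (hx : Measurable x) (hy : Measurable y) (h1 : SubGaussianAt law x a)
    (h2 : SubGaussianAt law y b) {δ : ℝ} (hδ0 : 0 ≤ δ) (hδ : δ ≤ 16) (I : Finset ι) :
    P {s | I.card * (a * b * δ) < |∑ i ∈ I, (x (Z i s) * y (Z i s) - ∫ z, x z * y z ∂law)|}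
      ≤ ENNReal.ofReal (2 * Real.exp (-(I.card * δ ^ 2 / 64))) := by
  set m := ∫ z, x z * y z ∂law with hm
  -- `θ = ± δ / 32` minimises the exponent `16 θ² - |θ| δ` of the Chernoff bound
  have hside : ∀ θ : ℝ, |θ| = δ / 32 →
      P {s | I.card * (δ / 32 * δ) ≤ ∑ i ∈ I, θ * ((x (Z i s) * y (Z i s) - m) / (a * b))}
        ≤ ENNReal.ofReal (Real.exp (-(I.card * δ ^ 2 / 64))) := by
    intro θ hθ
    have := measure_sum_ge_le_exp hind hZ hlaw
      (h := fun z => θ * ((x z * y z - m) / (a * b))) (by fun_prop)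
      (lintegral_exp_mul_sub_le ha hb hx hy h1 h2 (by rw [hθ]; linarith)) I
      (I.card * (δ / 32 * δ))
    refine this.trans (le_of_eq ?_)
    have : θ ^ 2 = (δ / 32) ^ 2 := by rw [← sq_abs, hθ]
    rw [this]; congr 2; ring
  have hab : 0 < a * b := by positivity
  have hsub : {s | I.card * (a * b * δ) < |∑ i ∈ I, (x (Z i s) * y (Z i s) - m)|} ⊆
      {s | I.card * (δ / 32 * δ) ≤ ∑ i ∈ I, δ / 32 * ((x (Z i s) * y (Z i s) - m) / (a * b))} ∪
      {s | I.card * (δ / 32 * δ)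
        ≤ ∑ i ∈ I, -(δ / 32) * ((x (Z i s) * y (Z i s) - m) / (a * b))} := by
    intro s hs
    simp only [Set.mem_ofPred_eq, Set.mem_union, ← Finset.mul_sum, ← Finset.sum_div] at hs ⊢
    set T := ∑ i ∈ I, (x (Z i s) * y (Z i s) - m)
    rcases lt_abs.1 hs with h | h
    · left
      have : I.card * δ ≤ T / (a * b) := by rw [le_div_iff₀ hab]; linarith
      nlinarith
    · right
      have : I.card * δ ≤ (-T) / (a * b) := by rw [le_div_iff₀ hab]; linarith
      rw [neg_div] at this
      nlinarith
  refine (measure_mono hsub).trans ((measure_union_le _ _).trans ?_)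
  rw [two_mul, ENNReal.ofReal_add (Real.exp_pos _).le (Real.exp_pos _).le]
  exact add_le_add (hside _ (abs_of_nonneg (by positivity)))
    (hside _ (by rw [abs_neg, abs_of_nonneg (by positivity)]))

/-- Lower tail of a sum of nonnegative i.i.d. variables. A second moment suffices, as only negative
exponents enter Chernoff's bound. -/
lemma measure_sum_le_le_exp [IsProbabilityMeasure law]
    (hind : iIndepFun Z P) (hZ : ∀ i, Measurable (Z i))
    (hlaw : ∀ i, P.map (Z i) = law) {q : β → ℝ} (hqm : Measurable q)
    (hq0 : ∀ z, 0 ≤ q z) (h1 : Integrable q law) (h2 : Integrable (fun z => q z ^ 2) law)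
    {M x : ℝ} (hM : ∫ z, q z ^ 2 ∂law ≤ M) (hM0 : 0 < M) (hx : 0 ≤ x) (I : Finset ι) :
    P {s | ∑ i ∈ I, q (Z i s) ≤ I.card * (∫ z, q z ∂law - x)}
      ≤ ENNReal.ofReal (Real.exp (-(I.card * (x ^ 2 / (2 * M))))) := by
  have := measure_sum_ge_le_exp hind hZ hlaw (h := fun z => -(x / M) * q z) (by fun_prop)
      (lintegral_exp_neg_le hq0 (θ := x / M) (by positivity) h1 h2 hM) I
      (-(x / M) * (I.card * (∫ z, q z ∂law - x)))
  refine (measure_mono ?_).trans (this.trans (le_of_eq ?_))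
  · intro s hs
    simp only [Set.mem_ofPred_eq, ← Finset.mul_sum] at hs ⊢
    have : 0 ≤ x / M := by positivity
    nlinarith
  · congr 2; field_simp; ring

/-- Markov's inequality for a sum of nonnegative i.i.d. variables. -/
lemma measure_sum_ge_le_div (hZ : ∀ i, Measurable (Z i))
    (hlaw : ∀ i, P.map (Z i) = law) {g : β → ℝ} (hg : Measurable g) (hg0 : ∀ z, 0 ≤ g z)
    (hgi : Integrable g law) (I : Finset ι) {c : ℝ} (hc : 0 < c) :
    P {s | c ≤ ∑ i ∈ I, g (Z i s)} ≤ ENNReal.ofReal (I.card * (∫ z, g z ∂law) / c) := by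
  have hgm : Measurable fun z => ENNReal.ofReal (g z) := by fun_prop
  have h3 := mul_meas_ge_le_lintegral₀ (μ := P)
    (f := fun s => ENNReal.ofReal (∑ i ∈ I, g (Z i s))) (by fun_prop) (ENNReal.ofReal c)
  have h4 : {s | c ≤ ∑ i ∈ I, g (Z i s)} ⊆ {s | ENNReal.ofReal c
      ≤ ENNReal.ofReal (∑ i ∈ I, g (Z i s))} := fun s hs => ENNReal.ofReal_le_ofReal hs
  refine (measure_mono h4).trans ?_
  rw [ENNReal.ofReal_div_of_pos hc, ENNReal.le_div_iff_mul_le (Or.inl (by simpa using hc))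
    (Or.inl ENNReal.ofReal_ne_top), mul_comm]
  refine h3.trans (le_of_eq ?_)
  simp_rw [ENNReal.ofReal_sum_of_nonneg fun i _ => hg0 _]
  rw [lintegral_finsetSum _ fun i _ => by fun_prop]
  simp_rw [lintegral_sample hZ hlaw hgm]
  rw [Finset.sum_const, ← ofReal_integral_eq_lintegral_ofReal hgi (Eventually.of_forall hg0),
    nsmul_eq_mul, ENNReal.ofReal_mul (by positivity), ENNReal.ofReal_natCast]

/-- Chebyshev's inequality for a sum of centred i.i.d. variables. -/
lemma measure_abs_sum_ge_le_div [IsProbabilityMeasure P]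
    (hind : iIndepFun Z P) (hZ : ∀ i, Measurable (Z i))
    (hlaw : ∀ i, P.map (Z i) = law) {f : β → ℝ} (hf : Measurable f)
    (hf2 : MemLp f 2 law) (hf0 : ∫ z, f z ∂law = 0) (I : Finset ι) {c : ℝ} (hc : 0 < c) :
    P {s | c ≤ |∑ i ∈ I, f (Z i s)|} ≤ ENNReal.ofReal (I.card * (∫ z, f z ^ 2 ∂law) / c ^ 2) := by
  have hmp : ∀ i, MeasurePreserving (Z i) P law := fun i => ⟨hZ i, hlaw i⟩
  have hL : ∀ i, MemLp (f ∘ Z i) 2 P := fun i => hf2.comp_measurePreserving (hmp i)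
  have hint : ∀ i, ∫ s, f (Z i s) ∂P = 0 := fun i => by
    rw [← hf0, ← hlaw i, integral_map (hZ i).aemeasurable hf.aestronglyMeasurable]
  have hvar : ∀ i, variance (f ∘ Z i) P = ∫ z, f z ^ 2 ∂law := fun i => by
    rw [variance_of_integral_eq_zero (hf.comp (hZ i)).aemeasurable (hint i), ← hlaw i,
      integral_map (hZ i).aemeasurable (by fun_prop)]
    rfl
  have hI := hind.comp (fun _ => f) fun _ => hf
  have hs := IndepFun.variance_sum (μ := P) (s := I) (X := fun i => f ∘ Z i) (fun i _ => hL i)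
    fun i _ j _ hij => hI.indepFun hij
  have hm : MemLp (∑ i ∈ I, f ∘ Z i) 2 P := memLp_finsetSum' _ fun i _ => hL i
  have h := meas_ge_le_variance_div_sq hm hc
  have h0 : P[∑ i ∈ I, f ∘ Z i] = 0 := by
    simp only [Finset.sum_apply, Function.comp_apply]
    rw [integral_finsetSum _ fun i _ => by exact (hL i).integrable (by norm_num)]
    simp [hint]
  rw [hs, h0] at h
  simpa [hvar] using h

/-- Conditioning on an independent variable: a bound on the probability of an event that is uniform
over the values `a ∈ B` of `U` holds on `{U ∈ B}`. -/
lemma measure_inter_le_of_indepFun {α : Type*} [MeasurableSpace α] [IsProbabilityMeasure P]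
    {U : Ω → α} {W : Ω → β} (hU : Measurable U) (hW : Measurable W) (hUW : IndepFun U W P)
    {A : Set (α × β)} (hA : MeasurableSet A) {B : Set α} (hB : MeasurableSet B) {δ : ℝ≥0∞}
    (h : ∀ a ∈ B, P {s | (a, W s) ∈ A} ≤ δ) :
    P {s | U s ∈ B ∧ (U s, W s) ∈ A} ≤ δ := by
  have hmap := (indepFun_iff_map_prod_eq_prod_map_map hU.aemeasurable hW.aemeasurable).1 hUW
  have hBA : MeasurableSet (Prod.fst ⁻¹' B ∩ A) := (measurable_fst hB).inter hA
  have e : {s | U s ∈ B ∧ (U s, W s) ∈ A} = (fun s => (U s, W s)) ⁻¹' (Prod.fst ⁻¹' B ∩ A) := rfl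
  have : IsProbabilityMeasure (P.map U) := Measure.isProbabilityMeasure_map hU.aemeasurable
  have : IsProbabilityMeasure (P.map W) := Measure.isProbabilityMeasure_map hW.aemeasurable
  rw [e, ← Measure.map_apply (hU.prodMk hW) hBA, hmap, Measure.prod_apply hBA]
  calc _ ≤ ∫⁻ _, δ ∂(P.map U) := by
        refine lintegral_mono fun a => ?_
        by_cases ha : a ∈ B
        · refine le_trans (measure_mono ?_) ((Measure.map_apply hW
            (measurable_prodMk_left hA)).trans_le (h a ha))
          intro w hw; exact hw.2
        · have : (Prod.mk a ⁻¹' (Prod.fst ⁻¹' B ∩ A)) = ∅ := by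
            ext w; simp [ha]
          rw [this]; simp
    _ = δ := by simp

end Sample

/-! ### Norms of vectors and matrices -/

section Norms

variable {p : ℕ}

lemma twoNorm_nonneg (v : Fin p → ℝ) : 0 ≤ twoNorm v := Real.sqrt_nonneg _

lemma twoNorm_sq (v : Fin p → ℝ) : twoNorm v ^ 2 = ∑ j, v j ^ 2 :=
  Real.sq_sqrt (Finset.sum_nonneg fun _ _ => sq_nonneg _)

lemma twoNorm_sq_eq_dotProduct (v : Fin p → ℝ) : twoNorm v ^ 2 = v ⬝ᵥ v := by
  rw [twoNorm_sq]; simp [dotProduct, sq]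

lemma twoNorm_pos {v : Fin p → ℝ} (hv : v ≠ 0) : 0 < twoNorm v := by
  obtain ⟨j, hj⟩ := Function.ne_iff.1 hv
  refine Real.sqrt_pos.2 (Finset.sum_pos' (fun _ _ => sq_nonneg _) ⟨j, Finset.mem_univ _, ?_⟩)
  exact pow_pos (abs_pos.2 hj) 2 |>.trans_eq (sq_abs _)

lemma oneNorm_nonneg (v : Fin p → ℝ) : 0 ≤ oneNorm v := Finset.sum_nonneg fun _ _ => abs_nonneg _

lemma abs_dotProduct_le {a b : Fin p → ℝ} {M : ℝ} (h : ∀ k, |a k| ≤ M) :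
    |a ⬝ᵥ b| ≤ M * oneNorm b := by
  rw [oneNorm, Finset.mul_sum]
  refine (Finset.abs_sum_le_sum_abs _ _).trans (Finset.sum_le_sum fun k _ => ?_)
  rw [abs_mul]
  exact mul_le_mul_of_nonneg_right (h k) (abs_nonneg _)

lemma twoNorm_le_oneNorm (v : Fin p → ℝ) : twoNorm v ≤ oneNorm v := by
  refine Real.sqrt_le_iff.2 ⟨oneNorm_nonneg v, ?_⟩
  have : ∑ j, v j ^ 2 = ∑ j, |v j| ^ 2 := by simp
  rw [this, oneNorm]
  exact Finset.sum_sq_le_sq_sum_of_nonneg fun _ _ => abs_nonneg _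

lemma sum_abs_le_sqrt_card_mul (S : Finset (Fin p)) (v : Fin p → ℝ) :
    ∑ k ∈ S, |v k| ≤ √(S.card : ℝ) * twoNorm v := by
  have h : (∑ k ∈ S, |v k|) ^ 2 ≤ S.card * ∑ k ∈ S, |v k| ^ 2 := sq_sum_le_card_mul_sum_sq
  have h2 : ∑ k ∈ S, |v k| ^ 2 ≤ twoNorm v ^ 2 := by
    rw [twoNorm_sq]; simp only [sq_abs]
    exact Finset.sum_le_sum_of_subset_of_nonneg (Finset.subset_univ _) fun _ _ _ => sq_nonneg _
  refine abs_le_of_sq_le_sq' ?_ (mul_nonneg (Real.sqrt_nonneg _) (twoNorm_nonneg v)) |>.2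
  rw [mul_pow, Real.sq_sqrt (by positivity)]
  exact h.trans (by gcongr)

lemma abs_entry_le_matMaxNorm {q : ℕ} (A : Matrix (Fin p) (Fin q) ℝ) (i : Fin p) (j : Fin q) :
    |A i j| ≤ matMaxNorm A :=
  (le_ciSup (f := fun j => |A i j|) (Finite.bddAbove_range _) j).trans
    (le_ciSup (f := fun i => ⨆ j, |A i j|) (Finite.bddAbove_range _) i)

lemma oneNorm_col_le_matOneNorm {q : ℕ} (A : Matrix (Fin p) (Fin q) ℝ) (j : Fin q) :
    oneNorm (fun i => A i j) ≤ matOneNorm A :=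
  le_ciSup (f := fun j => oneNorm fun i => A i j) (Finite.bddAbove_range _) j

lemma oneNorm_add_le (v w : Fin p → ℝ) : oneNorm (v + w) ≤ oneNorm v + oneNorm w := by
  rw [oneNorm, oneNorm, oneNorm, ← Finset.sum_add_distrib]
  exact Finset.sum_le_sum fun _ _ => abs_add_le _ _

lemma oneNorm_neg (v : Fin p → ℝ) : oneNorm (-v) = oneNorm v := by simp [oneNorm]

lemma oneNorm_vecMul_le {A : Matrix (Fin p) (Fin p) ℝ} (hA : A.IsSymm) {R : ℝ}
    (h : ∀ j, oneNorm (fun i => A i j) ≤ R) (ξ : Fin p → ℝ) :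
    oneNorm (ξ ᵥ* A) ≤ R * oneNorm ξ := by
  have h1 : oneNorm (ξ ᵥ* A) ≤ ∑ j, ∑ i, |ξ i| * |A i j| := by
    refine Finset.sum_le_sum fun j _ => ?_
    rw [vecMul, dotProduct]
    refine (Finset.abs_sum_le_sum_abs _ _).trans (le_of_eq ?_)
    simp [abs_mul]
  rw [Finset.sum_comm] at h1
  refine h1.trans ?_
  rw [oneNorm, Finset.mul_sum]
  refine Finset.sum_le_sum fun i _ => ?_
  rw [← Finset.mul_sum, mul_comm]
  refine mul_le_mul_of_nonneg_right ((le_of_eq ?_).trans (h i)) (abs_nonneg _)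
  simp only [oneNorm]
  exact Finset.sum_congr rfl fun j _ => by rw [hA.apply]

/-- Schur's test for a symmetric matrix. -/
lemma twoNorm_vecMul_le {A : Matrix (Fin p) (Fin p) ℝ} (hA : A.IsSymm) {R : ℝ} (hR : 0 ≤ R)
    (h : ∀ j, oneNorm (fun i => A i j) ≤ R) (ξ : Fin p → ℝ) :
    twoNorm (ξ ᵥ* A) ≤ R * twoNorm ξ := by
  refine abs_le_of_sq_le_sq' ?_ (mul_nonneg hR (twoNorm_nonneg ξ)) |>.2
  rw [mul_pow, twoNorm_sq, twoNorm_sq]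
  have h1 : ∀ j, (ξ ᵥ* A) j ^ 2 ≤ R * ∑ i, |A i j| * ξ i ^ 2 := by
    intro j
    have hcs := Finset.sum_mul_sq_le_sq_mul_sq Finset.univ (fun i => √|A i j|)
      (fun i => √|A i j| * |ξ i|)
    have e1 : ∀ i, √|A i j| * (√|A i j| * |ξ i|) = |A i j| * |ξ i| := fun i => by
      rw [← mul_assoc, Real.mul_self_sqrt (abs_nonneg _)]
    have e2 : ∀ i, (√|A i j| * |ξ i|) ^ 2 = |A i j| * ξ i ^ 2 := fun i => by
      rw [mul_pow, Real.sq_sqrt (abs_nonneg _), sq_abs]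
    simp only [e1, e2, Real.sq_sqrt (abs_nonneg _)] at hcs
    have h2 : |(ξ ᵥ* A) j| ≤ ∑ i, |A i j| * |ξ i| := by
      rw [vecMul, dotProduct]
      refine (Finset.abs_sum_le_sum_abs _ _).trans (le_of_eq ?_)
      simp [abs_mul, mul_comm]
    calc (ξ ᵥ* A) j ^ 2 = |(ξ ᵥ* A) j| ^ 2 := (sq_abs _).symm
      _ ≤ (∑ i, |A i j| * |ξ i|) ^ 2 := by gcongr
      _ ≤ _ := hcs
      _ ≤ _ := by
        gcongr
        exact h j
  calc ∑ j, (ξ ᵥ* A) j ^ 2 ≤ ∑ j, R * ∑ i, |A i j| * ξ i ^ 2 := Finset.sum_le_sum fun j _ => h1 j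
    _ = R * ∑ i, (∑ j, |A i j|) * ξ i ^ 2 := by
        rw [← Finset.mul_sum, Finset.sum_comm]; simp [Finset.sum_mul]
    _ ≤ R * ∑ i, R * ξ i ^ 2 := by
        gcongr with i
        refine (le_of_eq ?_).trans (h i)
        exact Finset.sum_congr rfl fun j _ => by rw [hA.apply]
    _ = _ := by rw [← Finset.mul_sum]; ring

/-- A bound on the image of a sparse vector under a matrix with `ℓ₂`-bounded rows. -/
lemma twoNorm_sq_vecMul_le_of_rows {A : Matrix (Fin p) (Fin p) ℝ} {b : ℝ}
    (h : ∀ i, twoNorm (A i) ^ 2 ≤ b) (ξ : Fin p → ℝ) :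
    twoNorm (ξ ᵥ* A) ^ 2 ≤ zeroNorm ξ * b * twoNorm ξ ^ 2 := by
  rw [twoNorm_sq, twoNorm_sq]
  set S := Finset.univ.filter fun j => ξ j ≠ 0 with hS
  have h1 : ∀ j, (ξ ᵥ* A) j ^ 2 ≤ S.card * ∑ i, (ξ i * A i j) ^ 2 := by
    intro j
    have e : (ξ ᵥ* A) j = ∑ i ∈ S, ξ i * A i j := by
      rw [vecMul, dotProduct]
      refine (Finset.sum_subset (Finset.subset_univ S) fun i _ hi => ?_).symm
      have : ξ i = 0 := by simpa [hS] using hi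
      simp [this]
    rw [e]
    refine sq_sum_le_card_mul_sum_sq.trans ?_
    gcongr
    exact Finset.subset_univ S
  calc ∑ j, (ξ ᵥ* A) j ^ 2 ≤ ∑ j, S.card * ∑ i, (ξ i * A i j) ^ 2 :=
        Finset.sum_le_sum fun j _ => h1 j
    _ = S.card * ∑ i, ξ i ^ 2 * twoNorm (A i) ^ 2 := by
        rw [← Finset.mul_sum, Finset.sum_comm]
        simp [twoNorm_sq, Finset.mul_sum, mul_pow]
    _ ≤ S.card * ∑ i, ξ i ^ 2 * b := by
        gcongr with i; exact h i
    _ = _ := by rw [← Finset.sum_mul, zeroNorm, ← hS]; ring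

end Norms

/-! ### The two-stage algorithm -/

section TwoStage

variable {p : ℕ}

/-- Restricted strong convexity of the quadratic form of `W`, with curvature `κ` and `ℓ₁` tolerance
`γ`. -/
def RestrictedConvexity (W : Matrix (Fin p) (Fin p) ℝ) (κ γ : ℝ) : Prop :=
  ∀ v : Fin p → ℝ, κ * twoNorm v ^ 2 - γ * oneNorm v ^ 2 ≤ v ⬝ᵥ W *ᵥ v

/-- The Lasso objective of the `j`-th column in the first stage. -/
noncomputable def columnObjective (W : Matrix (Fin p) (Fin p) ℝ) (r : ℝ) (j : Fin p)
    (θ : Fin p → ℝ) : ℝ :=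
  1 / 2 * (θ ⬝ᵥ W *ᵥ θ) - θ j + r * oneNorm θ

lemma stageOneObjective_eq_sum (W : Matrix (Fin p) (Fin p) ℝ) (r : ℝ)
    (G : Matrix (Fin p) (Fin p) ℝ) :
    stageOneObjective W r G = ∑ j, columnObjective W r j (fun i => G i j) := by
  have h1 : (Gᵀ * W * G).trace = ∑ j, (fun i => G i j) ⬝ᵥ W *ᵥ (fun i => G i j) := by
    rw [trace, Matrix.mul_assoc]
    refine Finset.sum_congr rfl fun j _ => ?_
    rw [diag_apply, mul_apply]
    rfl
  rw [stageOneObjective, h1, matEntryOneNorm, Finset.sum_comm]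
  simp only [columnObjective, Finset.sum_add_distrib, Finset.sum_sub_distrib, Finset.mul_sum,
    trace, diag_apply, oneNorm]

lemma IsStageOne.column_le {W : Matrix (Fin p) (Fin p) ℝ} {r : ℝ} {G : Matrix (Fin p) (Fin p) ℝ}
    (hG : IsStageOne W r G) (j : Fin p) (θ : Fin p → ℝ) :
    columnObjective W r j (fun i => G i j) ≤ columnObjective W r j θ := by
  have h := hG (G.updateCol j θ)
  rw [stageOneObjective_eq_sum, stageOneObjective_eq_sum,
    ← Finset.add_sum_erase _ _ (Finset.mem_univ j),
    ← Finset.add_sum_erase Finset.univ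
      (fun k => columnObjective W r k fun i => G.updateCol j θ i k) (Finset.mem_univ j)] at h
  have e : ∑ k ∈ Finset.univ.erase j, columnObjective W r k (fun i => G.updateCol j θ i k)
      = ∑ k ∈ Finset.univ.erase j, columnObjective W r k (fun i => G i k) := by
    refine Finset.sum_congr rfl fun k hk => ?_
    simp [updateCol_ne (Finset.ne_of_mem_erase hk)]
  rw [e] at h
  simp only [updateCol_self] at h
  exact le_of_add_le_add_right h

lemma quadForm_add {W : Matrix (Fin p) (Fin p) ℝ} (hW : W.IsSymm) (v w : Fin p → ℝ) :
    (v + w) ⬝ᵥ W *ᵥ (v + w) = v ⬝ᵥ W *ᵥ v + 2 * (v ⬝ᵥ W *ᵥ w) + w ⬝ᵥ W *ᵥ w := by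
  have : w ⬝ᵥ W *ᵥ v = v ⬝ᵥ W *ᵥ w := by
    rw [dotProduct_mulVec, dotProduct_comm, ← mulVec_transpose, hW.eq]
  rw [mulVec_add, dotProduct_add, add_dotProduct, add_dotProduct, this]; ring

/-- The `ℓ₁` error bound for the Lasso columns of the first stage. The error lies in the cone where
its mass off the support of `ω` is at most three times the mass on it; there the `ℓ₁` tolerance of
restricted convexity is absorbed by the curvature. -/
lemma IsStageOne.oneNorm_column_sub_le {W : Matrix (Fin p) (Fin p) ℝ} (hW : W.IsSymm)
    (hpos : ∀ v : Fin p → ℝ, 0 ≤ v ⬝ᵥ W *ᵥ v) {r κ γ s : ℝ} (hr : 0 < r) (hκ : 0 < κ)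
    (hγ : 0 ≤ γ) (hγs : 32 * γ * s ≤ κ) (hRC : RestrictedConvexity W κ γ)
    {G : Matrix (Fin p) (Fin p) ℝ} (hG : IsStageOne W r G) {j : Fin p} {ω : Fin p → ℝ}
    (hω : ∀ k, |(W *ᵥ ω) k - (1 : Matrix (Fin p) (Fin p) ℝ) k j| ≤ r / 2)
    (hs : (zeroNorm ω : ℝ) ≤ s) :
    oneNorm ((fun i => G i j) - ω) ≤ 24 * r * s / κ := by
  set θ : Fin p → ℝ := fun i => G i j
  set δ := θ - ω with hδ
  set S := Finset.univ.filter fun k => ω k ≠ 0 with hS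
  have hs0 : 0 ≤ s := le_trans (by positivity) hs
  have hbasic := hG.column_le j ω
  have hθ : θ = δ + ω := by rw [hδ]; abel
  have hq := quadForm_add hW δ ω
  rw [← hθ] at hq
  set e : Fin p → ℝ := fun k => (W *ᵥ ω) k - (1 : Matrix (Fin p) (Fin p) ℝ) k j
  have he : |e ⬝ᵥ δ| ≤ r / 2 * oneNorm δ := abs_dotProduct_le hω
  have he2 : e ⬝ᵥ δ = δ ⬝ᵥ W *ᵥ ω - δ j := by
    have : e = W *ᵥ ω - Pi.single j 1 := by
      ext k; simp [e, one_apply, Pi.single_apply]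
    rw [this, sub_dotProduct, single_one_dotProduct, dotProduct_comm]
  set A := ∑ k ∈ S, |δ k| with hA
  set B := ∑ k ∈ Sᶜ, |δ k| with hB
  have hone : oneNorm δ = A + B := (Finset.sum_add_sum_compl S _).symm
  have hA0 : 0 ≤ A := Finset.sum_nonneg fun _ _ => abs_nonneg _
  have hB0 : 0 ≤ B := Finset.sum_nonneg fun _ _ => abs_nonneg _
  have hl1 : oneNorm ω + B - A ≤ oneNorm θ := by
    rw [oneNorm, oneNorm, ← Finset.sum_add_sum_compl S,
      ← Finset.sum_add_sum_compl S (fun j => |θ j|)]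
    have h1 : ∑ k ∈ S, |ω k| - A ≤ ∑ k ∈ S, |θ k| := by
      rw [hA, ← Finset.sum_sub_distrib]
      refine Finset.sum_le_sum fun k _ => ?_
      have : ω k = θ k - δ k := by simp [hδ]
      have := abs_sub (θ k) (δ k)
      grind
    have h2 : ∑ k ∈ Sᶜ, |ω k| = 0 := Finset.sum_eq_zero fun k hk => by
      have : ω k = 0 := by simpa [hS] using hk
      simp [this]
    have h3 : B = ∑ k ∈ Sᶜ, |θ k| := Finset.sum_congr rfl fun k hk => by
      have : ω k = 0 := by simpa [hS] using hk
      simp [hδ, this]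
    linarith
  have hδj : δ j = θ j - ω j := rfl
  unfold columnObjective at hbasic
  have habs := abs_le.1 he
  have hpδ := hpos δ
  have key : 1 / 2 * (δ ⬝ᵥ W *ᵥ δ) + r / 2 * B ≤ 3 * r / 2 * A := by
    have := mul_le_mul_of_nonneg_left hl1 hr.le
    rw [hone] at habs
    nlinarith
  have hcone : B ≤ 3 * A := by
    have : r * B ≤ r * (3 * A) := by nlinarith
    exact le_of_mul_le_mul_left this hr
  have hAs : A ≤ √s * twoNorm δ :=
    (sum_abs_le_sqrt_card_mul S δ).trans (by gcongr; exact twoNorm_nonneg δ; exact hs)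
  set T := twoNorm δ
  have hT : 0 ≤ T := twoNorm_nonneg δ
  have hss : √s * √s = s := Real.mul_self_sqrt hs0
  have hs1 : 0 ≤ √s := Real.sqrt_nonneg s
  have hone4 : oneNorm δ ≤ 4 * (√s * T) := by rw [hone]; linarith
  have hone_sq : oneNorm δ ^ 2 ≤ 16 * s * T ^ 2 := by
    calc oneNorm δ ^ 2 ≤ (4 * (√s * T)) ^ 2 := by
          gcongr; exact oneNorm_nonneg δ
      _ = 16 * (√s * √s) * T ^ 2 := by ring
      _ = _ := by rw [hss]
  have hre := hRC δ
  have h1 : κ / 2 * T ^ 2 ≤ δ ⬝ᵥ W *ᵥ δ := by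
    have h2 := mul_le_mul_of_nonneg_left hone_sq hγ
    have h3 := mul_le_mul_of_nonneg_right hγs (sq_nonneg T)
    nlinarith
  have h2 : κ * T ≤ 6 * r * √s := by
    rcases hT.eq_or_lt with h0 | h0
    · rw [← h0, mul_zero]; positivity
    · have : (κ * T) * T ≤ (6 * r * √s) * T := by
        have := mul_le_mul_of_nonneg_left hAs hr.le
        nlinarith
      exact le_of_mul_le_mul_right this h0
  rw [le_div_iff₀ hκ]
  have h3 := mul_le_mul_of_nonneg_left h2 hs1
  have h4 := mul_le_mul_of_nonneg_right hone4 hκ.le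
  nlinarith

lemma matOneNorm_le [Nonempty (Fin p)] {A : Matrix (Fin p) (Fin p) ℝ} {R : ℝ}
    (h : ∀ j, oneNorm (fun i => A i j) ≤ R) : matOneNorm A ≤ R := ciSup_le h

/-- A point feasible for the second stage which is column-wise `ℓ₁`-close to the first stage
solution is close to the output. -/
lemma IsStageTwo.oneNorm_column_sub_le [Nonempty (Fin p)] {W : Matrix (Fin p) (Fin p) ℝ}
    {r R : ℝ} {G O Ω : Matrix (Fin p) (Fin p) ℝ} (hO : IsStageTwo W r G O)
    (hΩ : StageTwoFeasible W r Ω) (h : ∀ j, oneNorm ((fun i => G i j) - fun i => Ω i j) ≤ R)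
    (j : Fin p) : oneNorm (fun i => (O - Ω) i j) ≤ 2 * R := by
  have h1 : matOneNorm (G - Ω) ≤ R := matOneNorm_le h
  have h2 := (oneNorm_col_le_matOneNorm (G - O) j).trans ((hO.2 Ω hΩ).trans h1)
  have e : (fun i => (O - Ω) i j)
      = -(fun i => (G - O) i j) + ((fun i => G i j) - fun i => Ω i j) := by
    ext i; simp
  rw [e]
  refine (oneNorm_add_le _ _).trans ?_
  rw [oneNorm_neg]
  linarith [h j]

/-- Error bounds for the output of the two-stage algorithm when `Ω` is an approximate inverse of
`W` with sparse columns. The columns of `O - Ω` are `ℓ₁`-small by the second stage, hence so are the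
rows, by symmetry; Schur's test then bounds the operator norm. The bound in terms of the sparsity of
`ξ` uses that the columns are also `ℓ₂`-small, by restricted convexity. -/
lemma IsTwoStageOutput.error_bounds [Nonempty (Fin p)] {W Ω O : Matrix (Fin p) (Fin p) ℝ}
    (hW : W.IsSymm) (hpos : ∀ v : Fin p → ℝ, 0 ≤ v ⬝ᵥ W *ᵥ v) {r κ γ s : ℝ} (hr : 0 < r)
    (hκ : 0 < κ) (hγ : 0 ≤ γ) (hγs : 32 * γ * s ≤ κ) (hRC : RestrictedConvexity W κ γ)
    (hΩ : Ω.IsSymm) (hWΩ : ∀ k l, |(W * Ω - 1) k l| ≤ r / 2)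
    (hs : ∀ j, (zeroNorm (fun i => Ω i j) : ℝ) ≤ s) (hO : IsTwoStageOutput W r O)
    (ξ : Fin p → ℝ) :
    oneNorm (ξ ᵥ* (O - Ω)) ≤ 48 * r * s / κ * oneNorm ξ ∧
    twoNorm (ξ ᵥ* (O - Ω)) ≤ 48 * r / κ * min (√(zeroNorm ξ * s)) s * twoNorm ξ := by
  obtain ⟨G, hG, hO⟩ := hO
  have hs0 : 0 ≤ s := le_trans (by positivity) (hs (Classical.arbitrary _))
  have hfeas : StageTwoFeasible W r Ω :=
    ⟨hΩ, ciSup_le fun k => ciSup_le fun l => (hWΩ k l).trans (by linarith)⟩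
  have hG1 : ∀ j, oneNorm ((fun i => G i j) - fun i => Ω i j) ≤ 24 * r * s / κ := fun j =>
    hG.oneNorm_column_sub_le hW hpos hr hκ hγ hγs hRC (fun k => hWΩ k j) (hs j)
  set R := 48 * r * s / κ with hRdef
  have hR0 : 0 ≤ R := by positivity
  have hcol : ∀ j, oneNorm (fun i => (O - Ω) i j) ≤ R := fun j =>
    (hO.oneNorm_column_sub_le hfeas hG1 j).trans (le_of_eq (by rw [hRdef]; ring))
  have hsymm : (O - Ω).IsSymm := hO.1.1.sub hΩ
  have htwo : ∀ i, twoNorm ((O - Ω) i) ^ 2 ≤ (48 * r / κ) ^ 2 * s := by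
    intro j
    have hrow : (O - Ω) j = fun i => (O - Ω) i j := by ext i; exact hsymm.apply i j
    rw [hrow]
    set v : Fin p → ℝ := fun i => (O - Ω) i j
    -- both `O` and `Ω` satisfy the constraint of the second stage
    have hWv : ∀ k, |(W *ᵥ v) k| ≤ 2 * r := by
      intro k
      have e : (W *ᵥ v) k = (W * O - 1) k j - (W * Ω - 1) k j := by
        have : (W *ᵥ v) k = (W * (O - Ω)) k j := rfl
        rw [this, Matrix.mul_sub]; simp
      rw [e]
      have h1 := (abs_entry_le_matMaxNorm (W * O - 1) k j).trans hO.1.2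
      exact (abs_sub _ _).trans (by linarith [hWΩ k j])
    have h1 : v ⬝ᵥ W *ᵥ v ≤ 2 * r * R := by
      rw [dotProduct_comm]
      exact (le_abs_self _).trans ((abs_dotProduct_le hWv).trans (by gcongr; exact hcol j))
    have h2 := hRC v
    have h3 : γ * oneNorm v ^ 2 ≤ 3 / 2 * (r * R) := by
      have h4 : oneNorm v ^ 2 ≤ R * R := by
        rw [sq]; exact mul_le_mul (hcol j) (hcol j) (oneNorm_nonneg v) hR0
      have h5 : γ * R ≤ 3 / 2 * r := by
        rw [hRdef, mul_div_assoc', div_le_iff₀ hκ]; nlinarith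
      nlinarith
    have h6 : κ * twoNorm v ^ 2 ≤ 4 * (r * R) := by
      have : 0 ≤ r * R := by positivity
      linarith
    have h7 : 4 * (r * R) = κ * (192 * r ^ 2 * s / κ ^ 2) := by rw [hRdef]; field_simp; ring
    rw [h7] at h6
    refine (le_of_mul_le_mul_left h6 hκ).trans ?_
    rw [div_pow, div_mul_eq_mul_div]
    gcongr
    nlinarith [mul_nonneg (sq_nonneg r) hs0]
  refine ⟨oneNorm_vecMul_le hsymm hcol ξ, ?_⟩
  rcases min_choice (√(zeroNorm ξ * s)) s with h | h <;> rw [h]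
  · refine abs_le_of_sq_le_sq' ?_ (by have := twoNorm_nonneg ξ; positivity) |>.2
    refine (twoNorm_sq_vecMul_le_of_rows htwo ξ).trans (le_of_eq ?_)
    rw [mul_pow, mul_pow _ (√_), Real.sq_sqrt (by positivity)]; ring
  · refine (twoNorm_vecMul_le hsymm hR0 hcol ξ).trans (le_of_eq ?_)
    rw [hRdef]; ring

lemma continuous_matOneNorm [Nonempty (Fin p)] :
    Continuous fun A : Matrix (Fin p) (Fin p) ℝ => matOneNorm A := by
  have e : (fun A : Matrix (Fin p) (Fin p) ℝ => matOneNorm A)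
      = fun A => Finset.univ.sup' Finset.univ_nonempty fun j => oneNorm fun i => A i j := by
    ext A; rw [Finset.sup'_univ_eq_ciSup]; rfl
  rw [e]
  refine Continuous.finset_sup'_apply _ fun j _ => ?_
  simp only [oneNorm]
  fun_prop

/-- A continuous function on matrices that, outside a box, exceeds its value at a point of a closed
set attains its minimum on this set. -/
lemma exists_isMinOn_of_box {f : Matrix (Fin p) (Fin p) ℝ → ℝ} (hf : Continuous f)
    {C : Set (Matrix (Fin p) (Fin p) ℝ)} (hC : IsClosed C) {G₀ : Matrix (Fin p) (Fin p) ℝ}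
    (h₀ : G₀ ∈ C) {M : ℝ} (h : ∀ G, f G ≤ f G₀ → ∀ i j, |G i j| ≤ M) :
    ∃ G ∈ C, ∀ G' ∈ C, f G ≤ f G' := by
  set K : Set (Matrix (Fin p) (Fin p) ℝ) :=
    Set.pi Set.univ fun _ => Set.pi Set.univ fun _ => Set.Icc (-M) M with hK
  have hKc : IsCompact K := isCompact_univ_pi fun _ => isCompact_univ_pi fun _ => isCompact_Icc
  have hmem : ∀ G, f G ≤ f G₀ → G ∈ K := fun G hG i _ j _ => abs_le.1 (h G hG i j)
  obtain ⟨G, hG, hmin⟩ := (hKc.inter_right hC).exists_isMinOn ⟨G₀, hmem G₀ le_rfl, h₀⟩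
    hf.continuousOn
  refine ⟨G, hG.2, fun G' hG' => ?_⟩
  by_cases hle : f G' ≤ f G₀
  · exact hmin ⟨hmem G' hle, hG'⟩
  · exact (hmin ⟨hmem G₀ le_rfl, h₀⟩ : f G ≤ f G₀).trans (not_le.1 hle).le

/-- Both stages have a solution as soon as `W` has a symmetric approximate inverse. -/
lemma exists_isTwoStageOutput [Nonempty (Fin p)] {W Ω : Matrix (Fin p) (Fin p) ℝ}
    (hW : W.IsSymm) (hpos : ∀ v : Fin p → ℝ, 0 ≤ v ⬝ᵥ W *ᵥ v) {r : ℝ} (hr : 0 < r)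
    (hΩ : Ω.IsSymm) (hWΩ : ∀ k l, |(W * Ω - 1) k l| ≤ r / 2) :
    ∃ O, IsTwoStageOutput W r O := by
  have hfeas : StageTwoFeasible W r Ω :=
    ⟨hΩ, ciSup_le fun k => ciSup_le fun l => (hWΩ k l).trans (by linarith)⟩
  -- the approximate inverse makes the first-stage objective coercive
  have hcol : ∀ j (θ : Fin p → ℝ), r / 2 * oneNorm θ
      - 1 / 2 * ((fun i => Ω i j) ⬝ᵥ W *ᵥ fun i => Ω i j) ≤ columnObjective W r j θ := by
    intro j θ
    set ω : Fin p → ℝ := fun i => Ω i j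
    set e : Fin p → ℝ := fun k => (W *ᵥ ω) k - (1 : Matrix (Fin p) (Fin p) ℝ) k j
    have he : |e ⬝ᵥ θ| ≤ r / 2 * oneNorm θ := abs_dotProduct_le fun k => hWΩ k j
    have he2 : e ⬝ᵥ θ = θ ⬝ᵥ W *ᵥ ω - θ j := by
      have : e = W *ᵥ ω - Pi.single j 1 := by
        ext k; simp [e, one_apply, Pi.single_apply]
      rw [this, sub_dotProduct, single_one_dotProduct, dotProduct_comm]
    have h1 := quadForm_add hW θ (-ω)
    have h2 := hpos (θ + -ω)
    rw [h1] at h2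
    simp only [mulVec_neg, dotProduct_neg, neg_dotProduct, neg_neg] at h2
    rw [columnObjective]
    linarith [neg_le_of_abs_le he]
  set c := ∑ j, 1 / 2 * ((fun i => Ω i j) ⬝ᵥ W *ᵥ fun i => Ω i j) with hc
  have hobj : ∀ G, r / 2 * matEntryOneNorm G - c ≤ stageOneObjective W r G := by
    intro G
    rw [stageOneObjective_eq_sum, matEntryOneNorm, Finset.sum_comm, Finset.mul_sum, hc,
      ← Finset.sum_sub_distrib]
    exact Finset.sum_le_sum fun j _ => hcol j fun i => G i j
  have hentry : ∀ (G : Matrix (Fin p) (Fin p) ℝ) i j, |G i j| ≤ matEntryOneNorm G := fun G i j =>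
    (Finset.single_le_sum (f := fun j => |G i j|) (fun _ _ => abs_nonneg _)
      (Finset.mem_univ j)).trans
    (Finset.single_le_sum (f := fun i => ∑ j, |G i j|)
      (fun _ _ => Finset.sum_nonneg fun _ _ => abs_nonneg _) (Finset.mem_univ i))
  have hcont : Continuous (stageOneObjective W r) := by
    have : stageOneObjective W r = fun G => ∑ j, columnObjective W r j (fun i => G i j) :=
      funext fun G => stageOneObjective_eq_sum W r G
    rw [this]
    simp only [columnObjective, oneNorm, dotProduct, mulVec]
    fun_prop
  obtain ⟨G, -, hG⟩ := exists_isMinOn_of_box hcont isClosed_univ (G₀ := 0) (Set.mem_univ _)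
    (M := (stageOneObjective W r 0 + c) / (r / 2)) fun G hG i j => by
      rw [le_div_iff₀ (by positivity)]
      have := mul_le_mul_of_nonneg_left (hentry G i j) (half_pos hr).le
      linarith [hobj G]
  have hclosed : IsClosed {O | StageTwoFeasible W r O} := by
    have e : {O | StageTwoFeasible W r O}
        = {O | Oᵀ = O} ∩ ⋂ k, ⋂ l, {O | |(W * O - 1) k l| ≤ r} := by
      ext O
      simp only [StageTwoFeasible, IsSymm, Set.mem_inter_iff, Set.mem_ofPred_eq, Set.mem_iInter]
      refine and_congr_right fun _ => ⟨fun h k l => (abs_entry_le_matMaxNorm _ k l).trans h,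
        fun h => ciSup_le fun k => ciSup_le fun l => h k l⟩
    rw [e]
    refine (isClosed_eq (by fun_prop) continuous_id).inter
      (isClosed_iInter fun k => isClosed_iInter fun l => isClosed_le ?_ continuous_const)
    simp only [Matrix.sub_apply, mul_apply]
    fun_prop
  obtain ⟨O, hO, hmin⟩ := exists_isMinOn_of_box (f := fun O => matOneNorm (G - O))
    (continuous_matOneNorm.comp (by fun_prop)) hclosed (G₀ := Ω) hfeas
    (M := matEntryOneNorm G + matOneNorm (G - Ω)) fun O hO i j => by
      have h1 : |(G - O) i j| ≤ matOneNorm (G - O) :=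
        (Finset.single_le_sum (f := fun i => |(G - O) i j|) (fun _ _ => abs_nonneg _)
          (Finset.mem_univ i)).trans (oneNorm_col_le_matOneNorm (G - O) j)
      have h2 : O i j = G i j - (G - O) i j := by simp
      rw [h2]
      exact (abs_sub _ _).trans (add_le_add (hentry G i j) (h1.trans hO))
  exact ⟨O, G, fun G' => hG G' (Set.mem_univ _), hO, fun O' hO' => hmin O' hO'⟩

end TwoStage

/-! ### Maurey's sparsification -/

section Sparsification

variable {p : ℕ}

/-- The signed standard basis vectors `±e_j`. -/
def signedBasis (x : Fin p × Bool) : Fin p → ℝ := Pi.single x.1 (if x.2 then 1 else -1)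

lemma abs_smul_signedBasis (v : Fin p → ℝ) (j : Fin p) :
    |v j| • signedBasis (j, decide (0 ≤ v j)) = Pi.single j (v j) := by
  ext k
  rcases eq_or_ne k j with rfl | hk
  · by_cases h : 0 ≤ v k
    · simp [signedBasis, h, abs_of_nonneg h]
    · simp [signedBasis, h, abs_of_neg (not_le.1 h)]
  · simp [signedBasis, hk]

/-- A vector as a combination of signed basis vectors, with weights the absolute values of its
entries. -/
lemma sum_abs_smul_signedBasis (v : Fin p → ℝ) :
    ∑ j, |v j| • signedBasis (j, decide (0 ≤ v j)) = v := by
  simp_rw [abs_smul_signedBasis]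
  exact Finset.univ_sum_single v

lemma quadForm_signedBasis (A : Matrix (Fin p) (Fin p) ℝ) (x : Fin p × Bool) :
    signedBasis x ⬝ᵥ A *ᵥ signedBasis x = A x.1 x.1 := by
  obtain ⟨j, b⟩ := x
  cases b <;> simp [signedBasis]

/-- Maurey's sparsification, derandomised by the method of conditional expectations: the value of a
quadratic form at some sum of `r` signed basis vectors is at most its expectation when they are
drawn independently with mean `v`. -/
lemma exists_signedBasis_quadForm_le {A : Matrix (Fin p) (Fin p) ℝ} (hA : A.IsSymm)
    {v : Fin p → ℝ} (hv : oneNorm v = 1) (r : ℕ) (z : Fin p → ℝ) :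
    ∃ f : Fin r → Fin p × Bool,
      (z + ∑ k, signedBasis (f k)) ⬝ᵥ A *ᵥ (z + ∑ k, signedBasis (f k))
        ≤ z ⬝ᵥ A *ᵥ z + 2 * r * (z ⬝ᵥ A *ᵥ v) + r * (r - 1) * (v ⬝ᵥ A *ᵥ v)
          + r * ∑ j, |v j| * A j j := by
  induction r generalizing z with
  | zero => exact ⟨Fin.elim0, by simp⟩
  | succ r ih =>
    set d := ∑ j, |v j| * A j j with hd
    set e : Fin p → Fin p → ℝ := fun j => signedBasis (j, decide (0 ≤ v j)) with he
    set Φ : Fin p → ℝ := fun j => (z + e j) ⬝ᵥ A *ᵥ (z + e j)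
      + 2 * r * ((z + e j) ⬝ᵥ A *ᵥ v) + r * (r - 1) * (v ⬝ᵥ A *ᵥ v) + r * d with hΦ
    set T := z ⬝ᵥ A *ᵥ z + 2 * (r + 1) * (z ⬝ᵥ A *ᵥ v) + (r + 1) * r * (v ⬝ᵥ A *ᵥ v)
      + (r + 1) * d with hT
    have hmean : ∀ w : Fin p → ℝ, ∑ j, |v j| * (e j ⬝ᵥ w) = v ⬝ᵥ w := by
      intro w
      conv_rhs => rw [← sum_abs_smul_signedBasis v]
      simp [he, sum_dotProduct]
    have hsym : ∀ j, z ⬝ᵥ A *ᵥ e j = e j ⬝ᵥ A *ᵥ z := fun j => by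
      rw [dotProduct_mulVec, dotProduct_comm, ← mulVec_transpose, hA.eq]
    have hsymv : v ⬝ᵥ A *ᵥ z = z ⬝ᵥ A *ᵥ v := by
      rw [dotProduct_mulVec, dotProduct_comm, ← mulVec_transpose, hA.eq]
    -- averaging over the first draw reproduces the bound `T` for `r + 1` draws
    have havg : ∑ j, |v j| * (Φ j - T) = 0 := by
      have e1 : ∀ j, |v j| * (Φ j - T) = 2 * (|v j| * (e j ⬝ᵥ A *ᵥ z)) + |v j| * A j j
          + 2 * r * (|v j| * (e j ⬝ᵥ A *ᵥ v)) + |v j| * (-(2 * (z ⬝ᵥ A *ᵥ v))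
          - 2 * r * (v ⬝ᵥ A *ᵥ v) - d) := by
        intro j
        simp only [hΦ, hT]
        rw [quadForm_add hA, hsym, quadForm_signedBasis, add_dotProduct]
        ring
      simp_rw [e1]
      rw [Finset.sum_add_distrib, Finset.sum_add_distrib, Finset.sum_add_distrib, ← Finset.mul_sum,
        ← Finset.mul_sum, hmean, hmean, ← Finset.sum_mul, ← hd, hsymv]
      have : ∑ j, |v j| = 1 := hv
      rw [this]; ring
    obtain ⟨j, hj⟩ : ∃ j, Φ j ≤ T := by
      by_contra! hcon
      have h0 := (Finset.sum_eq_zero_iff_of_nonneg fun j _ =>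
        mul_nonneg (abs_nonneg (v j)) (sub_nonneg.2 (hcon j).le)).1 havg
      have : oneNorm v = 0 := Finset.sum_eq_zero fun j hj =>
        (mul_eq_zero.1 (h0 j hj)).resolve_right (sub_pos.2 (hcon j)).ne'
      rw [hv] at this; norm_num at this
    obtain ⟨f, hf⟩ := ih (z + e j)
    refine ⟨Fin.cons (j, decide (0 ≤ v j)) f, ?_⟩
    have e2 : z + ∑ k, signedBasis
        ((Fin.cons (j, decide (0 ≤ v j)) f : Fin (r + 1) → Fin p × Bool) k)
        = z + e j + ∑ k, signedBasis (f k) := by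
      rw [Fin.sum_univ_succ]; simp [he, add_assoc]
    rw [e2]
    refine hf.trans (hj.trans (le_of_eq ?_))
    simp only [hT]; push_cast; ring

/-- A quadratic form which is nonnegative on sums of `m` signed basis vectors is nonnegative up to
an `ℓ₁` error of order `1 / m`. -/
lemma neg_oneNorm_sq_le_quadForm {A : Matrix (Fin p) (Fin p) ℝ} (hA : A.IsSymm) {m : ℕ}
    (hm : 2 ≤ m)
    (h : ∀ f : Fin m → Fin p × Bool,
      0 ≤ (∑ k, signedBasis (f k)) ⬝ᵥ A *ᵥ (∑ k, signedBasis (f k)))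
    {b : ℝ} (hb : ∀ j, A j j ≤ b) (v : Fin p → ℝ) :
    -(b / (m - 1)) * oneNorm v ^ 2 ≤ v ⬝ᵥ A *ᵥ v := by
  have hm2 : (2 : ℝ) ≤ m := by exact_mod_cast hm
  have key : ∀ w : Fin p → ℝ, oneNorm w = 1 → -(b / (m - 1)) ≤ w ⬝ᵥ A *ᵥ w := by
    intro w hw
    obtain ⟨f, hf⟩ := exists_signedBasis_quadForm_le hA hw m 0
    have h1 : ∑ j, |w j| * A j j ≤ b := by
      calc _ ≤ ∑ j, |w j| * b := by gcongr with j; exact hb j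
        _ = b := by rw [← Finset.sum_mul]; exact (congrArg (· * b) hw).trans (one_mul b)
    simp only [zero_add, zero_dotProduct, mul_zero] at hf
    have h2 := (h f).trans hf
    rw [neg_le_iff_add_nonneg, add_comm, div_add' _ _ _ (sub_pos.2 (by linarith : (1 : ℝ) < m)).ne']
    refine div_nonneg ?_ (by linarith)
    have : 0 ≤ (m : ℝ) * (b + w ⬝ᵥ A *ᵥ w * (m - 1)) := by nlinarith
    exact nonneg_of_mul_nonneg_right this (by linarith)
  rcases (oneNorm_nonneg v).eq_or_lt with h0 | h0
  · have : v = 0 := by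
      ext j
      have := (Finset.sum_eq_zero_iff_of_nonneg fun j _ => abs_nonneg (v j)).1 h0.symm j
        (Finset.mem_univ j)
      simpa using this
    simp [this, oneNorm]
  · have h1 := key ((oneNorm v)⁻¹ • v) (by
      have : oneNorm ((oneNorm v)⁻¹ • v) = (oneNorm v)⁻¹ * oneNorm v := by
        conv_lhs => rw [oneNorm]
        simp only [Pi.smul_apply, smul_eq_mul, abs_mul, ← Finset.mul_sum, abs_inv,
          abs_of_pos h0]
        rfl
      rw [this, inv_mul_cancel₀ h0.ne'])
    rw [mulVec_smul, dotProduct_smul, smul_dotProduct, smul_eq_mul, smul_eq_mul] at h1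
    have h2 := mul_le_mul_of_nonneg_right h1 (sq_nonneg (oneNorm v))
    refine h2.trans (le_of_eq ?_)
    field_simp

end Sparsification

/-! ### Quadratic forms and eigenvalues -/

section Eigenvalues

variable {p : ℕ}

/-- A lower bound on the eigenvalues of a symmetric matrix is one on its quadratic form. -/
lemma le_quadForm_of_eigenvalues {H : Matrix (Fin p) (Fin p) ℝ} (hH : H.IsSymm) {c : ℝ}
    (h : ∀ μ : ℝ, Module.End.HasEigenvalue (Matrix.toLin' H) μ → c ≤ μ) (v : Fin p → ℝ) :
    c * twoNorm v ^ 2 ≤ v ⬝ᵥ H *ᵥ v := by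
  have hherm : (H - c • 1).IsHermitian := by
    rw [IsHermitian, conjTranspose_eq_transpose_of_trivial, transpose_sub, hH.eq]
    simp
  have hpsd : (H - c • 1).PosSemidef := by
    refine hherm.posSemidef_iff_eigenvalues_nonneg.2 fun i => ?_
    have h1 := hherm.mulVec_eigenvectorBasis i
    have hne : (hherm.eigenvectorBasis i : EuclideanSpace ℝ (Fin p)).ofLp ≠ 0 := by
      intro h0
      exact hherm.eigenvectorBasis.orthonormal.ne_zero i (by ext j; exact congrFun h0 j)
    set w := (hherm.eigenvectorBasis i : EuclideanSpace ℝ (Fin p)).ofLp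
    have h2 : H *ᵥ w = (hherm.eigenvalues i + c) • w := by
      rw [sub_mulVec, smul_mulVec, one_mulVec, sub_eq_iff_eq_add] at h1
      rw [h1, add_smul]
    have := h _ (Module.End.hasEigenvalue_of_hasEigenvector (x := w)
      (Module.End.hasEigenvector_iff.2 ⟨Module.End.mem_eigenspace_iff.2 (by simpa using h2), hne⟩))
    simp only [Pi.zero_apply]; linarith
  have h3 := hpsd.dotProduct_mulVec_nonneg v
  rw [sub_mulVec, smul_mulVec, one_mulVec, dotProduct_sub, dotProduct_smul] at h3
  rw [twoNorm_sq_eq_dotProduct]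
  simpa using h3

end Eigenvalues

/-! ### The model at a fixed sample size -/

namespace LMModel

variable {n : ℕ} (D : LMModel.{u} n)

/-- The `i`-th observation `(Xᵢ, Yᵢ)`. -/
def obs (i : Fin n) (s : D.S) : (Fin D.p → ℝ) × ℝ := (D.X i s, D.Y i s)

lemma measurable_obs (i : Fin n) : Measurable (D.obs i) :=
  (D.measurable_X i).prodMk (D.measurable_Y i)

/-- The population residual `Y₀ - X₀ᵀ βbar`. -/
def resid (z : (Fin D.p → ℝ) × ℝ) : ℝ := z.2 - z.1 ⬝ᵥ D.βbar

/-- The linear functional `ξᵀ Ω* X₀`. -/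
noncomputable def score (z : (Fin D.p → ℝ) × ℝ) : ℝ := D.ξ ⬝ᵥ D.Ωstar *ᵥ z.1

lemma measurable_dotProduct_fst {p : ℕ} (a : Fin p → ℝ) :
    Measurable fun z : (Fin p → ℝ) × ℝ => a ⬝ᵥ z.1 := by
  simp only [dotProduct]; fun_prop

lemma measurable_resid : Measurable D.resid := by
  unfold resid; simp only [dotProduct]; fun_prop

lemma measurable_score : Measurable D.score := by
  unfold score; simp only [dotProduct, mulVec]; fun_prop

lemma measurable_precision (l : Fin D.p) :
    Measurable fun z : (Fin D.p → ℝ) × ℝ => (D.Ωstar *ᵥ z.1) l := by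
  simp only [dotProduct, mulVec]; fun_prop

/-- The distributional assumptions at a fixed sample size, with sub-gaussian norms replaced by
exponential moments at explicit scales. Both sets of assumptions on the covariates imply it. -/
structure Regular (t C₃ C₄ C₅ σ : ℝ) : Prop where
  t_pos : 0 < t
  C₃_pos : 0 < C₃
  C₄_pos : 0 < C₄
  C₅_pos : 0 < C₅
  σ_pos : 0 < σ
  eigen : D.EigenvalueBounds C₃ C₄
  entry : ∀ j, SubGaussianAt D.law (fun z => z.1 j) t
  precision : ∀ j, SubGaussianAt D.law (fun z => (D.Ωstar *ᵥ z.1) j) t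
  loading : SubGaussianAt D.law D.score (t * twoNorm (D.Ωstar *ᵥ D.ξ))
  residual : SubGaussianAt D.law D.resid σ
  condVar : ∀ᵐ z ∂D.law, C₅ ≤ (D.law[fun z => D.resid z ^ 2 |
    MeasurableSpace.comap Prod.fst inferInstance]) z

lemma nonempty_fin : Nonempty (Fin D.p) := by
  obtain ⟨j, -⟩ := Function.ne_iff.1 D.ξ_ne_zero
  exact ⟨j⟩

lemma isSymm_secondMoment : D.secondMoment.IsSymm := by
  ext k l; simp [secondMoment, mul_comm]

lemma isSymm_Ωstar : D.Ωstar.IsSymm := by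
  rw [Ωstar, IsSymm, transpose_nonsing_inv, D.isSymm_secondMoment.eq]

/-- The second-moment matrix is invertible: the inverse of a singular matrix is `0` by convention,
and its eigenvalue `0` is excluded by the eigenvalue bounds. -/
lemma isUnit_det_secondMoment {C₃ C₄ : ℝ} (hC₃ : 0 < C₃) (h : D.EigenvalueBounds C₃ C₄) :
    IsUnit D.secondMoment.det := by
  by_contra hdet
  have h0 : D.Ωstar = 0 := nonsing_inv_apply_not_isUnit _ hdet
  have := h 0 (Module.End.hasEigenvalue_of_hasEigenvector (x := D.ξ)
    (Module.End.hasEigenvector_iff.2 ⟨Module.End.mem_eigenspace_iff.2 (by simp [h0]), D.ξ_ne_zero⟩))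
  linarith [this.1]

section Population

variable {D} {t C₃ C₄ C₅ σ : ℝ}

lemma Regular.secondMoment_mul (h : D.Regular t C₃ C₄ C₅ σ) : D.secondMoment * D.Ωstar = 1 :=
  mul_nonsing_inv _ (D.isUnit_det_secondMoment h.C₃_pos h.eigen)

lemma Regular.mul_secondMoment (h : D.Regular t C₃ C₄ C₅ σ) : D.Ωstar * D.secondMoment = 1 :=
  nonsing_inv_mul _ (D.isUnit_det_secondMoment h.C₃_pos h.eigen)

lemma Regular.le_quadForm_Ωstar (h : D.Regular t C₃ C₄ C₅ σ) (v : Fin D.p → ℝ) :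
    C₃ * twoNorm v ^ 2 ≤ v ⬝ᵥ D.Ωstar *ᵥ v :=
  le_quadForm_of_eigenvalues D.isSymm_Ωstar (fun μ hμ => (h.eigen μ hμ).1) v

/-- The eigenvalues of `Σ` are the inverses of those of `Ω*`. -/
lemma Regular.eigenvalue_inv (h : D.Regular t C₃ C₄ C₅ σ) {μ : ℝ}
    (hμ : Module.End.HasEigenvalue (Matrix.toLin' D.secondMoment) μ) :
    C₄⁻¹ ≤ μ ∧ μ ≤ C₃⁻¹ := by
  obtain ⟨w, hw⟩ := hμ.exists_hasEigenvector
  have h1 : D.secondMoment *ᵥ w = μ • w := by simpa using hw.apply_eq_smul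
  have h2 : w = μ • (D.Ωstar *ᵥ w) := by
    rw [← mulVec_smul, ← h1, mulVec_mulVec, h.mul_secondMoment, one_mulVec]
  have hμ0 : μ ≠ 0 := by
    rintro rfl; rw [zero_smul] at h2; exact hw.2 h2
  have h3 : D.Ωstar *ᵥ w = μ⁻¹ • w := by
    conv_rhs => rw [h2]
    rw [smul_smul, inv_mul_cancel₀ hμ0, one_smul]
  have h4 := h.eigen μ⁻¹ (Module.End.hasEigenvalue_of_hasEigenvector (x := w)
    (Module.End.hasEigenvector_iff.2 ⟨Module.End.mem_eigenspace_iff.2 (by simpa using h3), hw.2⟩))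
  have hpos : 0 < μ⁻¹ := h.C₃_pos.trans_le h4.1
  have hμp : 0 < μ := inv_pos.1 hpos
  exact ⟨(inv_le_comm₀ hμp h.C₄_pos).1 h4.2, (le_inv_comm₀ h.C₃_pos hμp).1 h4.1⟩

lemma Regular.le_quadForm_secondMoment (h : D.Regular t C₃ C₄ C₅ σ) (v : Fin D.p → ℝ) :
    C₄⁻¹ * twoNorm v ^ 2 ≤ v ⬝ᵥ D.secondMoment *ᵥ v :=
  le_quadForm_of_eigenvalues D.isSymm_secondMoment (fun _ hμ => (h.eigenvalue_inv hμ).1) v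

lemma quadForm_le_of_eigenvalues {p : ℕ} {H : Matrix (Fin p) (Fin p) ℝ} (hH : H.IsSymm) {c : ℝ}
    (h : ∀ μ : ℝ, Module.End.HasEigenvalue (Matrix.toLin' H) μ → μ ≤ c) (v : Fin p → ℝ) :
    v ⬝ᵥ H *ᵥ v ≤ c * twoNorm v ^ 2 := by
  have := le_quadForm_of_eigenvalues (H := -H) (c := -c) (by rw [IsSymm, transpose_neg, hH.eq])
    (fun μ hμ => by
      obtain ⟨w, hw⟩ := hμ.exists_hasEigenvector
      have h1 : H *ᵥ w = (-μ) • w := by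
        have h2 : -(H *ᵥ w) = μ • w := by simpa using hw.apply_eq_smul
        rw [neg_smul, ← h2, neg_neg]
      have := h (-μ) (Module.End.hasEigenvalue_of_hasEigenvector (x := w)
        (Module.End.hasEigenvector_iff.2
          ⟨Module.End.mem_eigenspace_iff.2 (by simpa using h1), hw.2⟩))
      linarith) v
  rw [neg_mulVec, dotProduct_neg] at this
  linarith

lemma Regular.quadForm_secondMoment_le (h : D.Regular t C₃ C₄ C₅ σ) (v : Fin D.p → ℝ) :
    v ⬝ᵥ D.secondMoment *ᵥ v ≤ C₃⁻¹ * twoNorm v ^ 2 :=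
  quadForm_le_of_eigenvalues D.isSymm_secondMoment (fun _ hμ => (h.eigenvalue_inv hμ).2) v

lemma Regular.twoNorm_Ωstar_mulVec_le (h : D.Regular t C₃ C₄ C₅ σ) (v : Fin D.p → ℝ) :
    twoNorm (D.Ωstar *ᵥ v) ≤ C₄ * twoNorm v := by
  have h1 := h.le_quadForm_secondMoment (D.Ωstar *ᵥ v)
  rw [mulVec_mulVec, h.secondMoment_mul, one_mulVec, dotProduct_comm] at h1
  have h2 := quadForm_le_of_eigenvalues D.isSymm_Ωstar (fun μ hμ => (h.eigen μ hμ).2) v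
  refine abs_le_of_sq_le_sq' ?_ (mul_nonneg h.C₄_pos.le (twoNorm_nonneg v)) |>.2
  have h3 := h1.trans h2
  rw [inv_mul_le_iff₀ h.C₄_pos] at h3
  nlinarith

lemma Regular.twoNorm_Ωstar_mulVec_pos (h : D.Regular t C₃ C₄ C₅ σ) :
    0 < twoNorm (D.Ωstar *ᵥ D.ξ) := by
  refine twoNorm_pos fun h0 => ?_
  have := h.le_quadForm_Ωstar D.ξ
  rw [h0, dotProduct_zero] at this
  have := mul_pos h.C₃_pos (pow_pos (twoNorm_pos D.ξ_ne_zero) 2)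
  linarith

lemma Regular.integrable_mul (h : D.Regular t C₃ C₄ C₅ σ) (k l : Fin D.p) :
    Integrable (fun z => z.1 k * z.1 l) D.law :=
  (h.entry k).integrable_mul h.t_pos h.t_pos (by fun_prop) (by fun_prop) (h.entry l)

lemma Regular.integral_mul_eq (h : D.Regular t C₃ C₄ C₅ σ) (a b : Fin D.p → ℝ) :
    Integrable (fun z => (a ⬝ᵥ z.1) * (b ⬝ᵥ z.1)) D.law ∧
    ∫ z, (a ⬝ᵥ z.1) * (b ⬝ᵥ z.1) ∂D.law = a ⬝ᵥ D.secondMoment *ᵥ b := by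
  have e : (fun z : (Fin D.p → ℝ) × ℝ => (a ⬝ᵥ z.1) * (b ⬝ᵥ z.1))
      = fun z => ∑ k, ∑ l, a k * b l * (z.1 k * z.1 l) := by
    ext z
    simp only [dotProduct, Finset.sum_mul_sum]
    exact Finset.sum_congr rfl fun k _ => Finset.sum_congr rfl fun l _ => by ring
  have hi : ∀ k l, Integrable (fun z : (Fin D.p → ℝ) × ℝ => a k * b l * (z.1 k * z.1 l)) D.law :=
    fun k l => (h.integrable_mul k l).const_mul _
  rw [e]
  refine ⟨integrable_finsetSum _ fun k _ => integrable_finsetSum _ fun l _ => hi k l, ?_⟩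
  rw [integral_finsetSum _ fun k _ => integrable_finsetSum _ fun l _ => hi k l]
  simp only [dotProduct, mulVec, Finset.mul_sum]
  refine Finset.sum_congr rfl fun k _ => ?_
  rw [integral_finsetSum _ fun l _ => hi k l]
  refine Finset.sum_congr rfl fun l _ => ?_
  rw [integral_const_mul]
  simp only [secondMoment, of_apply]; ring

end Population

end LMModel

/-! ### Moments of the covariates and the residual -/

/-- Mixed even moments of two sub-gaussian variables. -/
lemma SubGaussianAt.integral_pow_mul_pow_le {S : Type*} [MeasurableSpace S] {μ : Measure S}
    {x y : S → ℝ} {a b : ℝ} (ha : 0 < a) (hb : 0 < b)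
    (hx : Measurable x) (hy : Measurable y) (h1 : SubGaussianAt μ x a) (h2 : SubGaussianAt μ y b)
    (k : ℕ) : Integrable (fun s => x s ^ (2 * k) * y s ^ (2 * k)) μ ∧
      ∫ s, x s ^ (2 * k) * y s ^ (2 * k) ∂μ ≤ 2 * (2 * k).factorial * (a * b) ^ (2 * k) := by
  have i1 := h1.integrable_pow ha hx (2 * k)
  have i2 := h2.integrable_pow hb hy (2 * k)
  set c := a ^ (2 * k) with hc
  set d := b ^ (2 * k) with hd
  have hc0 : 0 < c := by positivity
  have hd0 : 0 < d := by positivity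
  have hI : Integrable (fun s => d / (2 * c) * x s ^ (2 * (2 * k))
      + c / (2 * d) * y s ^ (2 * (2 * k))) μ := (i1.const_mul _).add (i2.const_mul _)
  have hle : ∀ s, x s ^ (2 * k) * y s ^ (2 * k) ≤ d / (2 * c) * x s ^ (2 * (2 * k))
      + c / (2 * d) * y s ^ (2 * (2 * k)) := by
    intro s
    have e1 : x s ^ (2 * (2 * k)) = (x s ^ (2 * k)) ^ 2 := by rw [← pow_mul]; ring_nf
    have e2 : y s ^ (2 * (2 * k)) = (y s ^ (2 * k)) ^ 2 := by rw [← pow_mul]; ring_nf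
    rw [e1, e2]
    set X := x s ^ (2 * k)
    set Y := y s ^ (2 * k)
    have e3 : d / (2 * c) * X ^ 2 + c / (2 * d) * Y ^ 2 - X * Y
        = (d * X - c * Y) ^ 2 / (2 * c * d) := by field_simp; ring
    have : 0 ≤ (d * X - c * Y) ^ 2 / (2 * c * d) := by positivity
    linarith
  have hi : Integrable (fun s => x s ^ (2 * k) * y s ^ (2 * k)) μ := by
    refine hI.mono' (by fun_prop) ?_
    filter_upwards with s
    rw [Real.norm_of_nonneg (by rw [pow_mul, pow_mul]; positivity)]
    exact hle s
  refine ⟨hi, (integral_mono hi hI hle).trans ?_⟩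
  rw [integral_add (i1.const_mul _) (i2.const_mul _), integral_const_mul, integral_const_mul]
  have j1 := h1.integral_pow_le ha hx (2 * k)
  have j2 := h2.integral_pow_le hb hy (2 * k)
  have e1 : a ^ (2 * (2 * k)) = c ^ 2 := by rw [hc, ← pow_mul]; ring_nf
  have e2 : b ^ (2 * (2 * k)) = d ^ 2 := by rw [hd, ← pow_mul]; ring_nf
  rw [e1] at j1
  rw [e2] at j2
  calc _ ≤ d / (2 * c) * (2 * (2 * k).factorial * c ^ 2)
        + c / (2 * d) * (2 * (2 * k).factorial * d ^ 2) := by gcongr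
    _ = _ := by rw [mul_pow, ← hc, ← hd]; field_simp; ring

namespace LMModel

variable {n : ℕ} {D : LMModel.{u} n} {t C₃ C₄ C₅ σ : ℝ}

lemma score_eq (z : (Fin D.p → ℝ) × ℝ) : D.score z = (D.Ωstar *ᵥ D.ξ) ⬝ᵥ z.1 := by
  rw [score, dotProduct_mulVec, ← mulVec_transpose, D.isSymm_Ωstar.eq]

lemma Regular.integrable_dotProduct_sq (h : D.Regular t C₃ C₄ C₅ σ) (v : Fin D.p → ℝ) :
    Integrable (fun z => (v ⬝ᵥ z.1) ^ 2) D.law := by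
  simpa [sq] using (h.integral_mul_eq v v).1

lemma Regular.integral_dotProduct_sq (h : D.Regular t C₃ C₄ C₅ σ) (v : Fin D.p → ℝ) :
    ∫ z, (v ⬝ᵥ z.1) ^ 2 ∂D.law = v ⬝ᵥ D.secondMoment *ᵥ v := by
  simpa [sq] using (h.integral_mul_eq v v).2

lemma Regular.integrable_resid_sq (h : D.Regular t C₃ C₄ C₅ σ) :
    Integrable (fun z => D.resid z ^ 2) D.law := by
  simpa using h.residual.integrable_pow h.σ_pos D.measurable_resid 1

/-- The normal equations `E[(bᵀX₀) (Y₀ - X₀ᵀ βbar)] = 0` for the least-squares target. -/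
lemma Regular.integral_dotProduct_mul_resid (h : D.Regular t C₃ C₄ C₅ σ) (b : Fin D.p → ℝ) :
    ∫ z, (b ⬝ᵥ z.1) * D.resid z ∂D.law = 0 := by
  have i1 := h.integrable_dotProduct_sq b
  have i2 := h.integrable_resid_sq
  have i3 : Integrable (fun z => (b ⬝ᵥ z.1) * D.resid z) D.law := by
    refine ((i1.add i2).div_const 2).mono'
      ((measurable_dotProduct_fst b).mul D.measurable_resid).aestronglyMeasurable ?_
    filter_upwards with z
    exact abs_mul_abs_le
  set m := ∫ z, (b ⬝ᵥ z.1) * D.resid z ∂D.law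
  set q := ∫ z, (b ⬝ᵥ z.1) ^ 2 ∂D.law
  have hq : 0 ≤ q := integral_nonneg fun z => sq_nonneg _
  have key : ∀ c : ℝ, 0 ≤ -c * m + c ^ 2 / 2 * q := by
    intro c
    have h0 := D.βbar_min (D.βbar + c • b)
    have e : ∀ z : (Fin D.p → ℝ) × ℝ, 1 / 2 * (z.2 - z.1 ⬝ᵥ (D.βbar + c • b)) ^ 2
        = 1 / 2 * D.resid z ^ 2 + (-c * ((b ⬝ᵥ z.1) * D.resid z) + c ^ 2 / 2 * (b ⬝ᵥ z.1) ^ 2) := by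
      intro z
      rw [resid, dotProduct_add, dotProduct_smul, dotProduct_comm z.1 b, smul_eq_mul]; ring
    simp_rw [e] at h0
    rw [integral_add (i2.const_mul _) (by exact (i3.const_mul _).add (i1.const_mul _)),
      integral_add (i3.const_mul _) (i1.const_mul _), integral_const_mul (-c),
      integral_const_mul (c ^ 2 / 2)] at h0
    have e2 : ∫ z : (Fin D.p → ℝ) × ℝ, 1 / 2 * (z.2 - z.1 ⬝ᵥ D.βbar) ^ 2 ∂D.law
      = ∫ z, 1 / 2 * D.resid z ^ 2 ∂D.law := rfl
    linarith
  -- the minimising step is `m / q`; enlarging the denominator covers the case `q = 0`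
  have h1 := key (m / (q + 1))
  have h2 : -(m / (q + 1)) * m + (m / (q + 1)) ^ 2 / 2 * q
      = -(m ^ 2 * (q + 2)) / (2 * (q + 1) ^ 2) := by field_simp; ring
  rw [h2, div_nonneg_iff] at h1
  rcases h1 with ⟨h1, -⟩ | ⟨-, h1⟩
  · have : m ^ 2 ≤ 0 := by nlinarith [sq_nonneg m]
    exact pow_eq_zero_iff (two_ne_zero) |>.1 (le_antisymm this (sq_nonneg m))
  · nlinarith

/-- A bound for `E[(vᵀX₀)² (Y₀ - X₀ᵀ βbar)²]` in terms of `‖v‖₁`, which uses sub-gaussian entries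
only. -/
lemma Regular.integral_sq_mul_resid_sq_le (h : D.Regular t C₃ C₄ C₅ σ) (v : Fin D.p → ℝ) :
    Integrable (fun z => (v ⬝ᵥ z.1) ^ 2 * D.resid z ^ 2) D.law ∧
    ∫ z, (v ⬝ᵥ z.1) ^ 2 * D.resid z ^ 2 ∂D.law ≤ 4 * (t * σ) ^ 2 * oneNorm v ^ 2 := by
  have hk := fun k => SubGaussianAt.integral_pow_mul_pow_le h.t_pos h.σ_pos (by fun_prop)
    D.measurable_resid (h.entry k) h.residual 1
  simp only [mul_one] at hk
  have hI : Integrable (fun z => ∑ k, oneNorm v * |v k| * (z.1 k ^ 2 * D.resid z ^ 2)) D.law :=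
    integrable_finsetSum _ fun k _ => (hk k).1.const_mul _
  have hle : ∀ z, (v ⬝ᵥ z.1) ^ 2 * D.resid z ^ 2
      ≤ ∑ k, oneNorm v * |v k| * (z.1 k ^ 2 * D.resid z ^ 2) := by
    intro z
    have hcs := Finset.sum_mul_sq_le_sq_mul_sq Finset.univ (fun k => √|v k|)
      (fun k => √|v k| * |z.1 k|)
    have e1 : ∀ i, √|v i| * (√|v i| * |z.1 i|) = |v i| * |z.1 i| := fun i => by
      rw [← mul_assoc, Real.mul_self_sqrt (abs_nonneg _)]
    have e2 : ∀ i, (√|v i| * |z.1 i|) ^ 2 = |v i| * z.1 i ^ 2 := fun i => by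
      rw [mul_pow, Real.sq_sqrt (abs_nonneg _), sq_abs]
    simp only [e1, e2, Real.sq_sqrt (abs_nonneg _)] at hcs
    have h2 : |v ⬝ᵥ z.1| ≤ ∑ i, |v i| * |z.1 i| := by
      rw [dotProduct]
      exact (Finset.abs_sum_le_sum_abs _ _).trans (le_of_eq (by simp [abs_mul]))
    have h3 : (v ⬝ᵥ z.1) ^ 2 ≤ oneNorm v * ∑ i, |v i| * z.1 i ^ 2 := by
      calc (v ⬝ᵥ z.1) ^ 2 = |v ⬝ᵥ z.1| ^ 2 := (sq_abs _).symm
        _ ≤ (∑ i, |v i| * |z.1 i|) ^ 2 := by gcongr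
        _ ≤ _ := hcs
    calc _ ≤ (oneNorm v * ∑ i, |v i| * z.1 i ^ 2) * D.resid z ^ 2 := by gcongr
      _ = _ := by
        rw [Finset.mul_sum, Finset.sum_mul]
        exact Finset.sum_congr rfl fun k _ => by ring
  have hi : Integrable (fun z => (v ⬝ᵥ z.1) ^ 2 * D.resid z ^ 2) D.law := by
    refine hI.mono' (((measurable_dotProduct_fst v).pow_const 2).mul
      (D.measurable_resid.pow_const 2)).aestronglyMeasurable ?_
    filter_upwards with z
    rw [Real.norm_of_nonneg (by positivity)]
    exact hle z
  refine ⟨hi, (integral_mono hi hI hle).trans ?_⟩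
  rw [integral_finsetSum _ fun k _ => (hk k).1.const_mul _]
  simp_rw [integral_const_mul]
  calc _ ≤ ∑ k, oneNorm v * |v k| * (2 * (Nat.factorial 2 : ℝ) * (t * σ) ^ 2) := by
        gcongr with k
        · exact mul_nonneg (oneNorm_nonneg v) (abs_nonneg _)
        · exact (hk k).2
    _ = _ := by
        rw [← Finset.sum_mul, ← Finset.mul_sum]
        have : ∑ k, |v k| = oneNorm v := rfl
        rw [this, Nat.factorial_two]; push_cast; ring

/-- Every linear functional of `X₀` is sub-gaussian, at scale `t` times its norm. -/
def SubGaussianDirections (D : LMModel.{u} n) (t : ℝ) : Prop :=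
  ∀ v : Fin D.p → ℝ, v ≠ 0 → SubGaussianAt D.law (fun z => v ⬝ᵥ z.1) (t * twoNorm v)

/-- A bound for `E[(vᵀX₀)² (Y₀ - X₀ᵀ βbar)²]` in terms of `‖v‖₂`, for sub-gaussian directions. -/
lemma Regular.integral_sq_mul_resid_sq_le_twoNorm (h : D.Regular t C₃ C₄ C₅ σ)
    (hd : D.SubGaussianDirections t) (v : Fin D.p → ℝ) :
    ∫ z, (v ⬝ᵥ z.1) ^ 2 * D.resid z ^ 2 ∂D.law ≤ 4 * (t * σ) ^ 2 * twoNorm v ^ 2 := by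
  rcases eq_or_ne v 0 with rfl | hv
  · simp only [zero_dotProduct]; simp; positivity
  · have := (SubGaussianAt.integral_pow_mul_pow_le (mul_pos h.t_pos (twoNorm_pos hv)) h.σ_pos
      (measurable_dotProduct_fst v) D.measurable_resid (hd v hv) h.residual 1).2
    simp only [mul_one] at this
    refine this.trans (le_of_eq ?_)
    rw [Nat.factorial_two]; push_cast; ring

/-- First and second moments of the variable `(ξᵀ Ω* X₀)² (Y₀ - X₀ᵀ βbar)²`, whose mean is `V`. -/
lemma Regular.V_moments (h : D.Regular t C₃ C₄ C₅ σ) :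
    Integrable (fun z => D.score z ^ 2 * D.resid z ^ 2) D.law ∧
    Integrable (fun z => (D.score z ^ 2 * D.resid z ^ 2) ^ 2) D.law ∧
    ∫ z, (D.score z ^ 2 * D.resid z ^ 2) ^ 2 ∂D.law
      ≤ 48 * (t * C₄ * σ * twoNorm D.ξ) ^ 4 := by
  have ha := mul_pos h.t_pos h.twoNorm_Ωstar_mulVec_pos
  have h1 := SubGaussianAt.integral_pow_mul_pow_le ha h.σ_pos D.measurable_score D.measurable_resid
    h.loading h.residual 1
  have h2 := SubGaussianAt.integral_pow_mul_pow_le ha h.σ_pos D.measurable_score D.measurable_resid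
    h.loading h.residual 2
  have e : ∀ z, D.score z ^ (2 * 2) * D.resid z ^ (2 * 2) = (D.score z ^ 2 * D.resid z ^ 2) ^ 2 :=
    fun z => by ring
  simp only [e] at h2
  refine ⟨h1.1, h2.1, h2.2.trans ?_⟩
  have h3 := h.twoNorm_Ωstar_mulVec_le D.ξ
  have h4 : 2 * ((2 * 2).factorial : ℝ) = 48 := by norm_num [Nat.factorial]
  rw [h4]
  have ht := h.t_pos.le
  have hσ := h.σ_pos.le
  have h5 := h.twoNorm_Ωstar_mulVec_pos.le
  calc 48 * (t * twoNorm (D.Ωstar *ᵥ D.ξ) * σ) ^ (2 * 2)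
      ≤ 48 * (t * (C₄ * twoNorm D.ξ) * σ) ^ (2 * 2) := by gcongr
    _ = _ := by ring

/-- The asymptotic variance is bounded below by the squared norm of the loading: condition on `X₀`,
and use `E[(ξᵀ Ω* X₀)²] = ξᵀ Ω* ξ`. -/
lemma Regular.le_V (h : D.Regular t C₃ C₄ C₅ σ) : C₅ * C₃ * twoNorm D.ξ ^ 2 ≤ D.V := by
  set m : MeasurableSpace ((Fin D.p → ℝ) × ℝ) := MeasurableSpace.comap Prod.fst inferInstance
  have hm : m ≤ Prod.instMeasurableSpace := measurable_fst.comap_le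
  have hsm : StronglyMeasurable[m] fun z => D.score z ^ 2 := by
    have h1 : Measurable fun x : Fin D.p → ℝ => (D.ξ ⬝ᵥ D.Ωstar *ᵥ x) ^ 2 := by
      simp only [dotProduct, mulVec]; fun_prop
    exact (h1.comp (comap_measurable Prod.fst)).stronglyMeasurable
  have hi := h.V_moments.1
  have h1 := condExp_mul_of_stronglyMeasurable_left (μ := D.law) hsm hi h.integrable_resid_sq
  have hV : D.V = ∫ z, D.score z ^ 2 * (D.law[fun z => D.resid z ^ 2 | m]) z ∂D.law := by
    have : D.V = ∫ z, (D.law[(fun z => D.score z ^ 2) * (fun z => D.resid z ^ 2) | m]) z ∂D.law :=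
      (integral_condExp hm).symm
    rw [this]
    exact integral_congr_ae h1
  have hs : Integrable (fun z => D.score z ^ 2) D.law := by
    simp_rw [score_eq]; exact h.integrable_dotProduct_sq _
  have hs2 : ∫ z, D.score z ^ 2 ∂D.law = D.ξ ⬝ᵥ D.Ωstar *ᵥ D.ξ := by
    simp_rw [score_eq]
    rw [h.integral_dotProduct_sq, mulVec_mulVec, h.secondMoment_mul, one_mulVec, dotProduct_comm]
  rw [hV]
  calc C₅ * C₃ * twoNorm D.ξ ^ 2 ≤ C₅ * ∫ z, D.score z ^ 2 ∂D.law := by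
        rw [hs2, mul_assoc]
        exact mul_le_mul_of_nonneg_left (h.le_quadForm_Ωstar D.ξ) h.C₅_pos.le
    _ = ∫ z, C₅ * D.score z ^ 2 ∂D.law := (integral_const_mul _ _).symm
    _ ≤ _ := by
        refine integral_mono_ae (hs.const_mul _) ((integrable_condExp).congr h1) ?_
        filter_upwards [h.condVar] with z hz
        rw [mul_comm]
        exact mul_le_mul_of_nonneg_left hz (sq_nonneg _)

lemma Regular.V_pos (h : D.Regular t C₃ C₄ C₅ σ) : 0 < D.V :=
  lt_of_lt_of_le (mul_pos (mul_pos h.C₅_pos h.C₃_pos) (pow_pos (twoNorm_pos D.ξ_ne_zero) 2)) h.le_V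

/-! ### Sample second moments -/

lemma sampleSecondMoment_apply (I : Finset (Fin n)) (s : D.S) (k l : Fin D.p) :
    D.sampleSecondMoment I s k l = 1 / (I.card : ℝ) * ∑ i ∈ I, D.X i s k * D.X i s l := by
  simp [sampleSecondMoment, Matrix.sum_apply, vecMulVec_apply]

lemma sampleSecondMoment_mulVec (I : Finset (Fin n)) (s : D.S) (v : Fin D.p → ℝ) :
    D.sampleSecondMoment I s *ᵥ v = (1 / (I.card : ℝ)) • ∑ i ∈ I, (D.X i s ⬝ᵥ v) • D.X i s := by
  rw [sampleSecondMoment, smul_mulVec, sum_mulVec]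
  congr 1
  refine Finset.sum_congr rfl fun i _ => ?_
  ext k
  simp only [mulVec, vecMulVec_apply, dotProduct, Pi.smul_apply, smul_eq_mul, Finset.sum_mul]
  exact Finset.sum_congr rfl fun l _ => by ring

lemma isSymm_sampleSecondMoment (I : Finset (Fin n)) (s : D.S) :
    (D.sampleSecondMoment I s).IsSymm := by
  ext k l
  simp [sampleSecondMoment_apply, mul_comm]

lemma quadForm_sampleSecondMoment (I : Finset (Fin n)) (s : D.S) (v : Fin D.p → ℝ) :
    v ⬝ᵥ D.sampleSecondMoment I s *ᵥ v = 1 / (I.card : ℝ) * ∑ i ∈ I, (v ⬝ᵥ D.X i s) ^ 2 := by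
  rw [sampleSecondMoment_mulVec, dotProduct_smul, dotProduct_sum, smul_eq_mul]
  congr 1
  refine Finset.sum_congr rfl fun i _ => ?_
  rw [dotProduct_smul, dotProduct_comm (D.X i s), smul_eq_mul, sq]

lemma quadForm_sampleSecondMoment_nonneg (I : Finset (Fin n)) (s : D.S) (v : Fin D.p → ℝ) :
    0 ≤ v ⬝ᵥ D.sampleSecondMoment I s *ᵥ v := by
  rw [quadForm_sampleSecondMoment]
  positivity

/-! ### The logarithmic dimension -/

lemma exp_logDim (D : LMModel.{u} n) : Real.exp D.logDim = ((max D.p n : ℕ) : ℝ) := by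
  obtain ⟨j⟩ := D.nonempty_fin
  have : 0 < max D.p n := lt_max_of_lt_left j.pos
  exact Real.exp_log (by exact_mod_cast this)

lemma p_le_exp_logDim (D : LMModel.{u} n) : (D.p : ℝ) ≤ Real.exp D.logDim := by
  rw [exp_logDim]; exact_mod_cast le_max_left _ _

lemma n_le_exp_logDim (D : LMModel.{u} n) : (n : ℝ) ≤ Real.exp D.logDim := by
  rw [exp_logDim]; exact_mod_cast le_max_right _ _

lemma logDim_nonneg (D : LMModel.{u} n) : 0 ≤ D.logDim := by
  obtain ⟨j⟩ := D.nonempty_fin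
  have : 1 ≤ max D.p n := le_max_of_le_left j.pos
  exact Real.log_nonneg (by exact_mod_cast this)

lemma lam_sq (D : LMModel.{u} n) : D.lam ^ 2 = D.logDim / n :=
  Real.sq_sqrt (div_nonneg D.logDim_nonneg (Nat.cast_nonneg n))

lemma lam_nonneg (D : LMModel.{u} n) : 0 ≤ D.lam := Real.sqrt_nonneg _

/-! ### Concentration of sample averages -/

/-- Bernstein's inequality at the rate `λ_n`. The condition on `K` makes the probability small
enough for a union bound over the `p²` entries of a matrix. -/
lemma measure_abs_average_sub_gt_le {ρ K : ℝ} (hK0 : 0 ≤ K) (hK : 256 ≤ ρ * K ^ 2)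
    (hKl : K * D.lam ≤ 16) {I : Finset (Fin n)} (hn : 0 < n) (hI0 : 0 < I.card)
    (hI : ρ * n ≤ I.card) {x y : (Fin D.p → ℝ) × ℝ → ℝ} {a b : ℝ} (ha : 0 < a) (hb : 0 < b)
    (hx : Measurable x) (hy : Measurable y) (h1 : SubGaussianAt D.law x a)
    (h2 : SubGaussianAt D.law y b) :
    D.P {s | a * b * (K * D.lam)
        < |1 / (I.card : ℝ) * ∑ i ∈ I, x (D.obs i s) * y (D.obs i s) - ∫ z, x z * y z ∂D.law|}
      ≤ ENNReal.ofReal (2 * Real.exp (-(4 * D.logDim))) := by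
  have hc : (0 : ℝ) < I.card := by exact_mod_cast hI0
  have hn' : (0 : ℝ) < n := by exact_mod_cast hn
  have h := measure_abs_sum_mul_sub_gt_le (law := D.law) D.indep D.measurable_obs D.map_eq ha hb
    hx hy h1 h2 (mul_nonneg hK0 D.lam_nonneg) hKl I
  refine (measure_mono ?_).trans (h.trans (ENNReal.ofReal_le_ofReal ?_))
  · intro s hs
    simp only [Set.mem_ofPred_eq] at hs ⊢
    set m := ∫ z, x z * y z ∂D.law
    have e : 1 / (I.card : ℝ) * ∑ i ∈ I, x (D.obs i s) * y (D.obs i s) - m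
        = (∑ i ∈ I, (x (D.obs i s) * y (D.obs i s) - m)) / I.card := by
      rw [Finset.sum_sub_distrib, Finset.sum_const, nsmul_eq_mul]; field_simp
    rw [e, abs_div, abs_of_pos hc, lt_div_iff₀ hc] at hs
    exact (mul_comm _ _).trans_lt hs
  · gcongr
    rw [mul_pow, lam_sq]
    have h3 : ρ * K ^ 2 * D.logDim ≤ I.card * (K ^ 2 * (D.logDim / n)) := by
      have : ρ ≤ I.card / n := by rwa [le_div_iff₀ hn']
      calc ρ * K ^ 2 * D.logDim ≤ I.card / n * K ^ 2 * D.logDim := by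
            gcongr; exact D.logDim_nonneg
        _ = _ := by ring
    have := mul_le_mul_of_nonneg_right hK D.logDim_nonneg
    linarith

/-- The union bound over a finite index type. -/
lemma measure_exists_le {Ω ι : Type*} [MeasurableSpace Ω] {P : Measure Ω} [Fintype ι]
    {q : ι → Ω → Prop} {b : ℝ} (h : ∀ k, P {s | q k s} ≤ ENNReal.ofReal b) :
    P {s | ∃ k, q k s} ≤ ENNReal.ofReal (Fintype.card ι * b) := by
  have e : {s | ∃ k, q k s} = ⋃ k, {s | q k s} := by ext s; simp
  rw [e]
  refine (measure_iUnion_fintype_le _ _).trans ((Finset.sum_le_sum fun k _ => h k).trans ?_)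
  rw [Finset.sum_const, nsmul_eq_mul, ENNReal.ofReal_mul (by positivity), ENNReal.ofReal_natCast]
  rfl

lemma measure_exists_pair_le {q : Fin D.p → Fin D.p → D.S → Prop}
    (h : ∀ k l, D.P {s | q k l s} ≤ ENNReal.ofReal (2 * Real.exp (-(4 * D.logDim)))) :
    D.P {s | ∃ k l, q k l s} ≤ ENNReal.ofReal (2 * Real.exp (-D.logDim)) := by
  have h1 := measure_exists_le (ι := Fin D.p × Fin D.p) (q := fun x => q x.1 x.2)
    fun x => h x.1 x.2
  have e : {s | ∃ k l, q k l s} = {s | ∃ x : Fin D.p × Fin D.p, q x.1 x.2 s} := by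
    ext s; simp
  rw [e]
  refine h1.trans (ENNReal.ofReal_le_ofReal ?_)
  rw [Fintype.card_prod, Fintype.card_fin]
  push_cast
  have hp := D.p_le_exp_logDim
  have hL := D.logDim_nonneg
  calc (D.p : ℝ) * D.p * (2 * Real.exp (-(4 * D.logDim)))
      ≤ Real.exp D.logDim * Real.exp D.logDim * (2 * Real.exp (-(4 * D.logDim))) := by gcongr
    _ = 2 * Real.exp (-(2 * D.logDim)) := by
        rw [mul_left_comm, ← Real.exp_add, ← Real.exp_add]; ring_nf
    _ ≤ _ := by gcongr; linarith

/-- `Ω*` is an approximate inverse of the sample second-moment matrix. -/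
lemma Regular.measure_approxInverse_le (h : D.Regular t C₃ C₄ C₅ σ)
    {ρ K : ℝ} (hK0 : 0 ≤ K) (hK : 256 ≤ ρ * K ^ 2) (hKl : K * D.lam ≤ 16) {I : Finset (Fin n)}
    (hn : 0 < n) (hI0 : 0 < I.card) (hI : ρ * n ≤ I.card) :
    D.P {s | ∃ k l, t * t * (K * D.lam) < |(D.sampleSecondMoment I s * D.Ωstar - 1) k l|}
      ≤ ENNReal.ofReal (2 * Real.exp (-D.logDim)) := by
  refine measure_exists_pair_le fun k l => ?_
  refine (measure_mono ?_).trans (measure_abs_average_sub_gt_le hK0 hK hKl hn hI0 hI h.t_pos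
    h.t_pos (by fun_prop) (D.measurable_precision l) (h.entry k) (h.precision l))
  intro s hs
  have e1 : ∫ z, z.1 k * (D.Ωstar *ᵥ z.1) l ∂D.law = (1 : Matrix (Fin D.p) (Fin D.p) ℝ) k l := by
    have := (h.integral_mul_eq (Pi.single k 1) (D.Ωstar l)).2
    simp only [single_one_dotProduct] at this
    refine this.trans ?_
    rw [← h.secondMoment_mul, mul_apply]
    simp only [mulVec, dotProduct]
    exact Finset.sum_congr rfl fun j _ => by rw [D.isSymm_Ωstar.apply]
  have e2 : (D.sampleSecondMoment I s * D.Ωstar - 1) k l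
      = 1 / (I.card : ℝ) * ∑ i ∈ I, D.X i s k * (D.Ωstar *ᵥ D.X i s) l
        - (1 : Matrix (Fin D.p) (Fin D.p) ℝ) k l := by
    rw [Matrix.sub_apply, mul_apply]
    congr 1
    simp only [sampleSecondMoment_apply, mulVec, dotProduct, Finset.mul_sum, Finset.sum_mul]
    rw [Finset.sum_comm]
    refine Finset.sum_congr rfl fun i _ => Finset.sum_congr rfl fun j _ => ?_
    rw [D.isSymm_Ωstar.apply]; ring
  simp only [Set.mem_ofPred_eq] at hs ⊢
  rw [e1]
  rwa [e2] at hs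

/-- Entrywise concentration of the sample second-moment matrix. -/
lemma Regular.measure_entries_le (h : D.Regular t C₃ C₄ C₅ σ)
    {ρ K : ℝ} (hK0 : 0 ≤ K) (hK : 256 ≤ ρ * K ^ 2) (hKl : K * D.lam ≤ 16) {I : Finset (Fin n)}
    (hn : 0 < n) (hI0 : 0 < I.card) (hI : ρ * n ≤ I.card) :
    D.P {s | ∃ k l, t * t * (K * D.lam) < |(D.sampleSecondMoment I s - D.secondMoment) k l|}
      ≤ ENNReal.ofReal (2 * Real.exp (-D.logDim)) := by
  refine measure_exists_pair_le fun k l => ?_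
  refine (measure_mono ?_).trans (measure_abs_average_sub_gt_le hK0 hK hKl hn hI0 hI h.t_pos
    h.t_pos (by fun_prop) (by fun_prop) (h.entry k) (h.entry l))
  intro s hs
  simp only [Set.mem_ofPred_eq, Matrix.sub_apply, sampleSecondMoment_apply] at hs ⊢
  exact hs

/-- The vector `ξᵀ Ω*` nearly solves the sample debiasing equations: `ξᵀ Ω* Σ̂` is entrywise close
to `ξᵀ`. Its scale is the norm of `Ω* ξ`, so no bound on the `ℓ₁` norm of `Ω*` enters. -/
lemma Regular.measure_loading_le (h : D.Regular t C₃ C₄ C₅ σ)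
    {ρ K : ℝ} (hK0 : 0 ≤ K) (hK : 256 ≤ ρ * K ^ 2) (hKl : K * D.lam ≤ 16) {I : Finset (Fin n)}
    (hn : 0 < n) (hI0 : 0 < I.card) (hI : ρ * n ≤ I.card) :
    D.P {s | ∃ k, t * twoNorm (D.Ωstar *ᵥ D.ξ) * t * (K * D.lam)
        < |1 / (I.card : ℝ) * ∑ i ∈ I, D.score (D.obs i s) * D.X i s k - D.ξ k|}
      ≤ ENNReal.ofReal (2 * Real.exp (-D.logDim)) := by
  have e1 : ∀ k, ∫ z, D.score z * z.1 k ∂D.law = D.ξ k := by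
    intro k
    have := (h.integral_mul_eq (D.Ωstar *ᵥ D.ξ) (Pi.single k 1)).2
    simp only [single_one_dotProduct, ← score_eq] at this
    rw [this, dotProduct_mulVec, ← mulVec_transpose, D.isSymm_secondMoment.eq, mulVec_mulVec,
      h.secondMoment_mul, one_mulVec, dotProduct_single_one]
  have h1 := measure_exists_le (P := D.P) (ι := Fin D.p) fun k =>
    measure_abs_average_sub_gt_le hK0 hK hKl hn hI0 hI
      (mul_pos h.t_pos h.twoNorm_Ωstar_mulVec_pos) h.t_pos D.measurable_score
      (by fun_prop : Measurable fun z : (Fin D.p → ℝ) × ℝ => z.1 k) h.loading (h.entry k)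
  simp only [e1] at h1
  refine h1.trans (ENNReal.ofReal_le_ofReal ?_)
  rw [Fintype.card_fin]
  have hL := D.logDim_nonneg
  calc (D.p : ℝ) * (2 * Real.exp (-(4 * D.logDim)))
      ≤ Real.exp D.logDim * (2 * Real.exp (-(4 * D.logDim))) := by
        gcongr; exact D.p_le_exp_logDim
    _ = 2 * Real.exp (-(3 * D.logDim)) := by
        rw [mul_left_comm, ← Real.exp_add]; ring_nf
    _ ≤ _ := by gcongr; linarith

/-- The maximum of the squared scores over the sample is of logarithmic order. -/
lemma Regular.measure_score_sq_le (h : D.Regular t C₃ C₄ C₅ σ) :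
    D.P {s | ∃ i, 2 * (t * twoNorm (D.Ωstar *ᵥ D.ξ)) ^ 2 * D.logDim < D.score (D.obs i s) ^ 2}
      ≤ ENNReal.ofReal (2 * Real.exp (-D.logDim)) := by
  have ha := mul_pos h.t_pos h.twoNorm_Ωstar_mulVec_pos
  set a := t * twoNorm (D.Ωstar *ᵥ D.ξ)
  have hs := D.measurable_score
  have h1 := measure_exists_le (P := D.P) (ι := Fin n) (b := 2 / Real.exp (2 * D.logDim))
    (q := fun i s => 2 * a ^ 2 * D.logDim < D.score (D.obs i s) ^ 2) fun i => by
      have h2 := measure_sum_ge_le_div D.measurable_obs D.map_eq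
        (g := fun z => Real.exp (D.score z ^ 2 / a ^ 2)) (by fun_prop)
        (fun z => (Real.exp_pos _).le) (h.loading.integrable_exp hs) {i}
        (Real.exp_pos (2 * D.logDim))
      refine (measure_mono ?_).trans (h2.trans (ENNReal.ofReal_le_ofReal ?_))
      · intro s hs
        simp only [Set.mem_ofPred_eq, Finset.sum_singleton] at hs ⊢
        refine Real.exp_le_exp.2 ?_
        rw [le_div_iff₀ (by positivity)]
        linarith
      · have := h.loading.integral_exp_le
        rw [Finset.card_singleton, Nat.cast_one, one_mul]
        gcongr
  refine h1.trans (ENNReal.ofReal_le_ofReal ?_)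
  rw [Fintype.card_fin]
  calc (n : ℝ) * (2 / Real.exp (2 * D.logDim))
      ≤ Real.exp D.logDim * (2 / Real.exp (2 * D.logDim)) := by
        gcongr; exact D.n_le_exp_logDim
    _ = _ := by
        rw [two_mul, Real.exp_add, Real.exp_neg]; field_simp

/-- Chebyshev's inequality for the oracle estimator of `V`. -/
lemma Regular.measure_abs_sum_sub_V_le (h : D.Regular t C₃ C₄ C₅ σ) {c : ℝ} (hc : 0 < c) :
    D.P {s | c ≤ |∑ i, (D.score (D.obs i s) ^ 2 * D.resid (D.obs i s) ^ 2 - D.V)|}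
      ≤ ENNReal.ofReal (n * (48 * (t * C₄ * σ * twoNorm D.ξ) ^ 4) / c ^ 2) := by
  obtain ⟨i1, i2, i3⟩ := h.V_moments
  have hs := D.measurable_score
  have hr := D.measurable_resid
  have hV : ∫ z, D.score z ^ 2 * D.resid z ^ 2 ∂D.law = D.V := rfl
  have hm : MemLp (fun z => D.score z ^ 2 * D.resid z ^ 2 - D.V) 2 D.law :=
    ((memLp_two_iff_integrable_sq (by fun_prop)).2 i2).sub (memLp_const _)
  have h1 := measure_abs_sum_ge_le_div D.indep D.measurable_obs D.map_eq
    (f := fun z => D.score z ^ 2 * D.resid z ^ 2 - D.V) (by fun_prop) hm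
    (by rw [integral_sub i1 (integrable_const _), hV]; simp) Finset.univ hc
  refine h1.trans (ENNReal.ofReal_le_ofReal ?_)
  rw [Finset.card_univ, Fintype.card_fin]
  gcongr
  refine le_trans ?_ i3
  have e : ∀ z, (D.score z ^ 2 * D.resid z ^ 2 - D.V) ^ 2
      = (D.score z ^ 2 * D.resid z ^ 2) ^ 2
        - (2 * D.V * (D.score z ^ 2 * D.resid z ^ 2) - D.V ^ 2) :=
    fun z => by ring
  have i4 : Integrable (fun z => 2 * D.V * (D.score z ^ 2 * D.resid z ^ 2) - D.V ^ 2) D.law :=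
    (i1.const_mul _).sub (integrable_const _)
  simp_rw [e]
  rw [integral_sub i2 i4, integral_sub (i1.const_mul _) (integrable_const _),
    integral_const_mul, hV]
  simp only [integral_const, probReal_univ, smul_eq_mul, one_mul]
  nlinarith [sq_nonneg D.V]

/-! ### Restricted convexity of the sample second moments -/

/-- Entrywise closeness to the second-moment matrix gives restricted convexity. -/
lemma Regular.restrictedConvexity_of_entries (h : D.Regular t C₃ C₄ C₅ σ) {I : Finset (Fin n)}
    {s : D.S} {b : ℝ} (hb : ∀ k l, |(D.sampleSecondMoment I s - D.secondMoment) k l| ≤ b) :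
    RestrictedConvexity (D.sampleSecondMoment I s) C₄⁻¹ b := by
  intro v
  have h1 : |v ⬝ᵥ (D.sampleSecondMoment I s - D.secondMoment) *ᵥ v| ≤ b * oneNorm v ^ 2 := by
    rw [dotProduct_comm]
    refine (abs_dotProduct_le (M := b * oneNorm v) fun k => ?_).trans (le_of_eq (by ring))
    exact abs_dotProduct_le fun l => hb k l
  rw [sub_mulVec, dotProduct_sub] at h1
  linarith [neg_le_of_abs_le h1, h.le_quadForm_secondMoment v]

/-- With high probability the sample second-moment matrix is bounded below on all sums of `m` signed
basis vectors. -/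
lemma Regular.measure_signedBasis_le (h : D.Regular t C₃ C₄ C₅ σ) (hd : D.SubGaussianDirections t)
    {δ : ℝ} (hδ : 0 ≤ δ) (m : ℕ) {I : Finset (Fin n)} (hI0 : 0 < I.card) :
    D.P {s | ∃ f : Fin m → Fin D.p × Bool, (∑ k, signedBasis (f k)) ⬝ᵥ
        (D.sampleSecondMoment I s - D.secondMoment + δ • 1) *ᵥ (∑ k, signedBasis (f k)) < 0}
      ≤ ENNReal.ofReal ((D.p * 2 : ℝ) ^ m * Real.exp (-(I.card * (δ ^ 2 / (8 * t ^ 4))))) := by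
  have hc : (0 : ℝ) < I.card := by exact_mod_cast hI0
  have h1 := measure_exists_le (P := D.P) (ι := Fin m → Fin D.p × Bool)
    (b := Real.exp (-(I.card * (δ ^ 2 / (8 * t ^ 4)))))
    (q := fun f s => (∑ k, signedBasis (f k)) ⬝ᵥ
        (D.sampleSecondMoment I s - D.secondMoment + δ • 1) *ᵥ (∑ k, signedBasis (f k)) < 0)
    fun f => by
      set z := ∑ k, signedBasis (f k)
      rcases eq_or_ne z 0 with hz | hz
      · simp [hz]
      have hz0 := twoNorm_pos hz
      have ht := h.t_pos
      have hSG := hd z hz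
      have hm := measurable_dotProduct_fst z
      have i4 := hSG.integrable_pow (by positivity) hm 2
      have b4 := hSG.integral_pow_le (by positivity) hm 2
      have e : ∀ w : (Fin D.p → ℝ) × ℝ, (z ⬝ᵥ w.1) ^ (2 * 2) = ((z ⬝ᵥ w.1) ^ 2) ^ 2 := fun w => by
        ring
      simp only [e, Nat.factorial_two] at i4 b4
      have h2 := measure_sum_le_le_exp D.indep D.measurable_obs D.map_eq
        (q := fun w => (z ⬝ᵥ w.1) ^ 2) (hm.pow_const 2) (fun w => sq_nonneg _)
        (h.integrable_dotProduct_sq z) i4 b4 (by positivity)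
        (x := δ * twoNorm z ^ 2) (by positivity) I
      rw [h.integral_dotProduct_sq] at h2
      refine (measure_mono ?_).trans (h2.trans (ENNReal.ofReal_le_ofReal (le_of_eq ?_)))
      · intro s hs
        simp only [Set.mem_ofPred_eq] at hs ⊢
        rw [add_mulVec, sub_mulVec, smul_mulVec, one_mulVec, dotProduct_add, dotProduct_sub,
          dotProduct_smul, ← twoNorm_sq_eq_dotProduct, quadForm_sampleSecondMoment,
          smul_eq_mul] at hs
        have h3 : 1 / (I.card : ℝ) * ∑ i ∈ I, (z ⬝ᵥ D.X i s) ^ 2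
            ≤ z ⬝ᵥ D.secondMoment *ᵥ z - δ * twoNorm z ^ 2 := by linarith
        rw [one_div, inv_mul_le_iff₀ hc] at h3
        exact h3
      · congr 3
        push_cast
        field_simp
        ring
  refine h1.trans (ENNReal.ofReal_le_ofReal (le_of_eq ?_))
  simp

/-- A lower bound on all sums of `m` signed basis vectors extends to restricted convexity, with `ℓ₁`
tolerance of order `1 / m`, by Maurey's sparsification. -/
lemma Regular.restrictedConvexity_of_signedBasis (h : D.Regular t C₃ C₄ C₅ σ) {m : ℕ} (hm : 2 ≤ m)
    {I : Finset (Fin n)} {s : D.S} {b δ : ℝ}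
    (hb : ∀ k l, |(D.sampleSecondMoment I s - D.secondMoment) k l| ≤ b)
    (hf : ∀ f : Fin m → Fin D.p × Bool, 0 ≤ (∑ k, signedBasis (f k)) ⬝ᵥ
      (D.sampleSecondMoment I s - D.secondMoment + δ • 1) *ᵥ (∑ k, signedBasis (f k))) :
    RestrictedConvexity (D.sampleSecondMoment I s) (C₄⁻¹ - δ) ((b + δ) / (m - 1)) := by
  intro v
  have h1 := neg_oneNorm_sq_le_quadForm (b := b + δ)
    (((isSymm_sampleSecondMoment I s).sub D.isSymm_secondMoment).add (isSymm_one.smul δ)) hm hf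
    (fun j => by
      have := (le_abs_self _).trans (hb j j)
      rw [Matrix.add_apply, Matrix.smul_apply, one_apply_eq, smul_eq_mul, mul_one]
      linarith) v
  rw [add_mulVec, sub_mulVec, smul_mulVec, one_mulVec, dotProduct_add, dotProduct_sub,
    dotProduct_smul, ← twoNorm_sq_eq_dotProduct, smul_eq_mul] at h1
  linarith [h.le_quadForm_secondMoment v]

/-! ### Cross-fitting -/

/-- An estimator computed from the covariates of one fold may be treated as fixed in probability
bounds for sums over the other fold. -/
lemma measure_crossfit_le {I I' : Finset (Fin n)} (hII : Disjoint I I') {α : Type*}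
    [MeasurableSpace α] {U : D.S → α}
    (hU : Measurable[⨆ i ∈ I', MeasurableSpace.comap (D.X i) inferInstance] U)
    {F : α → (Fin D.p → ℝ) × ℝ → ℝ} (hF : Measurable (Function.uncurry F)) {B : Set α}
    (hB : MeasurableSet B) {c : ℝ} {δ : ℝ≥0∞}
    (h : ∀ u ∈ B, D.P {s | c ≤ |∑ i ∈ I, F u (D.obs i s)|} ≤ δ) :
    D.P {s | U s ∈ B ∧ c ≤ |∑ i ∈ I, F (U s) (D.obs i s)|} ≤ δ := by
  have hind := iIndepFun.indepFun_finset I I' hII D.indep D.measurable_obs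
  set W : D.S → I → (Fin D.p → ℝ) × ℝ := fun s i => D.obs i s with hWdef
  set W' : D.S → I' → (Fin D.p → ℝ) × ℝ := fun s i => D.obs i s with hWdef'
  have hW : Measurable W := measurable_pi_lambda _ fun i => D.measurable_obs i
  have hW' : Measurable W' := measurable_pi_lambda _ fun i => D.measurable_obs i
  have hle : (⨆ i ∈ I', MeasurableSpace.comap (D.X i) inferInstance)
      ≤ MeasurableSpace.comap W' inferInstance := by
    refine iSup₂_le fun i hi => ?_
    have e : D.X i = (fun w : I' → (Fin D.p → ℝ) × ℝ => (w ⟨i, hi⟩).1) ∘ W' := rfl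
    rw [e, ← MeasurableSpace.comap_comp]
    refine MeasurableSpace.comap_mono ?_
    exact Measurable.comap_le (by fun_prop)
  have hUW : IndepFun U W D.P := by
    refine (IndepFun_iff_Indep _ _ _).2 ?_
    refine indep_of_indep_of_le_left ((IndepFun_iff_Indep _ _ _).1 hind).symm ?_
    exact hU.comap_le.trans hle
  have hUm : Measurable U := hU.mono (hle.trans hW'.comap_le) le_rfl
  have hA : MeasurableSet {x : α × (I → (Fin D.p → ℝ) × ℝ) | c ≤ |∑ i, F x.1 (x.2 i)|} := by
    refine measurableSet_le measurable_const ?_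
    have : ∀ i : I, Measurable fun x : α × (I → (Fin D.p → ℝ) × ℝ) => F x.1 (x.2 i) := fun i =>
      hF.comp (by fun_prop : Measurable fun x : α × (I → (Fin D.p → ℝ) × ℝ) => (x.1, x.2 i))
    exact (Finset.measurable_sum _ fun i _ => this i).abs
  have e : ∀ (u : α) (s : D.S), ∑ i : I, F u (W s i) = ∑ i ∈ I, F u (D.obs i s) := fun u s =>
    Finset.sum_coe_sort I fun i => F u (D.obs i s)
  have := measure_inter_le_of_indepFun hUm hW hUW hA hB (δ := δ) (by
    intro u hu
    simpa only [Set.mem_ofPred_eq, e] using h u hu)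
  simpa only [Set.mem_ofPred_eq, e] using this

/-- Markov's inequality for the sample second moment in a direction estimated on the other fold. -/
lemma Regular.measure_crossfit_sq_le (h : D.Regular t C₃ C₄ C₅ σ) {I I' : Finset (Fin n)}
    (hII : Disjoint I I') {U : D.S → Fin D.p → ℝ}
    (hU : Measurable[⨆ i ∈ I', MeasurableSpace.comap (D.X i) inferInstance] U) {b c : ℝ}
    (hc : 0 < c) :
    D.P {s | twoNorm (U s) ≤ b ∧ c ≤ ∑ i ∈ I, (U s ⬝ᵥ D.X i s) ^ 2}
      ≤ ENNReal.ofReal (I.card * (C₃⁻¹ * b ^ 2) / c) := by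
  have hF : Measurable (Function.uncurry fun (u : Fin D.p → ℝ) (z : (Fin D.p → ℝ) × ℝ) =>
      (u ⬝ᵥ z.1) ^ 2) := by
    simp only [Function.uncurry_def, dotProduct]; fun_prop
  have hB : MeasurableSet {u : Fin D.p → ℝ | twoNorm u ≤ b} := by
    refine measurableSet_le ?_ measurable_const
    unfold twoNorm; fun_prop
  refine le_trans (measure_mono ?_) (measure_crossfit_le hII hU hF hB (c := c) fun u hu => ?_)
  · rintro s ⟨h1, h2⟩
    exact ⟨h1, h2.trans (le_abs_self _)⟩
  · have h1 := measure_sum_ge_le_div D.measurable_obs D.map_eq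
      (g := fun z => (u ⬝ᵥ z.1) ^ 2) ((measurable_dotProduct_fst u).pow_const 2)
      (fun z => sq_nonneg _) (h.integrable_dotProduct_sq u) I hc
    have e : ∀ s, |∑ i ∈ I, (u ⬝ᵥ (D.obs i s).1) ^ 2| = ∑ i ∈ I, (u ⬝ᵥ (D.obs i s).1) ^ 2 :=
      fun s => abs_of_nonneg (Finset.sum_nonneg fun i _ => sq_nonneg _)
    change D.P {s | c ≤ |∑ i ∈ I, (u ⬝ᵥ (D.obs i s).1) ^ 2|} ≤ _
    simp only [e]
    refine h1.trans (ENNReal.ofReal_le_ofReal ?_)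
    rw [h.integral_dotProduct_sq]
    gcongr
    refine (h.quadForm_secondMoment_le u).trans ?_
    have : 0 ≤ C₃⁻¹ := (inv_pos.2 h.C₃_pos).le
    gcongr
    · exact twoNorm_nonneg u
    · exact hu

/-- Chebyshev's inequality for the noise in a direction estimated on the other fold; the sum is
centred by the normal equations. -/
lemma Regular.measure_crossfit_sum_mul_resid_le (h : D.Regular t C₃ C₄ C₅ σ)
    {I I' : Finset (Fin n)} (hII : Disjoint I I') {U : D.S → Fin D.p → ℝ}
    (hU : Measurable[⨆ i ∈ I', MeasurableSpace.comap (D.X i) inferInstance] U)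
    {B : Set (Fin D.p → ℝ)} (hB : MeasurableSet B) {b c : ℝ} (hc : 0 < c)
    (hb : ∀ u ∈ B, ∫ z, (u ⬝ᵥ z.1) ^ 2 * D.resid z ^ 2 ∂D.law ≤ b) :
    D.P {s | U s ∈ B ∧ c ≤ |∑ i ∈ I, (U s ⬝ᵥ D.X i s) * D.resid (D.obs i s)|}
      ≤ ENNReal.ofReal (I.card * b / c ^ 2) := by
  have hr := D.measurable_resid
  have hF : Measurable (Function.uncurry fun (u : Fin D.p → ℝ) (z : (Fin D.p → ℝ) × ℝ) =>
      (u ⬝ᵥ z.1) * D.resid z) := by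
    simp only [Function.uncurry_def, dotProduct]; fun_prop
  refine measure_crossfit_le hII hU hF hB fun u hu => ?_
  have hm := measurable_dotProduct_fst u
  have e : ∀ z, ((u ⬝ᵥ z.1) * D.resid z) ^ 2 = (u ⬝ᵥ z.1) ^ 2 * D.resid z ^ 2 := fun z =>
    mul_pow _ _ _
  have h1 := measure_abs_sum_ge_le_div D.indep D.measurable_obs D.map_eq
    (f := fun z => (u ⬝ᵥ z.1) * D.resid z) (hm.mul hr)
    ((memLp_two_iff_integrable_sq (hm.mul hr).aestronglyMeasurable).2
      ((h.integral_sq_mul_resid_sq_le u).1.congr (Eventually.of_forall fun z => (e z).symm)))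
    (h.integral_dotProduct_mul_resid u) I hc
  refine h1.trans (ENNReal.ofReal_le_ofReal ?_)
  simp only [e]
  gcongr
  exact hb u hu

/-- Markov's inequality for the squared noise in a direction estimated on the other fold. -/
lemma Regular.measure_crossfit_sum_sq_mul_resid_le (h : D.Regular t C₃ C₄ C₅ σ)
    {I I' : Finset (Fin n)} (hII : Disjoint I I') {U : D.S → Fin D.p → ℝ}
    (hU : Measurable[⨆ i ∈ I', MeasurableSpace.comap (D.X i) inferInstance] U)
    {B : Set (Fin D.p → ℝ)} (hB : MeasurableSet B) {b c : ℝ} (hc : 0 < c)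
    (hb : ∀ u ∈ B, ∫ z, (u ⬝ᵥ z.1) ^ 2 * D.resid z ^ 2 ∂D.law ≤ b) :
    D.P {s | U s ∈ B ∧ c ≤ ∑ i ∈ I, (U s ⬝ᵥ D.X i s) ^ 2 * D.resid (D.obs i s) ^ 2}
      ≤ ENNReal.ofReal (I.card * b / c) := by
  have hr := D.measurable_resid
  have hF : Measurable (Function.uncurry fun (u : Fin D.p → ℝ) (z : (Fin D.p → ℝ) × ℝ) =>
      (u ⬝ᵥ z.1) ^ 2 * D.resid z ^ 2) := by
    simp only [Function.uncurry_def, dotProduct]; fun_prop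
  refine le_trans (measure_mono ?_) (measure_crossfit_le hII hU hF hB (c := c) fun u hu => ?_)
  · rintro s ⟨h1, h2⟩
    exact ⟨h1, h2.trans (le_abs_self _)⟩
  · have h1 := measure_sum_ge_le_div D.measurable_obs D.map_eq
      (g := fun z => (u ⬝ᵥ z.1) ^ 2 * D.resid z ^ 2)
      (((measurable_dotProduct_fst u).pow_const 2).mul (hr.pow_const 2))
      (fun z => by positivity) (h.integral_sq_mul_resid_sq_le u).1 I hc
    have e : ∀ s, |∑ i ∈ I, (u ⬝ᵥ (D.obs i s).1) ^ 2 * D.resid (D.obs i s) ^ 2|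
        = ∑ i ∈ I, (u ⬝ᵥ (D.obs i s).1) ^ 2 * D.resid (D.obs i s) ^ 2 :=
      fun s => abs_of_nonneg (Finset.sum_nonneg fun i _ => by positivity)
    change D.P {s | c ≤ |∑ i ∈ I, (u ⬝ᵥ (D.obs i s).1) ^ 2 * D.resid (D.obs i s) ^ 2|} ≤ _
    simp only [e]
    refine h1.trans (ENNReal.ofReal_le_ofReal ?_)
    gcongr
    exact hb u hu

/-! ### The error of the debiased estimator -/

/-- The error `ξᵀ (O - Ω*)` of an estimator `O` of `Ω*` in the direction of the loading. -/
noncomputable def loadingError (D : LMModel.{u} n) (O : Matrix (Fin D.p) (Fin D.p) ℝ) :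
    Fin D.p → ℝ :=
  D.ξ ᵥ* (O - D.Ωstar)

lemma dotProduct_mulVec_eq_score_add (O : Matrix (Fin D.p) (Fin D.p) ℝ) (x : Fin D.p → ℝ) (y : ℝ) :
    D.ξ ⬝ᵥ O *ᵥ x = D.score (x, y) + D.loadingError O ⬝ᵥ x := by
  rw [score, loadingError, vecMul_sub, sub_dotProduct, dotProduct_mulVec, dotProduct_mulVec]
  ring

/-- The bounds on the sums over the fold `I` which involve the error `v = ξᵀ (O - Ω*)` of the
precision matrix estimated on the other fold. The level is `ζ²` rather than `ζ`, as the expansion of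
the variance estimator loses a factor `ζ`. -/
structure FoldBounds (D : LMModel.{u} n) (ζ : ℝ) (I : Finset (Fin n)) (v : Fin D.p → ℝ) (s : D.S) :
    Prop where
  sq : (∑ i ∈ I, (v ⬝ᵥ D.X i s) ^ 2) * (D.s₀ * D.logDim) ≤ ζ ^ 2 * n * twoNorm D.ξ ^ 2
  resid : |∑ i ∈ I, (v ⬝ᵥ D.X i s) * D.resid (D.obs i s)| ≤ ζ ^ 2 * √n * twoNorm D.ξ
  resid_sq : ∑ i ∈ I, (v ⬝ᵥ D.X i s) ^ 2 * D.resid (D.obs i s) ^ 2 ≤ ζ ^ 2 * n * twoNorm D.ξ ^ 2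

/-- The contribution of one fold to the error of the debiased estimator. The error `ξᵀ (βhat -
βbar)` of the initial estimator is shared between the folds in proportion to their sizes. -/
noncomputable def foldError (D : LMModel.{u} n) (I : Finset (Fin n))
    (O : Matrix (Fin D.p) (Fin D.p) ℝ) (s : D.S) : ℝ :=
  (I.card : ℝ) / n * (D.ξ ⬝ᵥ (D.βhat s - D.βbar))
  + D.ξ ⬝ᵥ O *ᵥ ((1 / (n : ℝ)) • ∑ i ∈ I, (D.Y i s - D.X i s ⬝ᵥ D.βhat s) • D.X i s)
  - 1 / (n : ℝ) * ∑ i ∈ I, D.score (D.obs i s) * D.resid (D.obs i s)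

lemma remainder_eq (hn : 0 < n) (s : D.S) :
    D.remainder s = (D.foldError D.J (D.ΩhatJc s) s + D.foldError D.Jᶜ (D.ΩhatJ s) s) / √D.V := by
  have hn' : (n : ℝ) ≠ 0 := by exact_mod_cast hn.ne'
  have h1 : (D.J.card : ℝ) / n + (D.Jᶜ.card : ℝ) / n = 1 := by
    rw [← add_div, div_eq_one_iff_eq hn']
    have := Finset.card_add_card_compl D.J
    rw [Fintype.card_fin] at this
    exact_mod_cast this
  have h2 : ∑ i, (D.ξ ⬝ᵥ D.Ωstar *ᵥ D.X i s) * (D.Y i s - D.X i s ⬝ᵥ D.βbar) / √D.V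
      = (∑ i ∈ D.J, D.score (D.obs i s) * D.resid (D.obs i s)
        + ∑ i ∈ D.Jᶜ, D.score (D.obs i s) * D.resid (D.obs i s)) / √D.V := by
    rw [Finset.sum_add_sum_compl, Finset.sum_div]
    rfl
  have h3 : (D.Jᶜ.card : ℝ) / n = 1 - (D.J.card : ℝ) / n := by linarith
  rw [remainder, h2, debiased, foldError, foldError, dotProduct_sub, h3]
  ring

lemma sum_residual_mul_eq (I : Finset (Fin n)) (O : Matrix (Fin D.p) (Fin D.p) ℝ) (s : D.S) :
    D.ξ ⬝ᵥ O *ᵥ ((1 / (n : ℝ)) • ∑ i ∈ I, (D.Y i s - D.X i s ⬝ᵥ D.βhat s) • D.X i s)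
      = 1 / (n : ℝ) * ∑ i ∈ I, (D.score (D.obs i s) + D.loadingError O ⬝ᵥ D.X i s)
        * (D.resid (D.obs i s) - D.X i s ⬝ᵥ (D.βhat s - D.βbar)) := by
  rw [mulVec_smul, dotProduct_smul, smul_eq_mul, mulVec_sum, dotProduct_sum]
  congr 1
  refine Finset.sum_congr rfl fun i _ => ?_
  rw [mulVec_smul, dotProduct_smul, smul_eq_mul,
    dotProduct_mulVec_eq_score_add O (D.X i s) (D.Y i s), resid, obs, dotProduct_sub]
  ring

/-- Decomposition of the error of a fold: the oracle debiasing equations against the `ℓ₁` error of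
the initial estimator, the noise in the direction of the loading error, and the product of the two
estimation errors, treated by the Cauchy-Schwarz inequality. -/
lemma abs_foldError_le (hn : 0 < n) {I : Finset (Fin n)} (hI : 0 < I.card)
    (O : Matrix (Fin D.p) (Fin D.p) ℝ) (s : D.S) {M : ℝ}
    (hM : ∀ k, |1 / (I.card : ℝ) * ∑ i ∈ I, D.score (D.obs i s) * D.X i s k - D.ξ k| ≤ M) :
    |D.foldError I O s| ≤ M * oneNorm (D.βhat s - D.βbar)
      + 1 / n * |∑ i ∈ I, (D.loadingError O ⬝ᵥ D.X i s) * D.resid (D.obs i s)|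
      + 1 / n * √((∑ i ∈ I, (D.loadingError O ⬝ᵥ D.X i s) ^ 2)
          * ∑ i ∈ I, (D.X i s ⬝ᵥ (D.βhat s - D.βbar)) ^ 2) := by
  set Δ := D.βhat s - D.βbar
  set v := D.loadingError O
  have hn' : (0 : ℝ) < n := by exact_mod_cast hn
  have hI' : (0 : ℝ) < I.card := by exact_mod_cast hI
  have hIn : (I.card : ℝ) ≤ n := by
    have := Finset.card_le_univ I
    rw [Fintype.card_fin] at this
    exact_mod_cast this
  set w : Fin D.p → ℝ := fun k =>
    1 / (I.card : ℝ) * ∑ i ∈ I, D.score (D.obs i s) * D.X i s k - D.ξ k with hw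
  have h1 : |w ⬝ᵥ Δ| ≤ M * oneNorm Δ := abs_dotProduct_le hM
  have h2 : w ⬝ᵥ Δ = 1 / (I.card : ℝ) * ∑ i ∈ I, D.score (D.obs i s) * (D.X i s ⬝ᵥ Δ)
      - D.ξ ⬝ᵥ Δ := by
    simp only [hw, dotProduct, sub_mul, Finset.sum_sub_distrib, Finset.mul_sum, Finset.sum_mul]
    rw [Finset.sum_comm]
    congr 1
    exact Finset.sum_congr rfl fun i _ => Finset.sum_congr rfl fun k _ => by ring
  have h3 : D.foldError I O s = -((I.card : ℝ) / n * (w ⬝ᵥ Δ))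
      + 1 / n * ∑ i ∈ I, (v ⬝ᵥ D.X i s) * D.resid (D.obs i s)
      - 1 / n * ∑ i ∈ I, (v ⬝ᵥ D.X i s) * (D.X i s ⬝ᵥ Δ) := by
    have e : ∑ i ∈ I, (D.score (D.obs i s) + v ⬝ᵥ D.X i s) * (D.resid (D.obs i s) - D.X i s ⬝ᵥ Δ)
        = ∑ i ∈ I, D.score (D.obs i s) * D.resid (D.obs i s)
          + ∑ i ∈ I, (v ⬝ᵥ D.X i s) * D.resid (D.obs i s)
          - ∑ i ∈ I, D.score (D.obs i s) * (D.X i s ⬝ᵥ Δ)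
          - ∑ i ∈ I, (v ⬝ᵥ D.X i s) * (D.X i s ⬝ᵥ Δ) := by
      rw [← Finset.sum_add_distrib, ← Finset.sum_sub_distrib, ← Finset.sum_sub_distrib]
      exact Finset.sum_congr rfl fun i _ => by ring
    rw [foldError, sum_residual_mul_eq, e, h2]
    field_simp
    ring
  have h4 : |∑ i ∈ I, (v ⬝ᵥ D.X i s) * (D.X i s ⬝ᵥ Δ)|
      ≤ √((∑ i ∈ I, (v ⬝ᵥ D.X i s) ^ 2) * ∑ i ∈ I, (D.X i s ⬝ᵥ Δ) ^ 2) :=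
    Real.abs_le_sqrt (Finset.sum_mul_sq_le_sq_mul_sq _ _ _)
  have h5 : |(I.card : ℝ) / n * (w ⬝ᵥ Δ)| ≤ M * oneNorm Δ := by
    rw [abs_mul, abs_of_pos (by positivity)]
    refine le_trans ?_ h1
    exact mul_le_of_le_one_left (abs_nonneg _) ((div_le_one hn').2 hIn)
  rw [h3]
  refine (abs_sub _ _).trans (add_le_add ((abs_add_le _ _).trans (add_le_add ?_ ?_)) ?_)
  · rwa [abs_neg]
  · rw [abs_mul, abs_of_pos (by positivity)]
  · rw [abs_mul, abs_of_pos (by positivity)]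
    gcongr

/-! ### The variance estimator -/

/-- Perturbation of a sum of squares of products, from `x² - y² = (x - y)² + 2 (x - y) y` and
Young's inequality. -/
lemma abs_sum_sq_sub_le {ι : Type*} (I : Finset ι) (a b e d : ι → ℝ) {θ A : ℝ} (hθ : 0 < θ)
    (hA : ∀ i ∈ I, a i ^ 2 ≤ A) :
    |∑ i ∈ I, (a i + b i) ^ 2 * (e i - d i) ^ 2 - ∑ i ∈ I, a i ^ 2 * e i ^ 2|
      ≤ θ * ∑ i ∈ I, a i ^ 2 * e i ^ 2 + 3 * (1 + 1 / θ) * (∑ i ∈ I, b i ^ 2 * e i ^ 2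
        + A * ∑ i ∈ I, d i ^ 2 + (∑ i ∈ I, b i ^ 2) * ∑ i ∈ I, d i ^ 2) := by
  have h1 : ∀ i ∈ I, |(a i + b i) ^ 2 * (e i - d i) ^ 2 - a i ^ 2 * e i ^ 2|
      ≤ θ * (a i ^ 2 * e i ^ 2) + 3 * (1 + 1 / θ) * (b i ^ 2 * e i ^ 2 + A * d i ^ 2
        + b i ^ 2 * d i ^ 2) := by
    intro i hi
    set y := a i * e i with hy
    set x := (a i + b i) * (e i - d i) with hx
    have e1 : (a i + b i) ^ 2 * (e i - d i) ^ 2 = x ^ 2 := by rw [hx]; ring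
    have e2 : a i ^ 2 * e i ^ 2 = y ^ 2 := by rw [hy]; ring
    have h2 : (x - y) ^ 2 ≤ 3 * (b i ^ 2 * e i ^ 2 + A * d i ^ 2 + b i ^ 2 * d i ^ 2) := by
      have h3 : a i ^ 2 * d i ^ 2 ≤ A * d i ^ 2 :=
        mul_le_mul_of_nonneg_right (hA i hi) (sq_nonneg _)
      have h4 : x - y = b i * e i - a i * d i - b i * d i := by rw [hx, hy]; ring
      rw [h4]
      nlinarith [sq_nonneg (b i * e i + a i * d i), sq_nonneg (b i * e i + b i * d i),
        sq_nonneg (a i * d i - b i * d i)]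
    have h5 : |x ^ 2 - y ^ 2| ≤ θ * y ^ 2 + (1 + 1 / θ) * (x - y) ^ 2 := by
      have h6 : |x ^ 2 - y ^ 2| ≤ (x - y) ^ 2 + 2 * (|x - y| * |y|) := by
        have : x ^ 2 - y ^ 2 = (x - y) ^ 2 + 2 * ((x - y) * y) := by ring
        rw [this, ← abs_mul]
        refine (abs_add_le _ _).trans (add_le_add (abs_of_nonneg (sq_nonneg _)).le ?_)
        rw [abs_mul, abs_of_pos (two_pos)]
      have h7 : θ * y ^ 2 + 1 / θ * (x - y) ^ 2 - 2 * (|x - y| * |y|)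
          = (θ * |y| - |x - y|) ^ 2 / θ := by
        rw [← sq_abs y, ← sq_abs (x - y)]; field_simp; ring
      have : 0 ≤ (θ * |y| - |x - y|) ^ 2 / θ := by positivity
      linarith
    rw [e1, e2]
    refine h5.trans (add_le_add le_rfl ?_)
    have : 0 ≤ 1 + 1 / θ := by positivity
    calc _ ≤ (1 + 1 / θ) * (3 * (b i ^ 2 * e i ^ 2 + A * d i ^ 2 + b i ^ 2 * d i ^ 2)) := by gcongr
      _ = _ := by ring
  rw [← Finset.sum_sub_distrib]
  refine (Finset.abs_sum_le_sum_abs _ _).trans ((Finset.sum_le_sum h1).trans ?_)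
  rw [Finset.sum_add_distrib, ← Finset.mul_sum, ← Finset.mul_sum, Finset.sum_add_distrib,
    Finset.sum_add_distrib, ← Finset.mul_sum]
  have h8 : ∑ i ∈ I, b i ^ 2 * d i ^ 2 ≤ (∑ i ∈ I, b i ^ 2) * ∑ i ∈ I, d i ^ 2 := by
    rw [Finset.sum_mul]
    refine Finset.sum_le_sum fun i hi => mul_le_mul_of_nonneg_left ?_ (sq_nonneg _)
    exact Finset.single_le_sum (f := fun i => d i ^ 2) (fun _ _ => sq_nonneg _) hi
  gcongr

lemma abs_add_sub_le_of_relative {T₁ T₂ S₁ S₂ N θ η Q : ℝ} (hθ : 0 ≤ θ)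
    (h1 : |T₁ - S₁| ≤ θ * S₁ + 3 * Q) (h2 : |T₂ - S₂| ≤ θ * S₂ + 3 * Q)
    (h3 : |S₁ + S₂ - N| ≤ η * N) :
    |T₁ + T₂ - N| ≤ η * N + θ * (N + η * N) + 6 * Q := by
  have h4 : θ * (S₁ + S₂) ≤ θ * (N + η * N) :=
    mul_le_mul_of_nonneg_left (by linarith [(abs_le.1 h3).2]) hθ
  rw [abs_le] at h1 h2 h3 ⊢
  constructor <;> linarith

/-- The event on which all stochastic terms in the expansions are small. -/
structure GoodEvent (D : LMModel.{u} n) (ζ t K C₁ : ℝ) (s : D.S) : Prop where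
  init : s ∈ D.initialEvent C₁
  load : ∀ k, |1 / (D.J.card : ℝ) * ∑ i ∈ D.J, D.score (D.obs i s) * D.X i s k - D.ξ k|
    ≤ t * twoNorm (D.Ωstar *ᵥ D.ξ) * t * (K * D.lam)
  load_compl : ∀ k, |1 / (D.Jᶜ.card : ℝ) * ∑ i ∈ D.Jᶜ, D.score (D.obs i s) * D.X i s k - D.ξ k|
    ≤ t * twoNorm (D.Ωstar *ᵥ D.ξ) * t * (K * D.lam)
  score : ∀ i, D.score (D.obs i s) ^ 2 ≤ 2 * (t * twoNorm (D.Ωstar *ᵥ D.ξ)) ^ 2 * D.logDim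
  var : |∑ i, (D.score (D.obs i s) ^ 2 * D.resid (D.obs i s) ^ 2 - D.V)| ≤ ζ ^ 2 * (n * D.V)
  fold : D.FoldBounds ζ D.J (D.loadingError (D.ΩhatJc s)) s
  fold_compl : D.FoldBounds ζ D.Jᶜ (D.loadingError (D.ΩhatJ s)) s

lemma sum_sq_le_of_mem_initialEvent (hn : 0 < n) {C₁ : ℝ} {s : D.S} (hs : s ∈ D.initialEvent C₁)
    (I : Finset (Fin n)) :
    ∑ i ∈ I, (D.X i s ⬝ᵥ (D.βhat s - D.βbar)) ^ 2 ≤ C₁ * (D.s₀ * D.logDim) := by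
  have hn' : (0 : ℝ) < n := by exact_mod_cast hn
  have h1 := hs.2
  simp_rw [← dotProduct_sub] at h1
  have h2 : ∑ i ∈ I, (D.X i s ⬝ᵥ (D.βhat s - D.βbar)) ^ 2
      ≤ ∑ i, (D.X i s ⬝ᵥ (D.βhat s - D.βbar)) ^ 2 :=
    Finset.sum_le_sum_of_subset_of_nonneg (Finset.subset_univ _) fun _ _ _ => sq_nonneg _
  refine h2.trans ?_
  rw [one_div, inv_mul_le_iff₀ hn'] at h1
  refine h1.trans (le_of_eq ?_)
  field_simp

lemma Regular.abs_foldError_le (h : D.Regular t C₃ C₄ C₅ σ) {ζ K C₁ : ℝ} (hζ : 0 ≤ ζ) (hζ1 : ζ ≤ 1)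
    (hK : 0 ≤ K) (hC₁ : 0 ≤ C₁) (hn : 0 < n) (hs₀ : D.s₀ * D.τ ≤ ζ ^ 2) {I : Finset (Fin n)}
    (hI : 0 < I.card) {O : Matrix (Fin D.p) (Fin D.p) ℝ} {s : D.S} (hs : s ∈ D.initialEvent C₁)
    (hload : ∀ k, |1 / (I.card : ℝ) * ∑ i ∈ I, D.score (D.obs i s) * D.X i s k - D.ξ k|
      ≤ t * twoNorm (D.Ωstar *ᵥ D.ξ) * t * (K * D.lam))
    (hf : D.FoldBounds ζ I (D.loadingError O) s) :
    |D.foldError I O s| ≤ (t ^ 2 * C₄ * K * C₁ + 1 + √C₁) * ζ * (twoNorm D.ξ / √n) := by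
  have hn' : (0 : ℝ) < n := by exact_mod_cast hn
  have hsn : 0 < √(n : ℝ) := Real.sqrt_pos.2 hn'
  have hsn2 : √(n : ℝ) * √n = n := Real.mul_self_sqrt hn'.le
  have hsn3 : 1 / (n : ℝ) * √n = 1 / √n := by
    rw [div_mul_eq_mul_div, one_mul, Real.sqrt_div_self']
  have hx := twoNorm_nonneg D.ξ
  have ht := h.t_pos.le
  have hC₄ := h.C₄_pos.le
  have hL := D.lam_nonneg
  refine (LMModel.abs_foldError_le hn hI O s hload).trans ?_
  have hζ2 : ζ ^ 2 ≤ ζ := by nlinarith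
  have h1 : t * twoNorm (D.Ωstar *ᵥ D.ξ) * t * (K * D.lam) * oneNorm (D.βhat s - D.βbar)
      ≤ t ^ 2 * C₄ * K * C₁ * ζ * (twoNorm D.ξ / √n) := by
    have e1 : D.lam * D.lam = D.τ / √n := by
      rw [← sq, lam_sq, τ, div_div, hsn2]
    calc _ ≤ t * (C₄ * twoNorm D.ξ) * t * (K * D.lam) * (C₁ * D.s₀ * D.lam) := by
          gcongr
          · exact oneNorm_nonneg _
          · exact h.twoNorm_Ωstar_mulVec_le D.ξ
          · exact hs.1
      _ = t ^ 2 * C₄ * K * C₁ * twoNorm D.ξ * (D.s₀ * (D.lam * D.lam)) := by ring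
      _ = t ^ 2 * C₄ * K * C₁ * (D.s₀ * D.τ) * (twoNorm D.ξ / √n) := by rw [e1]; ring
      _ ≤ _ := by gcongr; exact hs₀.trans hζ2
  have h2 : 1 / (n : ℝ) * |∑ i ∈ I, (D.loadingError O ⬝ᵥ D.X i s) * D.resid (D.obs i s)|
      ≤ ζ * (twoNorm D.ξ / √n) := by
    calc _ ≤ 1 / (n : ℝ) * (ζ ^ 2 * √n * twoNorm D.ξ) := by gcongr; exact hf.resid
      _ = ζ ^ 2 * twoNorm D.ξ * (1 / (n : ℝ) * √n) := by ring
      _ = ζ ^ 2 * (twoNorm D.ξ / √n) := by rw [hsn3]; ring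
      _ ≤ _ := by gcongr
  have h3 : 1 / (n : ℝ) * √((∑ i ∈ I, (D.loadingError O ⬝ᵥ D.X i s) ^ 2)
      * ∑ i ∈ I, (D.X i s ⬝ᵥ (D.βhat s - D.βbar)) ^ 2) ≤ √C₁ * ζ * (twoNorm D.ξ / √n) := by
    have h4 : (∑ i ∈ I, (D.loadingError O ⬝ᵥ D.X i s) ^ 2)
        * ∑ i ∈ I, (D.X i s ⬝ᵥ (D.βhat s - D.βbar)) ^ 2 ≤ C₁ * (ζ * twoNorm D.ξ) ^ 2 * n := by
      calc _ ≤ (∑ i ∈ I, (D.loadingError O ⬝ᵥ D.X i s) ^ 2) * (C₁ * (D.s₀ * D.logDim)) := by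
            gcongr; exact sum_sq_le_of_mem_initialEvent hn hs I
        _ = C₁ * ((∑ i ∈ I, (D.loadingError O ⬝ᵥ D.X i s) ^ 2) * (D.s₀ * D.logDim)) := by ring
        _ ≤ C₁ * (ζ ^ 2 * n * twoNorm D.ξ ^ 2) := mul_le_mul_of_nonneg_left hf.sq hC₁
        _ = _ := by ring
    calc _ ≤ 1 / (n : ℝ) * √(C₁ * (ζ * twoNorm D.ξ) ^ 2 * n) := by gcongr
      _ = 1 / (n : ℝ) * (√C₁ * (ζ * twoNorm D.ξ) * √n) := by
          rw [Real.sqrt_mul (by positivity), Real.sqrt_mul hC₁, Real.sqrt_sq (by positivity)]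
      _ = √C₁ * (ζ * twoNorm D.ξ) * (1 / (n : ℝ) * √n) := by ring
      _ = _ := by rw [hsn3]; ring
  linarith

lemma Regular.sqrt_V_ge (h : D.Regular t C₃ C₄ C₅ σ) : √(C₅ * C₃) * twoNorm D.ξ ≤ √D.V := by
  rw [← Real.sqrt_sq (twoNorm_nonneg D.ξ), ← Real.sqrt_mul (mul_pos h.C₅_pos h.C₃_pos).le]
  exact Real.sqrt_le_sqrt h.le_V

lemma Regular.abs_remainder_le (h : D.Regular t C₃ C₄ C₅ σ) {ζ K C₁ : ℝ} (hζ : 0 ≤ ζ) (hζ1 : ζ ≤ 1)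
    (hK : 0 ≤ K) (hC₁ : 0 ≤ C₁) (hn : 0 < n) (hs₀ : D.s₀ * D.τ ≤ ζ ^ 2)
    (hJ : 0 < D.J.card) (hJc : 0 < D.Jᶜ.card) {s : D.S} (hs : D.GoodEvent ζ t K C₁ s) :
    |D.remainder s| ≤ 2 * (t ^ 2 * C₄ * K * C₁ + 1 + √C₁) / √(C₅ * C₃) * ζ * (1 / √n) := by
  have h1 := h.abs_foldError_le hζ hζ1 hK hC₁ hn hs₀ hJ hs.init hs.load hs.fold
  have h2 := h.abs_foldError_le hζ hζ1 hK hC₁ hn hs₀ hJc hs.init hs.load_compl hs.fold_compl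
  have hV : 0 < √D.V := Real.sqrt_pos.2 h.V_pos
  have hc : 0 < √(C₅ * C₃) := Real.sqrt_pos.2 (mul_pos h.C₅_pos h.C₃_pos)
  have hn' : (0 : ℝ) < n := by exact_mod_cast hn
  have hsn : 0 < √(n : ℝ) := Real.sqrt_pos.2 hn'
  set B := t ^ 2 * C₄ * K * C₁ + 1 + √C₁
  have hB : 0 ≤ B := by have := h.C₄_pos; positivity
  rw [remainder_eq hn, abs_div, abs_of_pos hV, div_le_iff₀ hV]
  calc _ ≤ 2 * (B * ζ * (twoNorm D.ξ / √n)) := (abs_add_le _ _).trans (by linarith)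
    _ = 2 * B / √(C₅ * C₃) * ζ * (1 / √n) * (√(C₅ * C₃) * twoNorm D.ξ) := by field_simp
    _ ≤ _ := by gcongr; exact h.sqrt_V_ge

lemma Vhat_eq (s : D.S) : D.Vhat s = 1 / (n : ℝ) * (
    ∑ i ∈ D.J, (D.score (D.obs i s) + D.loadingError (D.ΩhatJc s) ⬝ᵥ D.X i s) ^ 2
        * (D.resid (D.obs i s) - D.X i s ⬝ᵥ (D.βhat s - D.βbar)) ^ 2
    + ∑ i ∈ D.Jᶜ, (D.score (D.obs i s) + D.loadingError (D.ΩhatJ s) ⬝ᵥ D.X i s) ^ 2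
        * (D.resid (D.obs i s) - D.X i s ⬝ᵥ (D.βhat s - D.βbar)) ^ 2) := by
  have e1 : ∀ i O, D.ξ ⬝ᵥ O *ᵥ D.X i s = D.score (D.obs i s) + D.loadingError O ⬝ᵥ D.X i s :=
    fun i O => dotProduct_mulVec_eq_score_add O (D.X i s) (D.Y i s)
  have e2 : ∀ i, D.Y i s - D.X i s ⬝ᵥ D.βhat s
      = D.resid (D.obs i s) - D.X i s ⬝ᵥ (D.βhat s - D.βbar) := fun i => by
    rw [resid, obs, dotProduct_sub]; ring
  simp only [Vhat, e1, e2]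
  ring

lemma Regular.abs_Vhat_div_sub_one_le (h : D.Regular t C₃ C₄ C₅ σ) {ζ K C₁ : ℝ} (hζ : 0 < ζ)
    (hζ1 : ζ ≤ 1) (hC₁ : 0 ≤ C₁) (hn : 0 < n) (hs₀ : D.s₀ * D.τ ^ 2 ≤ ζ ^ 2)
    {s : D.S} (hs : D.GoodEvent ζ t K C₁ s) :
    |D.Vhat s / D.V - 1|
      ≤ (3 + 6 * (2 + 2 * C₁ + 4 * t ^ 2 * C₄ ^ 2 * C₁) / (C₅ * C₃)) * ζ := by
  have hn' : (0 : ℝ) < n := by exact_mod_cast hn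
  have hV := h.V_pos
  have hx : 0 < twoNorm D.ξ ^ 2 := pow_pos (twoNorm_pos D.ξ_ne_zero) 2
  have hx0 := twoNorm_nonneg D.ξ
  have hL := D.logDim_nonneg
  have ht := h.t_pos.le
  have hcc : 0 < C₅ * C₃ := mul_pos h.C₅_pos h.C₃_pos
  set A := 2 * (t * twoNorm (D.Ωstar *ᵥ D.ξ)) ^ 2 * D.logDim with hA
  set Δ := D.βhat s - D.βbar
  have hfold : ∀ (I : Finset (Fin n)) (v : Fin D.p → ℝ), D.FoldBounds ζ I v s →
      |∑ i ∈ I, (D.score (D.obs i s) + v ⬝ᵥ D.X i s) ^ 2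
          * (D.resid (D.obs i s) - D.X i s ⬝ᵥ Δ) ^ 2
        - ∑ i ∈ I, D.score (D.obs i s) ^ 2 * D.resid (D.obs i s) ^ 2|
      ≤ ζ * ∑ i ∈ I, D.score (D.obs i s) ^ 2 * D.resid (D.obs i s) ^ 2
        + 3 * (1 + 1 / ζ) * ((1 + C₁ + 2 * t ^ 2 * C₄ ^ 2 * C₁) * ζ ^ 2 * n * twoNorm D.ξ ^ 2) := by
    intro I v hv
    refine (abs_sum_sq_sub_le I (fun i => D.score (D.obs i s)) (fun i => v ⬝ᵥ D.X i s)
      (fun i => D.resid (D.obs i s)) (fun i => D.X i s ⬝ᵥ Δ) hζ fun i _ => hs.score i).trans ?_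
    refine add_le_add le_rfl (mul_le_mul_of_nonneg_left ?_ (by positivity))
    have hd : ∑ i ∈ I, (D.X i s ⬝ᵥ Δ) ^ 2 ≤ C₁ * (D.s₀ * D.logDim) :=
      sum_sq_le_of_mem_initialEvent hn hs.init I
    have b1 := hv.resid_sq
    have b2 : A * ∑ i ∈ I, (D.X i s ⬝ᵥ Δ) ^ 2
        ≤ 2 * t ^ 2 * C₄ ^ 2 * C₁ * ζ ^ 2 * n * twoNorm D.ξ ^ 2 := by
      have e1 : D.logDim * D.logDim = n * D.τ ^ 2 := by
        rw [τ, div_pow, Real.sq_sqrt hn'.le]; field_simp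
      calc _ ≤ 2 * (t * (C₄ * twoNorm D.ξ)) ^ 2 * D.logDim * (C₁ * (D.s₀ * D.logDim)) := by
            rw [hA]
            have := twoNorm_nonneg (D.Ωstar *ᵥ D.ξ)
            gcongr
            exact h.twoNorm_Ωstar_mulVec_le D.ξ
        _ = 2 * t ^ 2 * C₄ ^ 2 * C₁ * twoNorm D.ξ ^ 2 * D.s₀ * (D.logDim * D.logDim) := by ring
        _ = 2 * t ^ 2 * C₄ ^ 2 * C₁ * n * twoNorm D.ξ ^ 2 * (D.s₀ * D.τ ^ 2) := by rw [e1]; ring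
        _ ≤ 2 * t ^ 2 * C₄ ^ 2 * C₁ * n * twoNorm D.ξ ^ 2 * ζ ^ 2 := by gcongr
        _ = _ := by ring
    have b3 : (∑ i ∈ I, (v ⬝ᵥ D.X i s) ^ 2) * ∑ i ∈ I, (D.X i s ⬝ᵥ Δ) ^ 2
        ≤ C₁ * ζ ^ 2 * n * twoNorm D.ξ ^ 2 := by
      calc _ ≤ (∑ i ∈ I, (v ⬝ᵥ D.X i s) ^ 2) * (C₁ * (D.s₀ * D.logDim)) := by gcongr
        _ = C₁ * ((∑ i ∈ I, (v ⬝ᵥ D.X i s) ^ 2) * (D.s₀ * D.logDim)) := by ring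
        _ ≤ C₁ * (ζ ^ 2 * n * twoNorm D.ξ ^ 2) := mul_le_mul_of_nonneg_left hv.sq hC₁
        _ = _ := by ring
    linarith
  have h1 := hfold D.J _ hs.fold
  have h2 := hfold D.Jᶜ _ hs.fold_compl
  have h3 := hs.var
  have h4 := Vhat_eq s
  rw [one_div, eq_inv_mul_iff_mul_eq₀ hn'.ne'] at h4
  rw [Finset.sum_sub_distrib, Finset.sum_const, Finset.card_univ, Fintype.card_fin, nsmul_eq_mul,
    ← Finset.sum_add_sum_compl D.J] at h3
  set S1 := ∑ i ∈ D.J, D.score (D.obs i s) ^ 2 * D.resid (D.obs i s) ^ 2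
  set S2 := ∑ i ∈ D.Jᶜ, D.score (D.obs i s) ^ 2 * D.resid (D.obs i s) ^ 2
  set c := 1 + C₁ + 2 * t ^ 2 * C₄ ^ 2 * C₁ with hc
  have hc0 : 0 ≤ c := by positivity
  have h5 : |n * D.Vhat s - n * D.V| ≤ n * (ζ ^ 2 * D.V + ζ * (1 + ζ ^ 2) * D.V
      + 6 * (1 + 1 / ζ) * (c * ζ ^ 2 * twoNorm D.ξ ^ 2)) := by
    have e0 : 3 * (1 + 1 / ζ) * (c * ζ ^ 2 * n * twoNorm D.ξ ^ 2)
        = 3 * (n * ((1 + 1 / ζ) * (c * ζ ^ 2 * twoNorm D.ξ ^ 2))) := by ring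
    have e1 : n * (ζ ^ 2 * D.V + ζ * (1 + ζ ^ 2) * D.V
      + 6 * (1 + 1 / ζ) * (c * ζ ^ 2 * twoNorm D.ξ ^ 2)) = ζ ^ 2 * (n * D.V)
        + ζ * (n * D.V + ζ ^ 2 * (n * D.V))
        + 6 * (n * ((1 + 1 / ζ) * (c * ζ ^ 2 * twoNorm D.ξ ^ 2))) := by ring
    rw [e0] at h1 h2
    rw [h4, e1]
    exact abs_add_sub_le_of_relative hζ.le h1 h2 h3
  have h6 : |D.Vhat s / D.V - 1| = |n * D.Vhat s - n * D.V| / (n * D.V) := by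
    rw [← abs_of_pos (mul_pos hn' hV), ← abs_div, abs_of_pos (mul_pos hn' hV)]
    congr 1; field_simp
  rw [h6, div_le_iff₀ (mul_pos hn' hV)]
  refine h5.trans ?_
  have e1 : (1 + 1 / ζ) * (c * ζ ^ 2 * twoNorm D.ξ ^ 2) = (ζ ^ 2 + ζ) * c * twoNorm D.ξ ^ 2 := by
    field_simp
  have h7 : twoNorm D.ξ ^ 2 ≤ D.V / (C₅ * C₃) := by
    rw [le_div_iff₀ hcc]; linarith [h.le_V]
  have hz2 : ζ ^ 2 ≤ ζ := pow_le_of_le_one hζ.le hζ1 two_ne_zero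
  have hz3 : ζ ^ 2 + ζ ≤ 2 * ζ := by rw [two_mul]; exact add_le_add_left hz2 ζ
  have hz4 : ζ ^ 3 ≤ ζ := pow_le_of_le_one hζ.le hζ1 three_ne_zero
  have h8 : (1 + 1 / ζ) * (c * ζ ^ 2 * twoNorm D.ξ ^ 2) ≤ 2 * ζ * c * (D.V / (C₅ * C₃)) := by
    rw [e1]; gcongr
  have h9 : ζ ^ 2 * D.V + ζ * (1 + ζ ^ 2) * D.V ≤ 3 * ζ * D.V := by
    have e2 : ζ ^ 2 * D.V + ζ * (1 + ζ ^ 2) * D.V = (ζ ^ 2 + ζ + ζ ^ 3) * D.V := by ring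
    have e3 : 3 * ζ = 2 * ζ + ζ := by ring
    rw [e2, e3]
    exact mul_le_mul_of_nonneg_right (add_le_add hz3 hz4) hV.le
  calc _ ≤ n * (3 * ζ * D.V + 6 * (2 * ζ * c * (D.V / (C₅ * C₃)))) := by
        rw [mul_assoc 6]
        gcongr
    _ = _ := by rw [hc]; field_simp; ring

/-! ### Directional errors of the two-stage estimators -/

/-- The set of directional errors `ξᵀ (O - Ω*)` allowed by the error bounds for the two-stage
algorithm. The `ℓ₁` bound controls the noise term under sub-gaussian entries; for sub-gaussian
vectors the `ℓ₂` bound alone suffices. -/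
def errorSet (D : LMModel.{u} n) (c : ℝ) : Set (Fin D.p → ℝ) :=
  {v | oneNorm v ≤ c * D.lam * D.s₁ * oneNorm D.ξ ∧
    twoNorm v ≤ c * D.lam * D.minSparsity * twoNorm D.ξ}

lemma measurableSet_errorSet (D : LMModel.{u} n) (c : ℝ) : MeasurableSet (D.errorSet c) := by
  have h1 : Measurable fun v : Fin D.p → ℝ => oneNorm v := by unfold oneNorm; fun_prop
  have h2 : Measurable fun v : Fin D.p → ℝ => twoNorm v := by unfold twoNorm; fun_prop
  exact (measurableSet_le h1 measurable_const).inter (measurableSet_le h2 measurable_const)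

lemma Regular.s₁col_ne_zero (h : D.Regular t C₃ C₄ C₅ σ) (j : Fin D.p) : D.s₁col j ≠ 0 := by
  intro h0
  have hz : ∀ i, D.Ωstar i j = 0 := by
    intro i
    by_contra hi
    have : i ∈ Finset.univ.filter fun i => D.Ωstar i j ≠ 0 := by simpa using hi
    rw [s₁col, zeroNorm, Finset.card_eq_zero] at h0
    rw [h0] at this
    exact absurd this (Finset.notMem_empty i)
  have h1 : (D.secondMoment * D.Ωstar) j j = 0 := by
    rw [mul_apply]; simp [hz]
  rw [h.secondMoment_mul, one_apply_eq] at h1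
  exact one_ne_zero h1

lemma s₁col_le_s₁ (D : LMModel.{u} n) (j : Fin D.p) : D.s₁col j ≤ D.s₁ :=
  Finset.le_sup (f := D.s₁col) (Finset.mem_univ j)

lemma Regular.one_le_s₁ (h : D.Regular t C₃ C₄ C₅ σ) : (1 : ℝ) ≤ D.s₁ := by
  obtain ⟨j⟩ := D.nonempty_fin
  exact_mod_cast (Nat.one_le_iff_ne_zero.2 (h.s₁col_ne_zero j)).trans (D.s₁col_le_s₁ j)

lemma Regular.s₁ξzero_eq (h : D.Regular t C₃ C₄ C₅ σ) : D.s₁ξzero = zeroNorm D.ξ := by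
  rw [s₁ξzero, zeroNorm]
  congr 1
  ext j
  simp [h.s₁col_ne_zero j]

lemma Regular.one_le_s₁ξzero (h : D.Regular t C₃ C₄ C₅ σ) : (1 : ℝ) ≤ D.s₁ξzero := by
  rw [h.s₁ξzero_eq]
  obtain ⟨j, hj⟩ := Function.ne_iff.1 D.ξ_ne_zero
  have : 0 < zeroNorm D.ξ := Finset.card_pos.2 ⟨j, by simpa using hj⟩
  exact_mod_cast this

/-- `√s₁ ≤ min {√(‖s_{1ξ}‖₀ s₁), s₁}`. -/
lemma Regular.sqrt_s₁_le_minSparsity (h : D.Regular t C₃ C₄ C₅ σ) :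
    √(D.s₁ : ℝ) ≤ D.minSparsity := by
  have h1 := h.one_le_s₁
  refine le_min (Real.sqrt_le_sqrt ?_) ?_
  · nlinarith [h.one_le_s₁ξzero]
  · exact Real.sqrt_le_iff.2 ⟨by linarith, by nlinarith⟩

/-- On the event that `Ω*` approximately inverts the sample second-moment matrix and the latter
satisfies restricted convexity, the two-stage estimator exists and its directional error is
controlled. -/
lemma Regular.loadingError_mem_errorSet (h : D.Regular t C₃ C₄ C₅ σ) {I : Finset (Fin n)} {s : D.S}
    {A₀ κ γ : ℝ} {O : Matrix (Fin D.p) (Fin D.p) ℝ} (hr : 0 < A₀ * D.lam) (hκ : 0 < κ) (hγ : 0 ≤ γ)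
    (hγs : 32 * γ * D.s₁ ≤ κ) (hRC : RestrictedConvexity (D.sampleSecondMoment I s) κ γ)
    (happ : ∀ k l, |(D.sampleSecondMoment I s * D.Ωstar - 1) k l| ≤ A₀ * D.lam / 2)
    (hO : (∃ O, IsTwoStageOutput (D.sampleSecondMoment I s) (A₀ * D.lam) O) →
      IsTwoStageOutput (D.sampleSecondMoment I s) (A₀ * D.lam) O) :
    D.loadingError O ∈ D.errorSet (48 * A₀ / κ) := by
  have := D.nonempty_fin
  have hW := isSymm_sampleSecondMoment I s
  have hpos := quadForm_sampleSecondMoment_nonneg I s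
  have h1 := hO (exists_isTwoStageOutput hW hpos hr D.isSymm_Ωstar happ)
  have h2 := h1.error_bounds hW hpos hr hκ hγ hγs hRC D.isSymm_Ωstar happ
    (fun j => by exact_mod_cast D.s₁col_le_s₁ j) D.ξ
  rw [← h.s₁ξzero_eq] at h2
  refine ⟨h2.1.trans (le_of_eq (by ring)), h2.2.trans (le_of_eq ?_)⟩
  rw [minSparsity]; ring

lemma measurable_loadingError {m : MeasurableSpace D.S} {O : D.S → Matrix (Fin D.p) (Fin D.p) ℝ}
    (hO : ∀ k l, Measurable[m] fun s => O s k l) :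
    Measurable[m] fun s => D.loadingError (O s) := by
  have h1 : Measurable[m] fun s => (fun k l => O s k l : Fin D.p → Fin D.p → ℝ) :=
    @measurable_pi_lambda _ _ _ m _ _ fun k => @measurable_pi_lambda _ _ _ m _ _ fun l => hO k l
  have h2 : Measurable fun A : Fin D.p → Fin D.p → ℝ => D.loadingError (Matrix.of A) := by
    refine measurable_pi_lambda _ fun j => ?_
    simp only [loadingError, vecMul, dotProduct, Matrix.sub_apply, of_apply]
    fun_prop
  exact h2.comp h1

/-- The fold bounds hold with high probability, by conditioning on the other fold. The constant `Q`
bounds the conditional variance of the noise; it enters through `|Q|` since `Q ≥ 0` is not assumed.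
-/
lemma Regular.measure_not_foldBounds_le (h : D.Regular t C₃ C₄ C₅ σ) (hn : 0 < n)
    {I I' : Finset (Fin n)} (hII : Disjoint I I') {O : D.S → Matrix (Fin D.p) (Fin D.p) ℝ}
    (hO : ∀ k l, Measurable[⨆ i ∈ I', MeasurableSpace.comap (D.X i) inferInstance]
      fun s => O s k l) {c Q ζ : ℝ} (hζ : 0 < ζ)
    (hQ : ∀ v ∈ D.errorSet c,
      ∫ z, (v ⬝ᵥ z.1) ^ 2 * D.resid z ^ 2 ∂D.law ≤ Q * twoNorm D.ξ ^ 2) :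
    D.P {s | ¬ D.FoldBounds ζ I (D.loadingError (O s)) s}
      ≤ D.P {s | D.loadingError (O s) ∉ D.errorSet c}
        + (ENNReal.ofReal (C₃⁻¹ * c ^ 2 / ζ ^ 2 * ((D.lam * D.minSparsity) ^ 2 * (D.s₀ * D.logDim)))
        + (ENNReal.ofReal (|Q| / ζ ^ 4) + ENNReal.ofReal (|Q| / ζ ^ 2))) := by
  have hn' : (0 : ℝ) < n := by exact_mod_cast hn
  have hx : 0 < twoNorm D.ξ := twoNorm_pos D.ξ_ne_zero
  have hIn : (I.card : ℝ) ≤ n := by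
    have := Finset.card_le_univ I
    rw [Fintype.card_fin] at this
    exact_mod_cast this
  have hU := measurable_loadingError hO
  have hB := D.measurableSet_errorSet c
  have hsn2 : √(n : ℝ) ^ 2 = n := Real.sq_sqrt hn'.le
  have hsn : 0 < √(n : ℝ) := Real.sqrt_pos.2 hn'
  set v := fun s => D.loadingError (O s)
  have h1 : D.P {s | v s ∈ D.errorSet c ∧ ζ ^ 2 * n * twoNorm D.ξ ^ 2
      < (∑ i ∈ I, (v s ⬝ᵥ D.X i s) ^ 2) * (D.s₀ * D.logDim)}
      ≤ ENNReal.ofReal (C₃⁻¹ * c ^ 2 / ζ ^ 2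
        * ((D.lam * D.minSparsity) ^ 2 * (D.s₀ * D.logDim))) := by
    rcases (mul_nonneg (Nat.cast_nonneg D.s₀) D.logDim_nonneg).eq_or_lt with h0 | h0
    · -- without active coefficients the bound on the quadratic form is vacuous
      have : {s | v s ∈ D.errorSet c ∧ ζ ^ 2 * n * twoNorm D.ξ ^ 2
          < (∑ i ∈ I, (v s ⬝ᵥ D.X i s) ^ 2) * (D.s₀ * D.logDim)} = ∅ := by
        ext s
        simp only [Set.mem_ofPred_eq, Set.mem_empty_iff_false, iff_false, not_and, not_lt, ← h0,
          mul_zero]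
        intro _; positivity
      rw [this]; simp
    · have hc : 0 < ζ ^ 2 * n * twoNorm D.ξ ^ 2 / (D.s₀ * D.logDim) := by positivity
      refine (measure_mono ?_).trans ((h.measure_crossfit_sq_le hII hU
        (b := c * D.lam * D.minSparsity * twoNorm D.ξ) hc).trans (ENNReal.ofReal_le_ofReal ?_))
      · rintro s ⟨hs1, hs2⟩
        exact ⟨hs1.2, ((div_lt_iff₀ h0).2 hs2).le⟩
      · have h3 := (inv_pos.2 h.C₃_pos).le
        calc _ ≤ n * (C₃⁻¹ * (c * D.lam * D.minSparsity * twoNorm D.ξ) ^ 2)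
              / (ζ ^ 2 * n * twoNorm D.ξ ^ 2 / (D.s₀ * D.logDim)) := by gcongr
          _ = _ := by field_simp
  have hQ' : ∀ v ∈ D.errorSet c,
      ∫ z, (v ⬝ᵥ z.1) ^ 2 * D.resid z ^ 2 ∂D.law ≤ |Q| * twoNorm D.ξ ^ 2 := fun v hv =>
    (hQ v hv).trans (mul_le_mul_of_nonneg_right (le_abs_self Q) (sq_nonneg _))
  have h2 : D.P {s | v s ∈ D.errorSet c ∧ ζ ^ 2 * √n * twoNorm D.ξ
      ≤ |∑ i ∈ I, (v s ⬝ᵥ D.X i s) * D.resid (D.obs i s)|} ≤ ENNReal.ofReal (|Q| / ζ ^ 4) := by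
    refine (h.measure_crossfit_sum_mul_resid_le hII hU hB (by positivity) hQ').trans
      (ENNReal.ofReal_le_ofReal ?_)
    calc _ ≤ n * (|Q| * twoNorm D.ξ ^ 2) / (ζ ^ 2 * √n * twoNorm D.ξ) ^ 2 := by gcongr
      _ = _ := by rw [mul_pow, mul_pow, hsn2]; field_simp
  have h3 : D.P {s | v s ∈ D.errorSet c ∧ ζ ^ 2 * n * twoNorm D.ξ ^ 2
      ≤ ∑ i ∈ I, (v s ⬝ᵥ D.X i s) ^ 2 * D.resid (D.obs i s) ^ 2}
      ≤ ENNReal.ofReal (|Q| / ζ ^ 2) := by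
    refine (h.measure_crossfit_sum_sq_mul_resid_le hII hU hB (by positivity) hQ').trans
      (ENNReal.ofReal_le_ofReal ?_)
    calc _ ≤ n * (|Q| * twoNorm D.ξ ^ 2) / (ζ ^ 2 * n * twoNorm D.ξ ^ 2) := by gcongr
      _ = _ := by field_simp
  refine (measure_mono ?_).trans ((measure_union_le _ _).trans (add_le_add le_rfl
    ((measure_union_le _ _).trans (add_le_add h1 ((measure_union_le _ _).trans
      (add_le_add h2 h3))))))
  intro s hs
  by_contra hcon
  simp only [Set.mem_union, Set.mem_ofPred_eq, not_or, not_not, not_and, not_lt, not_le] at hcon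
  obtain ⟨h4, h5, h6, h7⟩ := hcon
  exact hs ⟨h5 h4, (h6 h4).le, (h7 h4).le⟩

lemma measurableSet_initialEvent (D : LMModel.{u} n) (C₁ : ℝ) :
    MeasurableSet (D.initialEvent C₁) := by
  have hb := D.measurable_βhat
  have hX := D.measurable_X
  have h1 : Measurable fun s => oneNorm (D.βhat s - D.βbar) := by
    simp only [oneNorm, Pi.sub_apply]; fun_prop
  have h2 : Measurable fun s =>
      1 / (n : ℝ) * ∑ i, (D.X i s ⬝ᵥ D.βhat s - D.X i s ⬝ᵥ D.βbar) ^ 2 := by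
    simp only [dotProduct]; fun_prop
  exact (measurableSet_le h1 measurable_const).inter (measurableSet_le h2 measurable_const)

end LMModel

/-! ### Asymptotics -/

section Asymptotics

variable {D : (n : ℕ) → LMModel.{u} n} {t C₃ C₄ C₅ σ : ℝ}

/-- An event depending on `n` has probability tending to zero. -/
def Negligible (D : (n : ℕ) → LMModel.{u} n) (q : (n : ℕ) → (D n).S → Prop) : Prop :=
  Tendsto (fun n => (D n).P {s | q n s}) atTop (𝓝 0)

lemma negligible_of_le {q : (n : ℕ) → (D n).S → Prop} {f : ℕ → ℝ≥0∞}
    (hf : Tendsto f atTop (𝓝 0)) (h : ∀ᶠ n in atTop, (D n).P {s | q n s} ≤ f n) :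
    Negligible D q :=
  tendsto_of_tendsto_of_tendsto_of_le_of_le' tendsto_const_nhds hf
    (Eventually.of_forall fun _ => zero_le) h

lemma Negligible.mono {q q' : (n : ℕ) → (D n).S → Prop} (hq : Negligible D q)
    (h : ∀ᶠ n in atTop, ∀ s, q' n s → q n s) : Negligible D q' :=
  negligible_of_le hq (h.mono fun _ hn => measure_mono fun s hs => hn s hs)

lemma Negligible.or {q q' : (n : ℕ) → (D n).S → Prop} (hq : Negligible D q)
    (hq' : Negligible D q') : Negligible D fun n s => q n s ∨ q' n s := by
  refine negligible_of_le (f := fun n => (D n).P {s | q n s} + (D n).P {s | q' n s}) ?_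
    (Eventually.of_forall fun n => measure_union_le _ _)
  simpa using hq.add hq'

lemma tendsto_ofReal_zero {f : ℕ → ℝ} (hf : Tendsto f atTop (𝓝 0)) :
    Tendsto (fun n => ENNReal.ofReal (f n)) atTop (𝓝 0) := by
  simpa using ENNReal.tendsto_ofReal hf

lemma tendsto_exp_neg_logDim (D : (n : ℕ) → LMModel.{u} n) :
    Tendsto (fun n => 2 * Real.exp (-(D n).logDim)) atTop (𝓝 0) := by
  have h1 : Tendsto (fun n : ℕ => 2 * (1 / (n : ℝ))) atTop (𝓝 0) := by
    simpa using tendsto_one_div_atTop_nhds_zero_nat.const_mul (2 : ℝ)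
  refine squeeze_zero' (Eventually.of_forall fun n => by positivity) ?_ h1
  filter_upwards [eventually_gt_atTop 0] with n hn
  have hn' : (0 : ℝ) < n := by exact_mod_cast hn
  rw [Real.exp_neg, one_div]
  gcongr
  exact (D n).n_le_exp_logDim

lemma eventually_one_le_logDim (D : (n : ℕ) → LMModel.{u} n) :
    ∀ᶠ n in atTop, 1 ≤ (D n).logDim := by
  filter_upwards [eventually_ge_atTop 3] with n hn
  rw [← Real.exp_le_exp]
  refine le_trans ?_ (D n).n_le_exp_logDim
  have : (3 : ℝ) ≤ n := by exact_mod_cast hn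
  linarith [Real.exp_one_lt_d9]

lemma LMModel.τ_nonneg {n : ℕ} (D : LMModel.{u} n) : 0 ≤ D.τ :=
  div_nonneg D.logDim_nonneg (Real.sqrt_nonneg _)

lemma LMModel.lam_le_τ {n : ℕ} {D : LMModel.{u} n} (h : 1 ≤ D.logDim) : D.lam ≤ D.τ := by
  rw [LMModel.lam, LMModel.τ, Real.sqrt_div D.logDim_nonneg]
  gcongr
  exact Real.sqrt_le_iff.2 ⟨D.logDim_nonneg, by nlinarith⟩

lemma LMModel.lam_sq_mul_logDim {n : ℕ} (D : LMModel.{u} n) : D.lam ^ 2 * D.logDim = D.τ ^ 2 := by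
  rw [LMModel.lam_sq, LMModel.τ, div_pow, Real.sq_sqrt (Nat.cast_nonneg n)]
  ring

lemma negligible_not_initialEvent {C₁ : ℝ} (h : InitialCondition D C₁) :
    Negligible D fun n s => s ∉ (D n).initialEvent C₁ := by
  obtain ⟨δ, hδ, hP⟩ := h
  refine negligible_of_le (tendsto_ofReal_zero hδ) (Eventually.of_forall fun n => ?_)
  have h1 : {s | s ∉ (D n).initialEvent C₁} = ((D n).initialEvent C₁)ᶜ := rfl
  rw [h1, ← ENNReal.ofReal_toReal (measure_ne_top (D n).P _)]
  refine ENNReal.ofReal_le_ofReal ?_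
  have := probReal_compl_eq_one_sub (μ := (D n).P) ((D n).measurableSet_initialEvent C₁)
  rw [Measure.real] at this
  rw [this]
  linarith [hP n]

lemma negligible_abs_sum_sub_V (hreg : ∀ᶠ n in atTop, (D n).Regular t C₃ C₄ C₅ σ) {ζ : ℝ}
    (hζ : 0 < ζ) : Negligible D fun n s => ζ * (n * (D n).V)
      ≤ |∑ i, ((D n).score ((D n).obs i s) ^ 2 * (D n).resid ((D n).obs i s) ^ 2 - (D n).V)| := by
  have h1 : Tendsto (fun n : ℕ => 48 * (t * C₄ * σ) ^ 4 / (ζ * (C₅ * C₃)) ^ 2 * (1 / (n : ℝ)))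
      atTop (𝓝 0) := by
    simpa only [mul_zero] using (tendsto_one_div_atTop_nhds_zero_nat (𝕜 := ℝ)).const_mul
      (48 * (t * C₄ * σ) ^ 4 / (ζ * (C₅ * C₃)) ^ 2)
  refine negligible_of_le (tendsto_ofReal_zero h1) ?_
  filter_upwards [hreg, eventually_gt_atTop 0] with n h hn
  have hn' : (0 : ℝ) < n := by exact_mod_cast hn
  have hV := h.V_pos
  have hx : 0 < twoNorm (D n).ξ := twoNorm_pos (D n).ξ_ne_zero
  refine (h.measure_abs_sum_sub_V_le (by positivity)).trans (ENNReal.ofReal_le_ofReal ?_)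
  have hC₅ := h.C₅_pos
  have hC₃ := h.C₃_pos
  calc _ ≤ n * (48 * (t * C₄ * σ * twoNorm (D n).ξ) ^ 4)
        / (ζ * (n * (C₅ * C₃ * twoNorm (D n).ξ ^ 2))) ^ 2 := by
        gcongr
        exact h.le_V
    _ = _ := by field_simp

lemma rpow_neg_half {n : ℕ} : (n : ℝ) ^ (-(1 / 2 : ℝ)) = 1 / √n := by
  rw [Real.rpow_neg (Nat.cast_nonneg n), ← Real.sqrt_eq_rpow, one_div]

/-- A variable is `o_p(a_n)` if, for every small `ζ`, it is at most a multiple of `ζ a_n` off a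
negligible event. -/
lemma IsLittleOp.of_negligible {Z : (n : ℕ) → (D n).S → ℝ} {a : ℕ → ℝ} {c : ℝ} (hc : 0 < c)
    (ha : ∀ᶠ n in atTop, 0 ≤ a n) {q : ℝ → (n : ℕ) → (D n).S → Prop}
    (hq : ∀ ζ, 0 < ζ → ζ ≤ 1 → Negligible D (q ζ))
    (h : ∀ ζ, 0 < ζ → ζ ≤ 1 → ∀ᶠ n in atTop, ∀ s, ¬ q ζ n s → |Z n s| ≤ c * ζ * a n) :
    IsLittleOp D Z a := by
  intro ε hε
  have hζ : 0 < min 1 (ε / c) := lt_min one_pos (by positivity)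
  refine (hq _ hζ (min_le_left _ _)).mono ?_
  filter_upwards [h _ hζ (min_le_left _ _), ha] with n hn han s hs
  by_contra hcon
  have h1 := hn s hcon
  rw [abs_of_nonneg han] at hs
  have h2 : c * min 1 (ε / c) ≤ ε := by
    calc c * min 1 (ε / c) ≤ c * (ε / c) := by gcongr; exact min_le_right _ _
      _ = ε := by field_simp
  exact absurd hs (not_lt.2 (h1.trans (mul_le_mul_of_nonneg_right h2 han)))

/-- The conclusion of the theorem, once the two-stage estimators of both folds have controlled
directional errors. -/
lemma resultLM_of_negligible_errorSet {ρ K C₁ c : ℝ} (hK0 : 0 ≤ K) (hK : 256 ≤ ρ * K ^ 2)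
    (hρ : 0 < ρ) (hC₁ : 0 < C₁)
    (hreg : ∀ᶠ n in atTop, (D n).Regular t C₃ C₄ C₅ σ)
    (hsplit : ∀ᶠ n in atTop, (D n).SplitCondition ρ)
    (hinit : InitialCondition D C₁)
    (hlam : Tendsto (fun n => (D n).lam) atTop (𝓝 0))
    (hs₀ : Tendsto (fun n => ((D n).s₀ : ℝ) * (D n).τ) atTop (𝓝 0))
    (hmin : Tendsto (fun n => (D n).minSparsity * √((D n).s₀ : ℝ) * (D n).τ) atTop (𝓝 0))
    {Q : ℕ → ℝ} (hQ0 : Tendsto Q atTop (𝓝 0))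
    (hQ : ∀ᶠ n in atTop, ∀ v ∈ (D n).errorSet c,
      ∫ z, (v ⬝ᵥ z.1) ^ 2 * (D n).resid z ^ 2 ∂(D n).law ≤ Q n * twoNorm (D n).ξ ^ 2)
    (hJ : Negligible D fun n s => (D n).loadingError ((D n).ΩhatJ s) ∉ (D n).errorSet c)
    (hJc : Negligible D fun n s => (D n).loadingError ((D n).ΩhatJc s) ∉ (D n).errorSet c) :
    ResultLM D := by
  -- one regular model suffices for the positivity of the constants
  have hreg0 := hreg.exists.choose_spec
  have ht := hreg0.t_pos
  have hC₄ := hreg0.C₄_pos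
  have hcc : 0 < √(C₅ * C₃) := Real.sqrt_pos.2 (mul_pos hreg0.C₅_pos hreg0.C₃_pos)
  have hcc' := mul_pos hreg0.C₅_pos hreg0.C₃_pos
  have hKl : ∀ᶠ n in atTop, K * (D n).lam ≤ 16 := by
    have : Tendsto (fun n => K * (D n).lam) atTop (𝓝 0) := by simpa using hlam.const_mul K
    exact this.eventually_le_const (by norm_num)
  have hfold0 : ∀ ζ : ℝ, 0 < ζ → Tendsto (fun n => ENNReal.ofReal (C₃⁻¹ * c ^ 2 / ζ ^ 2
      * (((D n).lam * (D n).minSparsity) ^ 2 * ((D n).s₀ * (D n).logDim)))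
      + (ENNReal.ofReal (|Q n| / ζ ^ 4) + ENNReal.ofReal (|Q n| / ζ ^ 2))) atTop (𝓝 0) := by
    intro ζ _
    have e : ∀ n, ((D n).lam * (D n).minSparsity) ^ 2 * ((D n).s₀ * (D n).logDim)
        = ((D n).minSparsity * √((D n).s₀ : ℝ) * (D n).τ) ^ 2 := by
      intro n
      rw [mul_pow _ ((D n).τ), ← LMModel.lam_sq_mul_logDim, mul_pow _ (√_),
        Real.sq_sqrt (Nat.cast_nonneg _)]
      ring
    have h1 := tendsto_ofReal_zero (by
      simpa using (hmin.pow 2).const_mul (C₃⁻¹ * c ^ 2 / ζ ^ 2))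
    have h2 := tendsto_ofReal_zero (by simpa using hQ0.abs.div_const (ζ ^ 4))
    have h3 := tendsto_ofReal_zero (by simpa using hQ0.abs.div_const (ζ ^ 2))
    simp only [e]
    simpa using h1.add (h2.add h3)
  have hgood : ∀ ζ : ℝ, 0 < ζ → ζ ≤ 1 →
      Negligible D fun n s => ¬ (D n).GoodEvent ζ t K C₁ s := by
    intro ζ hζ _
    have n1 := negligible_not_initialEvent hinit
    have n2 : Negligible D fun n s => ∃ k,
        t * twoNorm ((D n).Ωstar *ᵥ (D n).ξ) * t * (K * (D n).lam)
        < |1 / ((D n).J.card : ℝ) * ∑ i ∈ (D n).J, (D n).score ((D n).obs i s) * (D n).X i s k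
          - (D n).ξ k| := by
      refine negligible_of_le (tendsto_ofReal_zero (tendsto_exp_neg_logDim D)) ?_
      filter_upwards [hreg, hsplit, hKl, eventually_gt_atTop 0] with n h hs hl hn
      have hn' : (0 : ℝ) < n := by exact_mod_cast hn
      exact h.measure_loading_le hK0 hK hl hn
        (by exact_mod_cast (mul_pos hρ hn').trans hs.1) hs.1.le
    have n3 : Negligible D fun n s => ∃ k,
        t * twoNorm ((D n).Ωstar *ᵥ (D n).ξ) * t * (K * (D n).lam)
        < |1 / ((D n).Jᶜ.card : ℝ) * ∑ i ∈ (D n).Jᶜ, (D n).score ((D n).obs i s) * (D n).X i s k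
          - (D n).ξ k| := by
      refine negligible_of_le (tendsto_ofReal_zero (tendsto_exp_neg_logDim D)) ?_
      filter_upwards [hreg, hsplit, hKl, eventually_gt_atTop 0] with n h hs hl hn
      have hn' : (0 : ℝ) < n := by exact_mod_cast hn
      exact h.measure_loading_le hK0 hK hl hn
        (by exact_mod_cast (mul_pos hρ hn').trans hs.2) hs.2.le
    have n4 : Negligible D fun n s => ∃ i, 2 * (t * twoNorm ((D n).Ωstar *ᵥ (D n).ξ)) ^ 2
        * (D n).logDim < (D n).score ((D n).obs i s) ^ 2 := by
      refine negligible_of_le (tendsto_ofReal_zero (tendsto_exp_neg_logDim D)) ?_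
      filter_upwards [hreg] with n h
      exact h.measure_score_sq_le
    have n5 := negligible_abs_sum_sub_V hreg (pow_pos hζ 2)
    have n6 : Negligible D fun n s =>
        ¬ (D n).FoldBounds ζ (D n).J ((D n).loadingError ((D n).ΩhatJc s)) s := by
      refine negligible_of_le (by simpa using hJc.add (hfold0 ζ hζ)) ?_
      filter_upwards [hreg, hQ, eventually_gt_atTop 0] with n h hq hn
      exact h.measure_not_foldBounds_le hn disjoint_compl_right (D n).measurable_ΩhatJc hζ hq
    have n7 : Negligible D fun n s =>
        ¬ (D n).FoldBounds ζ (D n).Jᶜ ((D n).loadingError ((D n).ΩhatJ s)) s := by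
      refine negligible_of_le (by simpa using hJ.add (hfold0 ζ hζ)) ?_
      filter_upwards [hreg, hQ, eventually_gt_atTop 0] with n h hq hn
      exact h.measure_not_foldBounds_le hn disjoint_compl_left (D n).measurable_ΩhatJ hζ hq
    refine (n1.or (n2.or (n3.or (n4.or (n5.or (n6.or n7)))))).mono
      (Eventually.of_forall fun n s hs => ?_)
    by_contra hcon
    simp only [not_or, not_not, not_exists, not_lt, not_le] at hcon
    obtain ⟨h1, h2, h3, h4, h5, h6, h7⟩ := hcon
    exact hs ⟨h1, h2, h3, h4, h5.le, h6, h7⟩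
  have hs₀' : ∀ ζ : ℝ, 0 < ζ → ∀ᶠ n in atTop, ((D n).s₀ : ℝ) * (D n).τ ≤ ζ ^ 2 := fun ζ hζ =>
    hs₀.eventually_le_const (by positivity)
  have hs₀'' : ∀ ζ : ℝ, 0 < ζ → ∀ᶠ n in atTop, ((D n).s₀ : ℝ) * (D n).τ ^ 2 ≤ ζ ^ 2 := by
    intro ζ hζ
    have : Tendsto (fun n => (((D n).s₀ : ℝ) * (D n).τ) ^ 2) atTop (𝓝 0) := by
      simpa using hs₀.pow 2
    filter_upwards [this.eventually_le_const (pow_pos hζ 2)] with n hn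
    refine le_trans ?_ hn
    rw [mul_pow]
    refine mul_le_mul_of_nonneg_right ?_ (sq_nonneg _)
    exact_mod_cast Nat.le_self_pow two_ne_zero _
  constructor
  · refine IsLittleOp.of_negligible
      (c := 2 * (t ^ 2 * C₄ * K * C₁ + 1 + √C₁) / √(C₅ * C₃)) (by positivity)
      (Eventually.of_forall fun n => by positivity) hgood fun ζ hζ hζ1 => ?_
    filter_upwards [hreg, hsplit, hs₀' ζ hζ, eventually_gt_atTop 0] with n h hs h0 hn s hg
    have hn' : (0 : ℝ) < n := by exact_mod_cast hn
    rw [rpow_neg_half]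
    exact h.abs_remainder_le hζ.le hζ1 hK0 hC₁.le hn h0
      (by exact_mod_cast (mul_pos hρ hn').trans hs.1)
      (by exact_mod_cast (mul_pos hρ hn').trans hs.2) (not_not.1 hg)
  · refine IsLittleOp.of_negligible
      (c := 3 + 6 * (2 + 2 * C₁ + 4 * t ^ 2 * C₄ ^ 2 * C₁) / (C₅ * C₃)) (by positivity)
      (Eventually.of_forall fun n => zero_le_one) hgood fun ζ hζ hζ1 => ?_
    filter_upwards [hreg, hs₀'' ζ hζ, eventually_gt_atTop 0] with n h h0 hn s hg
    rw [mul_one]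
    exact h.abs_Vhat_div_sub_one_le hζ hζ1 hC₁.le hn h0 (not_not.1 hg)

end Asymptotics

/-! ### Restricted convexity with high probability -/

section Cases

variable {D : (n : ℕ) → LMModel.{u} n} {t C₃ C₄ C₅ σ : ℝ}

lemma eventually_mul_lam_le {K : ℝ} (hlam : Tendsto (fun n => (D n).lam) atTop (𝓝 0)) {b : ℝ}
    (hb : 0 < b) : ∀ᶠ n in atTop, K * (D n).lam ≤ b := by
  have : Tendsto (fun n => K * (D n).lam) atTop (𝓝 0) := by simpa using hlam.const_mul K
  exact this.eventually_le_const hb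

lemma negligible_entries {ρ K : ℝ} (hK0 : 0 ≤ K) (hK : 256 ≤ ρ * K ^ 2) (hρ : 0 < ρ)
    (hreg : ∀ᶠ n in atTop, (D n).Regular t C₃ C₄ C₅ σ)
    (hlam : Tendsto (fun n => (D n).lam) atTop (𝓝 0)) {I : (n : ℕ) → Finset (Fin n)}
    (hI : ∀ᶠ n in atTop, ρ * n < (I n).card) :
    Negligible D fun n s => ∃ k l, t * t * (K * (D n).lam)
      < |((D n).sampleSecondMoment (I n) s - (D n).secondMoment) k l| := by
  refine negligible_of_le (tendsto_ofReal_zero (tendsto_exp_neg_logDim D)) ?_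
  filter_upwards [hreg, hI, eventually_mul_lam_le hlam (K := K) (by norm_num : (0 : ℝ) < 16),
    eventually_gt_atTop 0] with n h hs hl hn
  have hn' : (0 : ℝ) < n := by exact_mod_cast hn
  exact h.measure_entries_le hK0 hK hl hn (by exact_mod_cast (mul_pos hρ hn').trans hs) hs.le

/-- Restricted convexity when only the entries of the covariate vector are sub-gaussian. -/
lemma negligible_not_restrictedConvexity {ρ K : ℝ} (hK0 : 0 ≤ K) (hK : 256 ≤ ρ * K ^ 2)
    (hρ : 0 < ρ) (hreg : ∀ᶠ n in atTop, (D n).Regular t C₃ C₄ C₅ σ)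
    (hlam : Tendsto (fun n => (D n).lam) atTop (𝓝 0)) {I : (n : ℕ) → Finset (Fin n)}
    (hI : ∀ᶠ n in atTop, ρ * n < (I n).card) :
    Negligible D fun n s => ¬ RestrictedConvexity ((D n).sampleSecondMoment (I n) s) C₄⁻¹
      (t * t * (K * (D n).lam)) := by
  refine (negligible_entries hK0 hK hρ hreg hlam hI).mono ?_
  filter_upwards [hreg] with n h s hs
  by_contra! hcon
  exact hs (h.restrictedConvexity_of_entries hcon)

/-- Restricted convexity, with the smaller `ℓ₁` tolerance `λ_n²`, when the covariate vector is
sub-gaussian. -/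
lemma negligible_not_restrictedConvexity_of_directions {ρ K : ℝ} (hK0 : 0 ≤ K)
    (hK : 256 ≤ ρ * K ^ 2) (hρ : 0 < ρ) (hreg : ∀ᶠ n in atTop, (D n).Regular t C₃ C₄ C₅ σ)
    (hdir : ∀ᶠ n in atTop, (D n).SubGaussianDirections t)
    (hlam : Tendsto (fun n => (D n).lam) atTop (𝓝 0)) {I : (n : ℕ) → Finset (Fin n)}
    (hI : ∀ᶠ n in atTop, ρ * n < (I n).card) {δ c : ℝ} (hδ : δ = C₄⁻¹ / 2)
    (hc : c = ρ * δ ^ 2 / (32 * t ^ 4)) :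
    Negligible D fun n s => ¬ RestrictedConvexity ((D n).sampleSecondMoment (I n) s) (C₄⁻¹ / 2)
      (2 * (1 + δ) / c * (D n).lam ^ 2) := by
  have hreg0 := hreg.exists.choose_spec
  have ht := hreg0.t_pos
  have hC₄ := hreg0.C₄_pos
  have hδ0 : 0 < δ := by rw [hδ]; positivity
  have hc0 : 0 < c := by rw [hc]; positivity
  -- there are `(2p)^m` sums of `m` signed basis vectors, so this is the largest order of `m` for
  -- which the union bound survives against probabilities exponentially small in `n`
  set m : ℕ → ℕ := fun n => ⌊c * n / (D n).logDim⌋₊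
  have n1 := negligible_entries hK0 hK hρ hreg hlam hI
  have hexp : Tendsto (fun n : ℕ => Real.exp (-(2 * c * n))) atTop (𝓝 0) := by
    refine Real.tendsto_exp_neg_atTop_nhds_zero.comp ?_
    exact tendsto_natCast_atTop_atTop.const_mul_atTop (by positivity)
  have n2 : Negligible D fun n s => ∃ f : Fin (m n) → Fin (D n).p × Bool,
      (∑ k, signedBasis (f k)) ⬝ᵥ ((D n).sampleSecondMoment (I n) s - (D n).secondMoment
        + δ • (1 : Matrix (Fin (D n).p) (Fin (D n).p) ℝ)) *ᵥ (∑ k, signedBasis (f k)) < 0 := by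
    refine negligible_of_le (tendsto_ofReal_zero hexp) ?_
    filter_upwards [hreg, hdir, hI, eventually_one_le_logDim D, eventually_gt_atTop 0]
      with n h hd hs hL hn
    have hn' : (0 : ℝ) < n := by exact_mod_cast hn
    have hI0 : 0 < (I n).card := by exact_mod_cast (mul_pos hρ hn').trans hs
    refine (h.measure_signedBasis_le hd hδ0.le (m n) hI0).trans (ENNReal.ofReal_le_ofReal ?_)
    have hm : (m n : ℝ) * (D n).logDim ≤ c * n := by
      rw [← le_div_iff₀ (by linarith)]
      exact Nat.floor_le (div_nonneg (by positivity) (by linarith))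
    have hp : ((D n).p * 2 : ℝ) ^ m n ≤ Real.exp (2 * (m n * (D n).logDim)) := by
      have h2 : (2 : ℝ) ≤ Real.exp (D n).logDim := by
        linarith [Real.add_one_le_exp (D n).logDim]
      calc ((D n).p * 2 : ℝ) ^ m n
          ≤ (Real.exp (D n).logDim * Real.exp (D n).logDim) ^ m n := by
            gcongr; exact (D n).p_le_exp_logDim
        _ = _ := by rw [← Real.exp_add, ← Real.exp_nat_mul]; ring_nf
    calc _ ≤ Real.exp (2 * (m n * (D n).logDim))
          * Real.exp (-(ρ * n * (δ ^ 2 / (8 * t ^ 4)))) := by gcongr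
      _ = Real.exp (2 * (m n * (D n).logDim) - 4 * (c * n)) := by
          rw [← Real.exp_add, hc]; congr 1; field_simp; ring
      _ ≤ _ := by gcongr; linarith
  refine (n1.or n2).mono ?_
  have hlam2 : Tendsto (fun n => (D n).lam ^ 2) atTop (𝓝 0) := by simpa using hlam.pow 2
  filter_upwards [hreg, eventually_mul_lam_le hlam (K := t * t * K) one_pos,
    hlam2.eventually_le_const (show 0 < c / 4 by positivity), eventually_one_le_logDim D,
    eventually_gt_atTop 0] with n h hb hl hL hn s hs
  by_contra! hcon
  have hn' : (0 : ℝ) < n := by exact_mod_cast hn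
  have hL0 : 0 < (D n).logDim := by linarith
  rw [LMModel.lam_sq] at hl
  have h4 : 4 ≤ c * n / (D n).logDim := by
    rw [le_div_iff₀ hL0]
    rw [div_le_div_iff₀ hn' (by norm_num)] at hl
    linarith
  have hfl : c * n / (D n).logDim < m n + 1 := Nat.lt_floor_add_one _
  have hm2 : 2 ≤ m n := Nat.le_floor (by push_cast; linarith)
  refine hs fun v => ?_
  have h5 := h.restrictedConvexity_of_signedBasis hm2 (b := 1) (δ := δ)
    (fun k l => (hcon.1 k l).trans (by rw [← mul_assoc]; exact hb)) (fun f => hcon.2 f) v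
  have h6 : (1 + δ) / ((m n : ℝ) - 1) ≤ 2 * (1 + δ) / c * (D n).lam ^ 2 := by
    have h7 : c * n / (D n).logDim / 2 ≤ (m n : ℝ) - 1 := by linarith
    calc (1 + δ) / ((m n : ℝ) - 1) ≤ (1 + δ) / (c * n / (D n).logDim / 2) := by gcongr
      _ = _ := by rw [LMModel.lam_sq]; field_simp
  have h8 : C₄⁻¹ - δ = C₄⁻¹ / 2 := by rw [hδ]; ring
  rw [h8] at h5
  have := mul_le_mul_of_nonneg_right h6 (sq_nonneg (oneNorm v))
  linarith

/-! ### The two sets of assumptions on the covariates -/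

/-- Restricted convexity implies that the two-stage estimator of a fold has a controlled directional
error with high probability. -/
lemma negligible_not_errorSet {ρ K A₀ κ : ℝ} (hK0 : 0 ≤ K) (hK : 256 ≤ ρ * K ^ 2)
    (hρ : 0 < ρ) (hA₀ : 0 < A₀) (hKA : 2 * (t * t * K) ≤ A₀) (hκ : 0 < κ)
    (hreg : ∀ᶠ n in atTop, (D n).Regular t C₃ C₄ C₅ σ)
    (hlam : Tendsto (fun n => (D n).lam) atTop (𝓝 0)) {I : (n : ℕ) → Finset (Fin n)}
    (hI : ∀ᶠ n in atTop, ρ * n < (I n).card)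
    {O : (n : ℕ) → (D n).S → Matrix (Fin (D n).p) (Fin (D n).p) ℝ}
    (hO : ∀ᶠ n in atTop, ∀ s,
      (∃ O, IsTwoStageOutput ((D n).sampleSecondMoment (I n) s) (A₀ * (D n).lam) O) →
        IsTwoStageOutput ((D n).sampleSecondMoment (I n) s) (A₀ * (D n).lam) (O n s))
    {γ : ℕ → ℝ} (hγ : ∀ n, 0 ≤ γ n) (hγs : Tendsto (fun n => γ n * (D n).s₁) atTop (𝓝 0))
    (hRC : Negligible D fun n s =>
      ¬ RestrictedConvexity ((D n).sampleSecondMoment (I n) s) κ (γ n)) :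
    Negligible D fun n s => (D n).loadingError (O n s) ∉ (D n).errorSet (48 * A₀ / κ) := by
  have n1 : Negligible D fun n s => ∃ k l, t * t * (K * (D n).lam)
      < |((D n).sampleSecondMoment (I n) s * (D n).Ωstar - 1) k l| := by
    refine negligible_of_le (tendsto_ofReal_zero (tendsto_exp_neg_logDim D)) ?_
    filter_upwards [hreg, hI, eventually_mul_lam_le hlam (K := K) (by norm_num : (0 : ℝ) < 16),
      eventually_gt_atTop 0] with n h hs hl hn
    have hn' : (0 : ℝ) < n := by exact_mod_cast hn
    exact h.measure_approxInverse_le hK0 hK hl hn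
      (by exact_mod_cast (mul_pos hρ hn').trans hs) hs.le
  refine (n1.or hRC).mono ?_
  filter_upwards [hreg, hO, eventually_one_le_logDim D, eventually_gt_atTop 0,
    hγs.eventually_le_const (show 0 < κ / 32 by positivity)] with n h ho hL hn hg s hs
  by_contra! hcon
  have hn' : (0 : ℝ) < n := by exact_mod_cast hn
  have hlam0 : 0 < (D n).lam := Real.sqrt_pos.2 (div_pos (by linarith) hn')
  refine hs (h.loadingError_mem_errorSet (mul_pos hA₀ hlam0) hκ (hγ n) (by linarith) hcon.2
    (fun k l => (hcon.1 k l).trans ?_) (ho s))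
  nlinarith

/-- The case of sub-gaussian entries. The `ℓ₁` tolerance of restricted convexity is of order `λ_n`,
and `s₁ λ_n → 0` since `‖ξ‖₁ ≥ ‖ξ‖₂`. -/
lemma resultLM_of_entries {ρ K A₀ C₁ : ℝ} (hK0 : 0 ≤ K) (hK : 256 ≤ ρ * K ^ 2)
    (hρ : 0 < ρ) (hA₀ : 0 < A₀) (hKA : 2 * (t * t * K) ≤ A₀) (hC₁ : 0 < C₁)
    (hreg : ∀ᶠ n in atTop, (D n).Regular t C₃ C₄ C₅ σ)
    (hsplit : ∀ᶠ n in atTop, (D n).SplitCondition ρ) (hinit : InitialCondition D C₁)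
    (hO : ∀ᶠ n in atTop, (D n).TwoStage (A₀ * (D n).lam))
    (h : Tendsto (fun n => max ((D n).s₀ : ℝ)
      (max ((D n).s₁ * (oneNorm (D n).ξ / twoNorm (D n).ξ))
        ((D n).minSparsity * √((D n).s₀ : ℝ))) * (D n).τ) atTop (𝓝 0)) :
    ResultLM D := by
  have hreg0 := hreg.exists.choose_spec
  have ht := hreg0.t_pos
  have hC₄ := hreg0.C₄_pos
  set x : ℕ → ℝ := fun n => oneNorm (D n).ξ / twoNorm (D n).ξ
  have hx1 : ∀ n, 1 ≤ x n := fun n =>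
    (one_le_div (twoNorm_pos (D n).ξ_ne_zero)).2 (twoNorm_le_oneNorm _)
  have hmin0 : ∀ n, 0 ≤ (D n).minSparsity := fun n =>
    le_min (Real.sqrt_nonneg _) (Nat.cast_nonneg _)
  have hτ : ∀ n, 0 ≤ (D n).τ := fun n => (D n).τ_nonneg
  have hs₀ : Tendsto (fun n => ((D n).s₀ : ℝ) * (D n).τ) atTop (𝓝 0) :=
    squeeze_zero (fun n => mul_nonneg (Nat.cast_nonneg _) (hτ n))
      (fun n => mul_le_mul_of_nonneg_right (le_max_left _ _) (hτ n)) h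
  have hs₁ : Tendsto (fun n => ((D n).s₁ : ℝ) * x n * (D n).τ) atTop (𝓝 0) :=
    squeeze_zero (fun n => mul_nonneg (mul_nonneg (Nat.cast_nonneg _) (by linarith [hx1 n])) (hτ n))
      (fun n => mul_le_mul_of_nonneg_right ((le_max_left _ _).trans (le_max_right _ _)) (hτ n)) h
  have hmin : Tendsto (fun n => (D n).minSparsity * √((D n).s₀ : ℝ) * (D n).τ) atTop (𝓝 0) :=
    squeeze_zero (fun n => mul_nonneg (mul_nonneg (hmin0 n) (Real.sqrt_nonneg _)) (hτ n))
      (fun n => mul_le_mul_of_nonneg_right ((le_max_right _ _).trans (le_max_right _ _)) (hτ n)) h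
  have hlamx : Tendsto (fun n => (D n).lam * (D n).s₁ * x n) atTop (𝓝 0) := by
    refine squeeze_zero' (Eventually.of_forall fun n => ?_) ?_ hs₁
    · have := hx1 n; have := (D n).lam_nonneg; positivity
    · filter_upwards [eventually_one_le_logDim D] with n hL
      have h1 : 0 ≤ ((D n).s₁ : ℝ) * x n := mul_nonneg (Nat.cast_nonneg _) (by linarith [hx1 n])
      have := mul_le_mul_of_nonneg_left (LMModel.lam_le_τ hL) h1
      linarith
  have hlams : Tendsto (fun n => (D n).lam * (D n).s₁) atTop (𝓝 0) := by
    refine squeeze_zero (fun n => mul_nonneg (D n).lam_nonneg (Nat.cast_nonneg _))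
      (fun n => ?_) hlamx
    exact le_mul_of_one_le_right (mul_nonneg (D n).lam_nonneg (Nat.cast_nonneg _)) (hx1 n)
  have hlam : Tendsto (fun n => (D n).lam) atTop (𝓝 0) := by
    refine squeeze_zero' (Eventually.of_forall fun n => (D n).lam_nonneg) ?_ hlams
    filter_upwards [hreg] with n h
    exact le_mul_of_one_le_right (D n).lam_nonneg h.one_le_s₁
  have hγ : Tendsto (fun n => t * t * (K * (D n).lam) * (D n).s₁) atTop (𝓝 0) := by
    have := hlams.const_mul (t * t * K)
    rw [mul_zero] at this
    exact this.congr fun n => by ring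
  have hγ0 : ∀ n, 0 ≤ t * t * (K * (D n).lam) := fun n => by
    have := (D n).lam_nonneg; positivity
  have hκ : 0 < C₄⁻¹ := inv_pos.2 hC₄
  set c := 48 * A₀ / C₄⁻¹
  have hJ := negligible_not_errorSet hK0 hK hρ hA₀ hKA hκ hreg hlam (hsplit.mono fun n h => h.1)
    (hO.mono fun n h s => (h s).1) hγ0 hγ
    (negligible_not_restrictedConvexity hK0 hK hρ hreg hlam (hsplit.mono fun n h => h.1))
  have hJc := negligible_not_errorSet hK0 hK hρ hA₀ hKA hκ hreg hlam (hsplit.mono fun n h => h.2)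
    (hO.mono fun n h s => (h s).2) hγ0 hγ
    (negligible_not_restrictedConvexity hK0 hK hρ hreg hlam (hsplit.mono fun n h => h.2))
  refine resultLM_of_negligible_errorSet hK0 hK hρ hC₁ hreg hsplit hinit hlam hs₀ hmin
    (Q := fun n => 4 * (t * σ) ^ 2 * c ^ 2 * ((D n).lam * (D n).s₁ * x n) ^ 2) ?_ ?_ hJ hJc
  · simpa using (hlamx.pow 2).const_mul (4 * (t * σ) ^ 2 * c ^ 2)
  · filter_upwards [hreg] with n h v hv
    refine (h.integral_sq_mul_resid_sq_le v).2.trans ?_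
    have h1 := hv.1
    have hξ := twoNorm_pos (D n).ξ_ne_zero
    calc 4 * (t * σ) ^ 2 * oneNorm v ^ 2
        ≤ 4 * (t * σ) ^ 2 * (c * (D n).lam * (D n).s₁ * oneNorm (D n).ξ) ^ 2 := by
          gcongr; exact oneNorm_nonneg v
      _ = _ := by simp only [x]; field_simp

/-- The case of a sub-gaussian covariate vector. The `ℓ₁` tolerance of restricted convexity is of
order `λ_n²`, and `s₁ λ_n² → 0` since `√s₁ ≤ min {√(‖s_{1ξ}‖₀ s₁), s₁}`. -/
lemma resultLM_of_directions {ρ K A₀ C₁ : ℝ} (hK0 : 0 ≤ K) (hK : 256 ≤ ρ * K ^ 2)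
    (hρ : 0 < ρ) (hA₀ : 0 < A₀) (hKA : 2 * (t * t * K) ≤ A₀) (hC₁ : 0 < C₁)
    (hreg : ∀ᶠ n in atTop, (D n).Regular t C₃ C₄ C₅ σ)
    (hdir : ∀ᶠ n in atTop, (D n).SubGaussianDirections t)
    (hsplit : ∀ᶠ n in atTop, (D n).SplitCondition ρ) (hinit : InitialCondition D C₁)
    (hO : ∀ᶠ n in atTop, (D n).TwoStage (A₀ * (D n).lam))
    (h : Tendsto (fun n => max ((D n).s₀ : ℝ)
      ((D n).minSparsity * √(max ((D n).s₀ : ℝ) 1)) * (D n).τ) atTop (𝓝 0)) :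
    ResultLM D := by
  have hreg0 := hreg.exists.choose_spec
  have ht := hreg0.t_pos
  have hC₄ := hreg0.C₄_pos
  have hmin0 : ∀ n, 0 ≤ (D n).minSparsity := fun n =>
    le_min (Real.sqrt_nonneg _) (Nat.cast_nonneg _)
  have hτ : ∀ n, 0 ≤ (D n).τ := fun n => (D n).τ_nonneg
  have hs₀ : Tendsto (fun n => ((D n).s₀ : ℝ) * (D n).τ) atTop (𝓝 0) :=
    squeeze_zero (fun n => mul_nonneg (Nat.cast_nonneg _) (hτ n))
      (fun n => mul_le_mul_of_nonneg_right (le_max_left _ _) (hτ n)) h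
  have hmin1 : Tendsto (fun n => (D n).minSparsity * √(max ((D n).s₀ : ℝ) 1) * (D n).τ)
      atTop (𝓝 0) :=
    squeeze_zero (fun n => mul_nonneg (mul_nonneg (hmin0 n) (Real.sqrt_nonneg _)) (hτ n))
      (fun n => mul_le_mul_of_nonneg_right (le_max_right _ _) (hτ n)) h
  have hmin : Tendsto (fun n => (D n).minSparsity * √((D n).s₀ : ℝ) * (D n).τ) atTop (𝓝 0) :=
    squeeze_zero (fun n => mul_nonneg (mul_nonneg (hmin0 n) (Real.sqrt_nonneg _)) (hτ n))
      (fun n => mul_le_mul_of_nonneg_right (mul_le_mul_of_nonneg_left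
        (Real.sqrt_le_sqrt (le_max_left _ _)) (hmin0 n)) (hτ n)) hmin1
  have hlamm : Tendsto (fun n => (D n).lam * (D n).minSparsity) atTop (𝓝 0) := by
    refine squeeze_zero' (Eventually.of_forall fun n => mul_nonneg (D n).lam_nonneg (hmin0 n)) ?_
      hmin1
    filter_upwards [eventually_one_le_logDim D] with n hL
    have h1 : 1 ≤ √(max ((D n).s₀ : ℝ) 1) := Real.one_le_sqrt.2 (le_max_right _ _)
    calc (D n).lam * (D n).minSparsity ≤ (D n).τ * (D n).minSparsity :=
          mul_le_mul_of_nonneg_right (LMModel.lam_le_τ hL) (hmin0 n)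
      _ = (D n).minSparsity * 1 * (D n).τ := by ring
      _ ≤ _ := mul_le_mul_of_nonneg_right (mul_le_mul_of_nonneg_left h1 (hmin0 n)) (hτ n)
  have hlams : Tendsto (fun n => (D n).lam ^ 2 * (D n).s₁) atTop (𝓝 0) := by
    have h1 : Tendsto (fun n => ((D n).lam * (D n).minSparsity) ^ 2) atTop (𝓝 0) := by
      simpa using hlamm.pow 2
    refine squeeze_zero' (Eventually.of_forall fun n => by positivity) ?_ h1
    filter_upwards [hreg] with n h
    rw [mul_pow]
    refine mul_le_mul_of_nonneg_left ?_ (sq_nonneg _)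
    exact (Real.sqrt_le_left (hmin0 n)).1 h.sqrt_s₁_le_minSparsity
  have hlam : Tendsto (fun n => (D n).lam) atTop (𝓝 0) := by
    refine squeeze_zero' (Eventually.of_forall fun n => (D n).lam_nonneg) ?_ hlamm
    filter_upwards [hreg] with n h
    refine le_mul_of_one_le_right (D n).lam_nonneg ?_
    exact (Real.one_le_sqrt.2 h.one_le_s₁).trans h.sqrt_s₁_le_minSparsity
  set δ := C₄⁻¹ / 2 with hδ
  set a := ρ * δ ^ 2 / (32 * t ^ 4) with ha
  have hκ : 0 < C₄⁻¹ / 2 := by positivity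
  have ha0 : 0 < a := by rw [ha]; positivity
  have hγ : Tendsto (fun n => 2 * (1 + δ) / a * (D n).lam ^ 2 * (D n).s₁) atTop (𝓝 0) := by
    have := hlams.const_mul (2 * (1 + δ) / a)
    rw [mul_zero] at this
    exact this.congr fun n => by ring
  have hγ0 : ∀ n, 0 ≤ 2 * (1 + δ) / a * (D n).lam ^ 2 := fun n => by positivity
  set c := 48 * A₀ / (C₄⁻¹ / 2)
  have hJ := negligible_not_errorSet hK0 hK hρ hA₀ hKA hκ hreg hlam (hsplit.mono fun n h => h.1)
    (hO.mono fun n h s => (h s).1) hγ0 hγ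
    (negligible_not_restrictedConvexity_of_directions hK0 hK hρ hreg hdir hlam
      (hsplit.mono fun n h => h.1) hδ ha)
  have hJc := negligible_not_errorSet hK0 hK hρ hA₀ hKA hκ hreg hlam (hsplit.mono fun n h => h.2)
    (hO.mono fun n h s => (h s).2) hγ0 hγ
    (negligible_not_restrictedConvexity_of_directions hK0 hK hρ hreg hdir hlam
      (hsplit.mono fun n h => h.2) hδ ha)
  refine resultLM_of_negligible_errorSet hK0 hK hρ hC₁ hreg hsplit hinit hlam hs₀ hmin
    (Q := fun n => 4 * (t * σ) ^ 2 * c ^ 2 * ((D n).lam * (D n).minSparsity) ^ 2) ?_ ?_ hJ hJc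
  · simpa using (hlamm.pow 2).const_mul (4 * (t * σ) ^ 2 * c ^ 2)
  · filter_upwards [hreg, hdir] with n h hd v hv
    refine (h.integral_sq_mul_resid_sq_le_twoNorm hd v).trans ?_
    have h1 := hv.2
    calc 4 * (t * σ) ^ 2 * twoNorm v ^ 2
        ≤ 4 * (t * σ) ^ 2 * (c * (D n).lam * (D n).minSparsity * twoNorm (D n).ξ) ^ 2 := by
          gcongr; exact twoNorm_nonneg v
      _ = _ := by ring

end Cases

namespace LMModel

variable {n : ℕ} {D : LMModel.{u} n} {C₃ C₄ C₅ σ₁ σ₂ : ℝ}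

lemma SubGaussianVector.directions (hσ₁ : 0 < σ₁) (h : D.SubGaussianVector σ₁) :
    D.SubGaussianDirections (2 * σ₁) := by
  intro v hv
  refine SubGaussianAt.of_div (subGaussianAt_of_psiTwoNorm_le (σ := σ₁) (by linarith) (by linarith)
    (le_trans ?_ h))
  exact le_iSup₂ (f := fun (a : Fin D.p → ℝ) (_ : a ≠ 0) =>
    psiTwoNorm D.law (fun s => (a ⬝ᵥ s.1) / twoNorm a)) v hv

lemma Ωstar_mulVec_ξ_ne_zero (hC₃ : 0 < C₃) (h : D.EigenvalueBounds C₃ C₄) :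
    D.Ωstar *ᵥ D.ξ ≠ 0 := by
  intro h0
  have := h 0 (Module.End.hasEigenvalue_of_hasEigenvector (x := D.ξ)
    (Module.End.hasEigenvector_iff.2 ⟨Module.End.mem_eigenspace_iff.2 (by simp [h0]), D.ξ_ne_zero⟩))
  linarith [this.1]

lemma regular_of_entries (hσ₁ : 0 < σ₁) (hσ₂ : 0 < σ₂) (hC₃ : 0 < C₃) (hC₄ : 0 < C₄)
    (hC₅ : 0 < C₅) (h1 : D.EigenvalueBounds C₃ C₄) (h2 : D.ResidualCondition σ₂ C₅)
    (h3 : D.SubGaussianPrecisionEntries σ₁) (h4 : D.SubGaussianEntries σ₁) :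
    D.Regular (2 * σ₁) C₃ C₄ C₅ (2 * σ₂) where
  t_pos := by linarith
  C₃_pos := hC₃
  C₄_pos := hC₄
  C₅_pos := hC₅
  σ_pos := by linarith
  eigen := h1
  entry j := subGaussianAt_of_psiTwoNorm_le (by linarith) (by linarith) (h4.1 j)
  precision j := subGaussianAt_of_psiTwoNorm_le (by linarith) (by linarith) (h3 j)
  loading := by
    have := mul_pos hσ₁ (twoNorm_pos (Ωstar_mulVec_ξ_ne_zero hC₃ h1))
    exact subGaussianAt_of_psiTwoNorm_le (by linarith) (by linarith) h4.2
  residual := subGaussianAt_of_psiTwoNorm_le (by linarith) (by linarith) h2.1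
  condVar := h2.2

lemma regular_of_vector (hσ₁ : 0 < σ₁) (hσ₂ : 0 < σ₂) (hC₃ : 0 < C₃) (hC₄ : 0 < C₄)
    (hC₅ : 0 < C₅) (h1 : D.EigenvalueBounds C₃ C₄) (h2 : D.ResidualCondition σ₂ C₅)
    (h3 : D.SubGaussianPrecisionEntries σ₁) (h4 : D.SubGaussianVector σ₁) :
    D.Regular (2 * σ₁) C₃ C₄ C₅ (2 * σ₂) where
  t_pos := by linarith
  C₃_pos := hC₃
  C₄_pos := hC₄
  C₅_pos := hC₅
  σ_pos := by linarith
  eigen := h1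
  entry j := by
    have h5 := h4.directions hσ₁ (Pi.single j 1) (by simp)
    have h6 : twoNorm (Pi.single j 1 : Fin D.p → ℝ) = 1 := by
      simp [twoNorm, Pi.single_apply]
    simpa [h6] using h5
  precision j := subGaussianAt_of_psiTwoNorm_le (by linarith) (by linarith) (h3 j)
  loading := by
    have h5 := h4.directions hσ₁ _ (Ωstar_mulVec_ξ_ne_zero hC₃ h1)
    simp only [← score_eq] at h5
    exact h5
  residual := subGaussianAt_of_psiTwoNorm_le (by linarith) (by linarith) h2.1
  condVar := h2.2

end LMModel

end DebiasedLM

theorem theorem3 (σ₁ ρ : ℝ) (hσ₁ : 0 < σ₁) (hρ : 0 < ρ) (hρ1 : ρ < 1) :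
    ∃ a₀ : ℝ, 0 < a₀ ∧ ∀ A₀ : ℝ, a₀ ≤ A₀ →
      ∀ C₁ C₃ C₄ C₅ σ₂ : ℝ, 0 < C₁ → 0 < C₃ → 0 < C₄ → 0 < C₅ → 0 < σ₂ →
      ∀ D : (n : ℕ) → DebiasedLM.LMModel.{u} n,
      (∀ᶠ n in atTop, (D n).SplitCondition ρ) →
      (∀ᶠ n in atTop, (D n).EigenvalueBounds C₃ C₄) →
      (∀ᶠ n in atTop, (D n).ResidualCondition σ₂ C₅) →
      (∀ᶠ n in atTop, (D n).SubGaussianPrecisionEntries σ₁) →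
      DebiasedLM.InitialCondition D C₁ →
      (∀ᶠ n in atTop, (D n).TwoStage (A₀ * (D n).lam)) →
      ((∀ᶠ n in atTop, (D n).SubGaussianEntries σ₁) →
        Tendsto (fun n =>
          max ((D n).s₀ : ℝ)
            (max ((D n).s₁ * (DebiasedLM.oneNorm (D n).ξ / DebiasedLM.twoNorm (D n).ξ))
              ((D n).minSparsity * √((D n).s₀ : ℝ))) * (D n).τ) atTop (𝓝 0) →
        DebiasedLM.ResultLM D) ∧
      ((∀ᶠ n in atTop, (D n).SubGaussianVector σ₁) →
        Tendsto (fun n =>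
          max ((D n).s₀ : ℝ)
            ((D n).minSparsity * √(max ((D n).s₀ : ℝ) 1)) * (D n).τ) atTop (𝓝 0) →
        DebiasedLM.ResultLM D) := by
  -- `16 / ρ` is a multiple of `λ_n` at which the union bounds over entries hold on both folds; the
  -- scale `2 σ₁` exceeds the `ψ₂`-norms, and the leading factor `2` makes `Ω*` feasible with room
  have hK0 : 0 < 16 / ρ := by positivity
  have hK : 256 ≤ ρ * (16 / ρ) ^ 2 := by
    have : ρ * (16 / ρ) ^ 2 = 256 / ρ := by field_simp; norm_num
    rw [this, le_div_iff₀ hρ]; linarith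
  refine ⟨2 * (2 * σ₁ * (2 * σ₁) * (16 / ρ)), by positivity, ?_⟩
  intro A₀ hA C₁ C₃ C₄ C₅ σ₂ hC₁ hC₃ hC₄ hC₅ hσ₂ D hsplit heig hres hprec hinit hO
  have hA₀ : 0 < A₀ := lt_of_lt_of_le (by positivity) hA
  constructor
  · intro hent hlim
    have hreg : ∀ᶠ n in atTop, (D n).Regular (2 * σ₁) C₃ C₄ C₅ (2 * σ₂) := by
      filter_upwards [heig, hres, hprec, hent] with n h1 h2 h3 h4
      exact DebiasedLM.LMModel.regular_of_entries hσ₁ hσ₂ hC₃ hC₄ hC₅ h1 h2 h3 h4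
    exact DebiasedLM.resultLM_of_entries hK0.le hK hρ hA₀ hA hC₁ hreg hsplit hinit hO hlim
  · intro hvec hlim
    have hreg : ∀ᶠ n in atTop, (D n).Regular (2 * σ₁) C₃ C₄ C₅ (2 * σ₂) := by
      filter_upwards [heig, hres, hprec, hvec] with n h1 h2 h3 h4
      exact DebiasedLM.LMModel.regular_of_vector hσ₁ hσ₂ hC₃ hC₄ hC₅ h1 h2 h3 h4
    exact DebiasedLM.resultLM_of_directions hK0.le hK hρ hA₀ hA hC₁ hreg
      (hvec.mono fun n h => h.directions hσ₁) hsplit hinit hO hlim
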